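/- Let $A=(a_{jk})$ be a complex $\ell\times\ell$ matrix and $\tau\subseteq\{1,\dots,\ell\}$. Let $(\mathfrak h,\Sigma=\{\alpha_j\},\Sigma^\vee=\{\alpha_j^\vee\})$ be a realization of $A$: $\dim\mathfrak h=2\ell-\operatorname{rank}A$, $\Sigma\subset\mathfrak h^*$ and $\Sigma^\vee\subset\mathfrak h$ are linearly independent, and $\langle\alpha_j^\vee,\alpha_k\rangle=a_{jk}$. Let $\tilde{\mathfrak g}(A,\tau)$ be the Lie superalgebra generated by the even vector space $\mathfrak h$ and symbols $\tilde e_j,\tilde f_j$ (odd if and only if $j\in\tau$) with relations $[\mathfrak h,\mathfrak h]=0$, $[h,\tilde e_j]=\alpha_j(h)\tilde e_j$, $[h,\tilde f_j]=-\alpha_j(h)\tilde f_j$, $[\tilde e_j,\tilde f_k]=\delta_{jk}\alpha_j^\vee$. Let $\mathfrak g(A,\tau)$ be its quotient by the maximal ideal having zero intersection with $\mathfrak h$, let $e_j,f_j$ be the images of $\tilde e_j,\tilde f_j$, and let $\Delta\subset\mathfrak h^*\setminus\{0\}$ be the set of roots of $\mathfrak g(A,\tau)$ with respect to $\mathfrak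 h$. For $S\subset\Delta$ let $\Delta^+(S)$ be the set of roots that are finite sums of elements of $S$. The set $S$ is a *root base* if it is linearly independent and $\Delta=\Delta^+(S)\sqcup(-\Delta^+(S))$. A root base $S$ is *contragredient* if there are a Lie superalgebra $\mathfrak g(A',\tau')$, constructed in the same way from a matrix $A'$, a set $\tau'$ and a realization $(\mathfrak h',\Sigma',\Sigma'^\vee)$, and an isomorphism of Lie superalgebras $\phi:\mathfrak g(A,\tau)\to\mathfrak g(A',\tau')$ with $\phi(\mathfrak h)=\mathfrak h'$ and $\phi^*(\Sigma')=S$. A root base $S$ is *reflectable* at $\alpha\in\Delta^+(S)$ if there is a root base $S'$ with $\Delta^+(S)\setminus\mathbb Z_{>0}\alpha=\Delta^+(S')\setminus\mathbb Z_{>0}(-\alpha)$; then we write $S'=r_\alpha S$, and we put $r_\alpha(\alpha)=-\alpha$ and $r_\alpha(\beta)=\beta+s\alpha$, $s=\max\{n\in\mathbb Z:\beta+n\alpha\in\Delta\}$, for $\beta\in S\setminus\{\alpha\}$. Fix $i\in\{1,\dots,\ell\}$ and consider the conditions: * (a) $\Sigma$ is reflectable at $\alpha_i$ and $r_{\alpha_i}\Sigma$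 is a contragredient base; * (b) $\Sigma$ is reflectable at $\alpha_i$; * (c) $e_i$ and $f_i$ are $\operatorname{ad}$-locally nilpotent; * (d) the following three conditions hold: (A1) if $a_{ii}=0$ and $i\notin\tau$, then $a_{ij}=0$ for all $j$; (A2) for all $j$, $a_{ij}=0$ implies $a_{ji}=0$; (A3) if $a_{ii}\neq0$, then for all $j\ne i$ one has $2a_{ij}/a_{ii}\in\mathbb Z_{\le0}$ when $i\notin\tau$, and $a_{ij}/a_{ii}\in\mathbb Z_{\le0}$ when $i\in\tau$. Then: 1. (a) $\Rightarrow$ (b) $\Rightarrow$ (c). 2. If $a_{ii}\ne0$, then (a), (b), (c), (d) are equivalent. Moreover, if $\Sigma$ is reflectable at $\alpha_i$, then for all $j$ one has $r_{\alpha_i}(\alpha_j)=s_{\alpha_i}(\alpha_j):=\alpha_j-\frac{2a_{ij}}{a_{ii}}\alpha_i$, and $r_{\alpha_i}\Sigma=\{s_{\alpha_i}(\alpha_j)\}_{j=1}^{\ell}$. 3. If $a_{ii}=0$, then: * (P1) if $i\notin\tau$, then (c) holds if and only if $a_{ij}=0$ for all $j$; * (P2) if $i\in\tau$, then (c) holds;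 * (P3) (a) $\Leftrightarrow$ (d). Moreover, when these hold, $r_{\alpha_i}(\alpha_j)=\alpha_j'$ for all $j$ and $r_{\alpha_i}\Sigma=\{\alpha_j'\}_{j=1}^{\ell}$, where $\alpha'_i=-\alpha_i$, $\alpha_j'=\alpha_j$ if $j\ne i$ and $a_{ij}=0$, and $\alpha'_j=\alpha_j+\alpha_i$ if $a_{ij}\ne0$. -/

import Mathlib

noncomputable section

namespace SuperLie

universe u v

/-! ### Lie superalgebras over the complex numbers -/

/-- A complex superalgebra, with no identities required: a `ℤ/2`-graded complex vector space
`V = V₀ ⊕ V₁` with a bilinear operation respecting the grading. -/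
class Superalgebra (V : Type v) [AddCommGroup V] [Module ℂ V] where
  bracket : V →ₗ[ℂ] V →ₗ[ℂ] V
  part : ZMod 2 → Submodule ℂ V
  isCompl : IsCompl (part 0) (part 1)
  bracket_mem : ∀ {i j : ZMod 2} {x y : V}, x ∈ part i → y ∈ part j → bracket x y ∈ part (i + j)

open Superalgebra

/-- The Koszul sign `(-1)^(ij)`. -/
def koszul (i j : ZMod 2) : ℂ := if i = 1 ∧ j = 1 then -1 else 1

/-- A complex Lie superalgebra. -/
class LieSuperalgebra (L : Type v) [AddCommGroup L] [Module ℂ L] extends Superalgebra L where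
  skew : ∀ {i j : ZMod 2} {x y : L}, x ∈ part i → y ∈ part j →
    bracket x y = -(koszul i j • bracket y x)
  jacobi : ∀ {i j k : ZMod 2} {x y z : L}, x ∈ part i → y ∈ part j → z ∈ part k →
    bracket x (bracket y z) = bracket (bracket x y) z + koszul i j • bracket y (bracket x z)

/-- A (two-sided, `ℤ/2`-graded) ideal of a superalgebra. -/
structure IsIdeal {V : Type v} [AddCommGroup V] [Module ℂ V] [Superalgebra V]
    (I : Submodule ℂ V) : Prop where
  left : ∀ (x : V) {y : V}, y ∈ I → bracket x y ∈ I
  right : ∀ {x : V} (y : V), x ∈ I → bracket x y ∈ I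
  graded : I ≤ (I ⊓ part 0) ⊔ (I ⊓ part 1)

section ideals

variable {V : Type v} [AddCommGroup V] [Module ℂ V] [Superalgebra V]

theorem eq_of_add_eq_add {y z y' z' : V} (hy : y ∈ part (V := V) 0) (hz : z ∈ part (V := V) 1)
    (hy' : y' ∈ part (V := V) 0) (hz' : z' ∈ part (V := V) 1) (h : y + z = y' + z') :
    y = y' ∧ z = z' := by
  have h1 : y - y' = z' - z := by
    have : y - y' - (z' - z) = (y + z) - (y' + z') := by abel
    rw [h, sub_self] at this
    exact sub_eq_zero.1 this
  have h0 : y - y' = 0 := by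
    refine (Submodule.disjoint_def.1 (isCompl (V := V)).disjoint) _ (sub_mem hy hy') ?_
    rw [h1]
    exact sub_mem hz' hz
  refine ⟨sub_eq_zero.1 h0, ?_⟩
  rw [h0] at h1
  exact (sub_eq_zero.1 h1.symm).symm

theorem IsIdeal.split {I : Submodule ℂ V} (hI : IsIdeal I) {y z : V} (hy : y ∈ part (V := V) 0)
    (hz : z ∈ part (V := V) 1) (h : y + z ∈ I) : y ∈ I ∧ z ∈ I := by
  obtain ⟨y', hy', z', hz', he⟩ := Submodule.mem_sup.1 (hI.graded h)
  obtain ⟨rfl, rfl⟩ := eq_of_add_eq_add hy hz hy'.2 hz'.2 he.symm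
  exact ⟨hy'.1, hz'.1⟩

theorem isIdeal_sInf (S : Set (Submodule ℂ V)) (hS : ∀ I ∈ S, IsIdeal I) : IsIdeal (sInf S) where
  left x y hy := by
    rw [Submodule.mem_sInf] at hy ⊢
    exact fun I hI => (hS I hI).left x (hy I hI)
  right {x} y hx := by
    rw [Submodule.mem_sInf] at hx ⊢
    exact fun I hI => (hS I hI).right y (hx I hI)
  graded := by
    intro x hx
    obtain ⟨y, hy, z, hz, rfl⟩ :=
      Submodule.mem_sup.1 (show x ∈ part 0 ⊔ part 1 by rw [isCompl.sup_eq_top]; trivial)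
    rw [Submodule.mem_sInf] at hx
    refine Submodule.mem_sup.2 ⟨y, ⟨?_, hy⟩, z, ⟨?_, hz⟩, rfl⟩
    · exact Submodule.mem_sInf.2 fun I hI => ((hS I hI).split hy hz (hx I hI)).1
    · exact Submodule.mem_sInf.2 fun I hI => ((hS I hI).split hy hz (hx I hI)).2

theorem isIdeal_sSup (S : Set (Submodule ℂ V)) (hS : ∀ I ∈ S, IsIdeal I) : IsIdeal (sSup S) where
  left x y hy := by
    have : sSup S ≤ (sSup S).comap (bracket x) :=
      sSup_le fun I hI y hy => (le_sSup hI : I ≤ sSup S) ((hS I hI).left x hy)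
    exact this hy
  right {x} y hx := by
    have : sSup S ≤ (sSup S).comap (bracket.flip y) :=
      sSup_le fun I hI x hx => (le_sSup hI : I ≤ sSup S) ((hS I hI).right y hx)
    exact this hx
  graded := sSup_le fun I hI => (hS I hI).graded.trans <|
    sup_le_sup (inf_le_inf_right _ (le_sSup hI)) (inf_le_inf_right _ (le_sSup hI))

/-- The quotient of a superalgebra by an ideal. -/
@[reducible] def quotientSuperalgebra (I : Submodule ℂ V) (hI : IsIdeal I) :
    Superalgebra (V ⧸ I) where
  bracket := LinearMap.liftQ₂ I I (bracket.compr₂ I.mkQ)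
    (fun x hx => by
      ext y
      simpa using hI.right y hx)
    (fun y hy => by
      ext x
      simpa using hI.left x hy)
  part k := (part k).map I.mkQ
  isCompl := by
    constructor
    · rw [Submodule.disjoint_def]
      rintro _ ⟨y, hy, rfl⟩ ⟨z, hz, h⟩
      have h1 : y + -z ∈ I := by
        rw [← sub_eq_add_neg]
        exact (Submodule.Quotient.eq I).1 h.symm
      simpa using (hI.split hy (neg_mem hz) h1).1
    · rw [codisjoint_iff, ← Submodule.map_sup, isCompl.sup_eq_top, Submodule.map_top,
        Submodule.range_mkQ]
  bracket_mem := by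
    rintro i j _ _ ⟨x, hx, rfl⟩ ⟨y, hy, rfl⟩
    exact ⟨bracket x y, bracket_mem hx hy, rfl⟩

/-- The quotient of a Lie superalgebra by an ideal. -/
@[reducible] def quotientLieSuperalgebra {L : Type v} [AddCommGroup L] [Module ℂ L]
    [LieSuperalgebra L] (I : Submodule ℂ L) (hI : IsIdeal I) : LieSuperalgebra (L ⧸ I) where
  toSuperalgebra := quotientSuperalgebra I hI
  skew := by
    rintro i j _ _ ⟨x, hx, rfl⟩ ⟨y, hy, rfl⟩
    exact congrArg I.mkQ (LieSuperalgebra.skew hx hy)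
  jacobi := by
    rintro i j k _ _ _ ⟨x, hx, rfl⟩ ⟨y, hy, rfl⟩ ⟨z, hz, rfl⟩
    exact congrArg I.mkQ (LieSuperalgebra.jacobi hx hy hz)

end ideals

/-! ### Cartan data, realizations, contragredient Lie superalgebras -/

/-- A realization `(𝔥, Σ, Σᵛ)` of a complex `ℓ × ℓ`-matrix `A`. -/
structure Realization {ℓ : ℕ} (A : Matrix (Fin ℓ) (Fin ℓ) ℂ) (H : Type u) [AddCommGroup H]
    [Module ℂ H] where
  finiteDimensional : FiniteDimensional ℂ H
  finrank_add_rank : Module.finrank ℂ H + A.rank = 2 * ℓ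
  root : Fin ℓ → Module.Dual ℂ H
  coroot : Fin ℓ → H
  linearIndependent_root : LinearIndependent ℂ root
  linearIndependent_coroot : LinearIndependent ℂ coroot
  root_coroot : ∀ i j, root j (coroot i) = A i j

/-- The symbols generating the half-baked Lie superalgebra. -/
inductive Gen (ℓ : ℕ) (H : Type u) : Type u
  | cartan : H → Gen ℓ H
  | e : Fin ℓ → Gen ℓ H
  | f : Fin ℓ → Gen ℓ H

section construction

variable {ℓ : ℕ}

/-- The parity of a generator: `ẽᵢ` and `f̃ᵢ` are odd if and only if `i ∈ τ`. -/
def Gen.parity {H : Type u} (τ : Finset (Fin ℓ)) : Gen ℓ H → ZMod 2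
  | .cartan _ => 0
  | .e i => if i ∈ τ then 1 else 0
  | .f i => if i ∈ τ then 1 else 0

/-- The parity of a nonassociative word in the generators. -/
def wordParity {H : Type u} (τ : Finset (Fin ℓ)) : FreeMagma (Gen ℓ H) → ZMod 2
  | .of g => g.parity τ
  | .mul v w => wordParity τ v + wordParity τ w

/-- The free nonassociative complex algebra on the generators, graded by `τ`. -/
def FreeSuper (_ : Finset (Fin ℓ)) (H : Type u) : Type u :=
  FreeNonUnitalNonAssocAlgebra ℂ (Gen ℓ H)

variable (τ : Finset (Fin ℓ)) {A : Matrix (Fin ℓ) (Fin ℓ) ℂ} {H : Type u}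

instance : AddCommGroup (FreeSuper τ H) :=
  inferInstanceAs (AddCommGroup (FreeNonUnitalNonAssocAlgebra ℂ (Gen ℓ H)))

instance : Module ℂ (FreeSuper τ H) :=
  inferInstanceAs (Module ℂ (FreeNonUnitalNonAssocAlgebra ℂ (Gen ℓ H)))

/-- A linear combination of words is of parity `k` if all the words in it are. -/
def FreeSuper.part (k : ZMod 2) : Submodule ℂ (FreeNonUnitalNonAssocAlgebra ℂ (Gen ℓ H)) :=
  MonoidAlgebra.supported ℂ ℂ {w : FreeMagma (Gen ℓ H) | wordParity τ w = k}

theorem FreeSuper.mul_mem {i j : ZMod 2} {x y : FreeNonUnitalNonAssocAlgebra ℂ (Gen ℓ H)}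
    (hx : x ∈ FreeSuper.part τ i) (hy : y ∈ FreeSuper.part τ j) :
    x * y ∈ FreeSuper.part τ (i + j) := by
  unfold FreeSuper.part at hx hy
  rw [MonoidAlgebra.supported_eq_span_single] at hx hy
  induction hx using Submodule.span_induction with
  | zero => simp
  | add a b _ _ ha hb => rw [add_mul]; exact add_mem ha hb
  | smul c a _ ha => rw [smul_mul_assoc]; exact Submodule.smul_mem _ c ha
  | mem x hx =>
    obtain ⟨v, hv, rfl⟩ := hx
    induction hy using Submodule.span_induction with
    | zero => simp
    | add a b _ _ ha hb => rw [mul_add]; exact add_mem ha hb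
    | smul c a _ ha => rw [mul_smul_comm]; exact Submodule.smul_mem _ c ha
    | mem y hy =>
      obtain ⟨w, hw, rfl⟩ := hy
      unfold FreeSuper.part
      rw [MonoidAlgebra.supported_eq_span_single]
      refine Submodule.subset_span ⟨v * w, ?_, by simp [MonoidAlgebra.single_mul_single]⟩
      rw [Set.mem_ofPred_eq] at hv hw ⊢
      rw [← hv, ← hw]
      rfl

theorem FreeSuper.isCompl_part :
    IsCompl (FreeSuper.part (H := H) τ 0) (FreeSuper.part (H := H) τ 1) := by
  have hdisj : Disjoint {w : FreeMagma (Gen ℓ H) | wordParity τ w = 0}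
      {w : FreeMagma (Gen ℓ H) | wordParity τ w = 1} := by
    rw [Set.disjoint_left]
    intro w h0 h1
    rw [Set.mem_ofPred_eq] at h0 h1
    rw [h0] at h1
    exact absurd h1 (by decide)
  have hcod : Codisjoint {w : FreeMagma (Gen ℓ H) | wordParity τ w = 0}
      {w : FreeMagma (Gen ℓ H) | wordParity τ w = 1} := by
    rw [codisjoint_iff]
    refine Set.eq_univ_iff_forall.2 fun w => ?_
    have : ∀ k : ZMod 2, k = 0 ∨ k = 1 := by decide
    exact this _
  have h := IsCompl.mk (Finsupp.disjoint_supported_supported (M := ℂ) (R := ℂ) hdisj)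
    (Finsupp.codisjoint_supported_supported (M := ℂ) (R := ℂ) hcod)
  exact h.map (Submodule.orderIsoMapComap
    (MonoidAlgebra.coeffLinearEquiv (S := ℂ) (M := FreeMagma (Gen ℓ H)) ℂ)).symm

instance : Superalgebra (FreeSuper τ H) where
  bracket := LinearMap.mul ℂ (FreeNonUnitalNonAssocAlgebra ℂ (Gen ℓ H))
  part := FreeSuper.part τ
  isCompl := FreeSuper.isCompl_part τ
  bracket_mem := FreeSuper.mul_mem τ

/-- The generators as elements of the free superalgebra. -/
def FreeSuper.gen (g : Gen ℓ H) : FreeSuper τ H := FreeNonUnitalNonAssocAlgebra.of ℂ g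

variable [AddCommGroup H] [Module ℂ H] (R : Realization A H)

/-- The relations of the half-baked Lie superalgebra: each listed element is set to zero. The
first two are the Lie superalgebra identities, the next two make `𝔥` a vector space. -/
inductive Rel : FreeSuper τ H → Prop
  | skew {i j : ZMod 2} {x y : FreeSuper τ H} : x ∈ part i → y ∈ part j →
      Rel (bracket x y + koszul i j • bracket y x)
  | jacobi {i j k : ZMod 2} {x y z : FreeSuper τ H} : x ∈ part i → y ∈ part j → z ∈ part k →
      Rel (bracket x (bracket y z) -
        (bracket (bracket x y) z + koszul i j • bracket y (bracket x z)))
  | cartan_add (h h' : H) :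
      Rel (FreeSuper.gen τ (.cartan (h + h')) -
        (FreeSuper.gen τ (.cartan h) + FreeSuper.gen τ (.cartan h')))
  | cartan_smul (c : ℂ) (h : H) :
      Rel (FreeSuper.gen τ (.cartan (c • h)) - c • FreeSuper.gen τ (.cartan h))
  | cartan_cartan (h h' : H) :
      Rel (bracket (FreeSuper.gen τ (.cartan h)) (FreeSuper.gen τ (.cartan h')))
  | cartan_e (h : H) (i : Fin ℓ) :
      Rel (bracket (FreeSuper.gen τ (.cartan h)) (FreeSuper.gen τ (.e i)) -
        R.root i h • FreeSuper.gen τ (.e i))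
  | cartan_f (h : H) (i : Fin ℓ) :
      Rel (bracket (FreeSuper.gen τ (.cartan h)) (FreeSuper.gen τ (.f i)) +
        R.root i h • FreeSuper.gen τ (.f i))
  | e_f_same (i : Fin ℓ) :
      Rel (bracket (FreeSuper.gen τ (.e i)) (FreeSuper.gen τ (.f i)) -
        FreeSuper.gen τ (.cartan (R.coroot i)))
  | e_f_ne (i j : Fin ℓ) : i ≠ j →
      Rel (bracket (FreeSuper.gen τ (.e i)) (FreeSuper.gen τ (.f j)))

/-- The ideal generated by the relations. -/
def relIdeal : Submodule ℂ (FreeSuper τ H) :=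
  sInf {I | IsIdeal I ∧ ∀ x, Rel τ R x → x ∈ I}

theorem isIdeal_relIdeal : IsIdeal (relIdeal τ R) := isIdeal_sInf _ fun _ hI => hI.1

theorem rel_mem {x : FreeSuper τ H} (hx : Rel τ R x) : x ∈ relIdeal τ R :=
  Submodule.mem_sInf.2 fun _ hI => hI.2 x hx

/-- The half-baked Lie superalgebra `𝔤̃(A, τ)`. -/
def HalfBaked : Type u := FreeSuper τ H ⧸ relIdeal τ R

instance : AddCommGroup (HalfBaked τ R) :=
  inferInstanceAs (AddCommGroup (FreeSuper τ H ⧸ relIdeal τ R))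

instance : Module ℂ (HalfBaked τ R) :=
  inferInstanceAs (Module ℂ (FreeSuper τ H ⧸ relIdeal τ R))

/-- The class of a generator. -/
def HalfBaked.gen (g : Gen ℓ H) : HalfBaked τ R := (relIdeal τ R).mkQ (FreeSuper.gen τ g)

instance : LieSuperalgebra (HalfBaked τ R) where
  toSuperalgebra := quotientSuperalgebra (relIdeal τ R) (isIdeal_relIdeal τ R)
  skew := by
    rintro i j _ _ ⟨x, hx, rfl⟩ ⟨y, hy, rfl⟩
    rw [eq_neg_iff_add_eq_zero]
    exact (Submodule.Quotient.mk_eq_zero _).2 (rel_mem τ R (.skew hx hy))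
  jacobi := by
    rintro i j k _ _ _ ⟨x, hx, rfl⟩ ⟨y, hy, rfl⟩ ⟨z, hz, rfl⟩
    rw [← sub_eq_zero]
    exact (Submodule.Quotient.mk_eq_zero _).2 (rel_mem τ R (.jacobi hx hy hz))

/-- The canonical map `𝔥 → 𝔤̃(A, τ)`. -/
def HalfBaked.cartan : H →ₗ[ℂ] HalfBaked τ R where
  toFun h := HalfBaked.gen τ R (.cartan h)
  map_add' h h' := (Submodule.Quotient.eq _).2 (rel_mem τ R (.cartan_add h h'))
  map_smul' c h := (Submodule.Quotient.eq _).2 (rel_mem τ R (.cartan_smul c h))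

/-- The maximal ideal of `𝔤̃(A, τ)` with zero intersection with `𝔥`: the sum of all such ideals. -/
def maxIdeal : Submodule ℂ (HalfBaked τ R) :=
  sSup {I | IsIdeal I ∧ I ⊓ LinearMap.range (HalfBaked.cartan τ R) = ⊥}

theorem isIdeal_maxIdeal : IsIdeal (maxIdeal τ R) := isIdeal_sSup _ fun _ hI => hI.1

/-- The contragredient Lie superalgebra `𝔤(A, τ)`. -/
def Contragredient : Type u := HalfBaked τ R ⧸ maxIdeal τ R

instance : AddCommGroup (Contragredient τ R) :=
  inferInstanceAs (AddCommGroup (HalfBaked τ R ⧸ maxIdeal τ R))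

instance : Module ℂ (Contragredient τ R) :=
  inferInstanceAs (Module ℂ (HalfBaked τ R ⧸ maxIdeal τ R))

instance : LieSuperalgebra (Contragredient τ R) :=
  quotientLieSuperalgebra (maxIdeal τ R) (isIdeal_maxIdeal τ R)

namespace Contragredient

/-- The canonical map `𝔥 → 𝔤(A, τ)`. -/
def cartan : H →ₗ[ℂ] Contragredient τ R := (maxIdeal τ R).mkQ ∘ₗ HalfBaked.cartan τ R

/-- The Chevalley generator `eᵢ`. -/
def e (i : Fin ℓ) : Contragredient τ R := (maxIdeal τ R).mkQ (HalfBaked.gen τ R (.e i))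

/-- The Chevalley generator `fᵢ`. -/
def f (i : Fin ℓ) : Contragredient τ R := (maxIdeal τ R).mkQ (HalfBaked.gen τ R (.f i))

/-- The space `𝔤_α = {x | [h, x] = α(h) x for all h ∈ 𝔥}`. -/
def rootSpace (α : Module.Dual ℂ H) : Submodule ℂ (Contragredient τ R) :=
  ⨅ h : H, Module.End.eigenspace (bracket (cartan τ R h)) (α h)

/-- The root system `Δ`. -/
def roots : Set (Module.Dual ℂ H) := {α | α ≠ 0 ∧ rootSpace τ R α ≠ ⊥}

end Contragredient

end construction

/-! ### Root bases and reflexions -/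

section bases

variable {V : Type v} [AddCommGroup V] [Module ℂ V]

/-- `Δ⁺(S)`: the elements of `Δ` that are sums of elements of `S`. -/
def positiveRoots (Δ S : Set V) : Set V := Δ ∩ (AddSubmonoid.closure S : Set V)

/-- `S` is a root base of `Δ`. -/
structure IsRootBase (Δ S : Set V) : Prop where
  subset : S ⊆ Δ
  linearIndependent : LinearIndependent ℂ (fun x : S => (x : V))
  eq_union : Δ = positiveRoots Δ S ∪ {α | -α ∈ positiveRoots Δ S}
  disjoint : Disjoint (positiveRoots Δ S) {α | -α ∈ positiveRoots Δ S}

/-- The multiples of `α` by strictly positive integers. -/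
def positiveMultiples (α : V) : Set V := {β | ∃ n : ℕ, 0 < n ∧ β = n • α}

/-- `S' = r_α S`, for a root base `S` and a root `α ∈ Δ⁺(S)`. -/
structure IsReflexion (Δ S : Set V) (α : V) (S' : Set V) : Prop where
  source : IsRootBase Δ S
  mem : α ∈ positiveRoots Δ S
  target : IsRootBase Δ S'
  diff_eq : positiveRoots Δ S \ positiveMultiples α =
    positiveRoots Δ S' \ positiveMultiples (-α)

/-- `S` is reflectable at `α`. -/
def ReflectableAt (Δ S : Set V) (α : V) : Prop := ∃ S' : Set V, IsReflexion Δ S α S'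

/-- `γ = r_α(β)`, the image of an element `β` of a base under the correspondence `r_α`:
`r_α(α) = -α`, and `r_α(β) = β + sα` with `s = max {n | β + nα ∈ Δ}` for `β ≠ α`. -/
def IsReflexionValue (Δ : Set V) (α β γ : V) : Prop :=
  (β = α ∧ γ = -α) ∨
    (β ≠ α ∧ ∃ s : ℤ, IsGreatest {n : ℤ | β + n • α ∈ Δ} s ∧ γ = β + s • α)

end bases

/-- Isomorphisms of Lie superalgebras. -/
structure IsSuperIso {L : Type u} {L' : Type v} [AddCommGroup L] [Module ℂ L] [LieSuperalgebra L]
    [AddCommGroup L'] [Module ℂ L'] [LieSuperalgebra L'] (φ : L ≃ₗ[ℂ] L') : Prop where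
  map_bracket : ∀ x y : L, φ (bracket x y) = bracket (φ x) (φ y)
  map_part : ∀ (k : ZMod 2) (x : L), x ∈ part k ↔ φ x ∈ part k

section conditions

variable {ℓ : ℕ} (τ : Finset (Fin ℓ)) {A : Matrix (Fin ℓ) (Fin ℓ) ℂ} {H : Type u}
  [AddCommGroup H] [Module ℂ H] (R : Realization A H)

/-- `S` is a contragredient base of `𝔤(A, τ)`: a root base for which there is an isomorphism
`φ : 𝔤(A, τ) → 𝔤(A', τ')` with `φ(𝔥) = 𝔥'` and `φ*(Σ') = S`. The restriction of `φ` to the Cartan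
subalgebras is the isomorphism `ψ`. -/
def IsContragredientBase (S : Set (Module.Dual ℂ H)) : Prop :=
  IsRootBase (Contragredient.roots τ R) S ∧
    ∃ (ℓ' : ℕ) (A' : Matrix (Fin ℓ') (Fin ℓ') ℂ) (τ' : Finset (Fin ℓ')) (H' : Type u)
      (_ : AddCommGroup H') (_ : Module ℂ H') (R' : Realization A' H')
      (φ : Contragredient τ R ≃ₗ[ℂ] Contragredient τ' R') (ψ : H ≃ₗ[ℂ] H'),
      IsSuperIso φ ∧
      (∀ h : H, φ (Contragredient.cartan τ R h) = Contragredient.cartan τ' R' (ψ h)) ∧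
      S = Set.range fun j => (R'.root j) ∘ₗ ψ.toLinearMap

/-- (a): `Σ` is reflectable at `αᵢ` and `r_{αᵢ} Σ` is a contragredient base. -/
def CondA (i : Fin ℓ) : Prop :=
  ∃ S : Set (Module.Dual ℂ H),
    IsReflexion (Contragredient.roots τ R) (Set.range R.root) (R.root i) S ∧
      IsContragredientBase τ R S

/-- (b): `Σ` is reflectable at `αᵢ`. -/
def CondB (i : Fin ℓ) : Prop :=
  ReflectableAt (Contragredient.roots τ R) (Set.range R.root) (R.root i)

/-- `x` is `ad`-locally nilpotent. -/
def IsAdLocallyNilpotent {L : Type v} [AddCommGroup L] [Module ℂ L] [LieSuperalgebra L]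
    (x : L) : Prop :=
  ∀ y : L, ∃ n : ℕ, (bracket x ^ n : Module.End ℂ L) y = 0

/-- (c): `eᵢ` and `fᵢ` are `ad`-locally nilpotent. -/
def CondC (i : Fin ℓ) : Prop :=
  IsAdLocallyNilpotent (Contragredient.e τ R i) ∧ IsAdLocallyNilpotent (Contragredient.f τ R i)

/-- (d): the matrix conditions (A1), (A2), (A3) at the index `i`. -/
structure CondD (τ : Finset (Fin ℓ)) (A : Matrix (Fin ℓ) (Fin ℓ) ℂ) (i : Fin ℓ) : Prop where
  a1 : A i i = 0 → i ∉ τ → ∀ j, A i j = 0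
  a2 : ∀ j, A i j = 0 → A j i = 0
  a3_even : A i i ≠ 0 → i ∉ τ → ∀ j, j ≠ i → ∃ n : ℤ, n ≤ 0 ∧ 2 * A i j / A i i = n
  a3_odd : A i i ≠ 0 → i ∈ τ → ∀ j, j ≠ i → ∃ n : ℤ, n ≤ 0 ∧ A i j / A i i = n

/-- `s_{αᵢ} μ = μ - (2 ⟨αᵢᵛ, μ⟩ / aᵢᵢ) αᵢ`, for `aᵢᵢ ≠ 0`. -/
def reflection (i : Fin ℓ) (μ : Module.Dual ℂ H) : Module.Dual ℂ H :=
  μ - (2 * μ (R.coroot i) / A i i) • R.root i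

open Classical in
/-- The isotropic reflexion: `αⱼ' = -αᵢ` if `j = i`, `αⱼ' = αⱼ` if `j ≠ i` and `aᵢⱼ = 0`, and
`αⱼ' = αⱼ + αᵢ` if `aᵢⱼ ≠ 0`; for `aᵢᵢ = 0`. -/
def isotropicReflexion (i j : Fin ℓ) : Module.Dual ℂ H :=
  if j = i then -R.root i else if A i j = 0 then R.root j else R.root j + R.root i

end conditions

end SuperLie

end

open SuperLie

noncomputable section

namespace SuperLie

universe u v w

open Superalgebra

/-! ### Homogeneous components and consequences of the super Jacobi identity. -/

section general

variable {V : Type v} [AddCommGroup V] [Module ℂ V] [Superalgebra V]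

/-! The argument is carried by Chevalley systems: generators of a Lie superalgebra that satisfy the
defining relations and have independent roots and coroots. If the Cartan subalgebra embeds and no
nonzero ideal meets it trivially (`System.Reduced`), the system identifies the algebra with a
contragredient one (`System.exists_iso`). That 𝔤(A,τ) is itself reduced (`Contragredient.reduced`)
rests on Verma modules, which show that 𝔥 embeds in the half-baked algebra, and on the triangular
decomposition.

Everything else is read off the strings (ad e_i)^n e_j. Applying f_i to the (n+1)-st vector gives an
explicit multiple of the n-th: the coefficients are partial sums of an arithmetic progression if i
is even, and follow a rule depending on the parity of n if i is odd. In a reduced system a positive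
word killed by all f_k vanishes (`Reduced.eq_zero_of_singular`). Hence under (d) each string stops
at its first vanishing coefficient. Exchanging e_i with f_i and replacing e_j, f_j by the ends of
their strings gives another Chevalley system with the same Cartan subalgebra and the same rank of
the Cartan matrix (`exists_reflected`), so (d) implies (a).

Conversely, pure combinatorics of root bases (`IsReflexion.exists_strings`) shows that any reflected
base consists of -α_i and the tops α_j + N_j α_i of the root strings. Bounded strings give local
nilpotency, so (b) implies (c). If a_ii ≠ 0, local nilpotency forces a coefficient to vanish, which
is the integrality condition, and a string of length zero forces a_ji = 0; so (c) implies (d).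

If a_ii = 0 and i is odd, every string has length at most one and (c) carries no information, so
(A2) is extracted from (a) (`CondA.symm_of_isotropic`). If a_ij = 0 ≠ a_ji, then in the reflected
base α_j is the sum of the simple roots -α_i and α_i + α_j, whose root vectors f_i and [e_i, e_j]
have zero bracket. This is impossible in a contragredient algebra, where that bracket spans the root
space of the sum. -/

theorem exists_parts (x : V) :
    ∃ y ∈ part (V := V) 0, ∃ z ∈ part (V := V) 1, y + z = x :=
  Submodule.mem_sup.1 (show x ∈ part 0 ⊔ part 1 by rw [isCompl.sup_eq_top]; trivial)

theorem zmod_two_cases (k : ZMod 2) : k = 0 ∨ k = 1 := by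
  revert k; decide

@[simp] theorem koszul_zero_left (k : ZMod 2) : koszul 0 k = 1 := by simp [koszul]

@[simp] theorem koszul_zero_right (k : ZMod 2) : koszul k 0 = 1 := by simp [koszul]

@[simp] theorem koszul_one_one : koszul 1 1 = -1 := by simp [koszul]

theorem koszul_mul_self (i j : ZMod 2) : koszul i j * koszul i j = 1 := by
  unfold koszul; split_ifs <;> norm_num

theorem koszul_ne_zero (i j : ZMod 2) : koszul i j ≠ 0 := by
  unfold koszul; split_ifs <;> norm_num

theorem koszul_comm (i j : ZMod 2) : koszul i j = koszul j i := by
  simp [koszul, and_comm]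

theorem parts_induction {P : V → Prop} (hom : ∀ k, ∀ x ∈ part (V := V) k, P x)
    (add : ∀ x y, P x → P y → P (x + y)) (x : V) : P x := by
  obtain ⟨y, hy, z, hz, rfl⟩ := exists_parts x
  exact add _ _ (hom 0 y hy) (hom 1 z hz)

theorem isIdeal_ker {W : Type w} [AddCommGroup W] [Module ℂ W] [Superalgebra W]
    (F : V →ₗ[ℂ] W) (hb : ∀ x y, F (bracket x y) = bracket (F x) (F y))
    (hp : ∀ k, ∀ x ∈ part (V := V) k, F x ∈ part (V := W) k) : IsIdeal (LinearMap.ker F) where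
  left x y hy := by
    rw [LinearMap.mem_ker] at hy ⊢
    rw [hb, hy, map_zero]
  right {x} y hx := by
    rw [LinearMap.mem_ker] at hx ⊢
    rw [hb, hx, map_zero, LinearMap.zero_apply]
  graded := by
    intro x hx
    obtain ⟨y, hy, z, hz, rfl⟩ := exists_parts x
    rw [LinearMap.mem_ker, map_add] at hx
    obtain ⟨h0, h1⟩ := eq_of_add_eq_add (hp 0 y hy) (hp 1 z hz) (zero_mem _) (zero_mem _)
      (hx.trans (add_zero 0).symm)
    exact Submodule.mem_sup.2 ⟨y, ⟨h0, hy⟩, z, ⟨h1, hz⟩, rfl⟩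

theorem part_iff_of_injective {W : Type w} [AddCommGroup W] [Module ℂ W] [Superalgebra W]
    (F : V →ₗ[ℂ] W) (hF : Function.Injective F)
    (hp : ∀ k, ∀ x ∈ part (V := V) k, F x ∈ part (V := W) k) (k : ZMod 2) (x : V) :
    x ∈ part k ↔ F x ∈ part k := by
  refine ⟨hp k x, fun h => ?_⟩
  obtain ⟨y, hy, z, hz, rfl⟩ := exists_parts x
  rw [map_add] at h
  obtain rfl | rfl := zmod_two_cases k
  · have := (eq_of_add_eq_add (hp 0 y hy) (hp 1 z hz) h (zero_mem _) (add_zero _).symm).2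
    rw [(map_eq_zero_iff F hF).1 this, add_zero]
    exact hy
  · have := (eq_of_add_eq_add (hp 0 y hy) (hp 1 z hz) (zero_mem _) h (zero_add _).symm).1
    rw [(map_eq_zero_iff F hF).1 this, zero_add]
    exact hz

variable {L : Type v} [AddCommGroup L] [Module ℂ L] [LieSuperalgebra L]

/-- The sign does not involve the parity of the third argument, so homogeneity of `z` can be dropped
by linearity. -/
theorem jacobi_right {i j : ZMod 2} {x y : L} (hx : x ∈ part i) (hy : y ∈ part j) (z : L) :
    bracket x (bracket y z) = bracket (bracket x y) z + koszul i j • bracket y (bracket x z) := by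
  induction z using parts_induction with
  | hom k z hz => exact LieSuperalgebra.jacobi hx hy hz
  | add a b ha hb => simp only [map_add, ha, hb, smul_add]; abel

theorem jacobi_even {x : L} (hx : x ∈ part (V := L) 0) (y z : L) :
    bracket x (bracket y z) = bracket (bracket x y) z + bracket y (bracket x z) := by
  induction y using parts_induction with
  | hom k y hy => simpa using jacobi_right hx hy z
  | add a b ha hb => simp only [map_add, ha, hb, LinearMap.add_apply]; abel

theorem skew_even {x : L} (hx : x ∈ part (V := L) 0) (y : L) :
    bracket x y = -bracket y x := by
  induction y using parts_induction with
  | hom k y hy => simpa using LieSuperalgebra.skew hx hy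
  | add a b ha hb => simp only [map_add, ha, hb, LinearMap.add_apply]; abel

theorem bracket_self_even {x : L} (hx : x ∈ part (V := L) 0) : bracket x x = 0 := by
  have h : (2 : ℂ) • bracket x x = 0 := by
    rw [two_smul]
    nth_rewrite 1 [skew_even hx x]
    exact neg_add_cancel _
  exact (smul_eq_zero.1 h).resolve_left two_ne_zero

/-- For three equal odd arguments the Jacobi identity becomes 3[x,[x,x]] = 0. -/
theorem bracket_cube_odd {x : L} (hx : x ∈ part (V := L) 1) : bracket x (bracket x x) = 0 := by
  have h := LieSuperalgebra.jacobi hx hx hx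
  have hxx : bracket x x ∈ part (V := L) 0 := bracket_mem hx hx
  rw [skew_even hxx x, koszul_one_one] at h
  have h3 : (3 : ℂ) • bracket x (bracket x x) = 0 := by
    have : bracket x (bracket x x) + bracket x (bracket x x) + bracket x (bracket x x) = 0 := by
      nth_rewrite 1 [h]; module
    rw [← this]; module
  exact (smul_eq_zero.1 h3).resolve_left (by norm_num)

/-- A graded subspace stable under all left multiplications is an ideal. -/
theorem isIdeal_of_left {I : Submodule ℂ L} (hl : ∀ (x : L), ∀ y ∈ I, bracket x y ∈ I)
    (hg : I ≤ (I ⊓ part 0) ⊔ (I ⊓ part 1)) : IsIdeal I where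
  left x _ hy := hl x _ hy
  graded := hg
  right {x} y hx := by
    have key : ∀ k, ∀ x ∈ I ⊓ part k, bracket x y ∈ I := by
      intro k x hx
      induction y using parts_induction with
      | hom j y hy =>
        rw [LieSuperalgebra.skew hx.2 hy]
        exact neg_mem (Submodule.smul_mem _ _ (hl y x hx.1))
      | add a b ha hb => rw [map_add]; exact add_mem ha hb
    obtain ⟨a, ha, b, hb, rfl⟩ := Submodule.mem_sup.1 (hg hx)
    rw [map_add]
    exact add_mem (key 0 a ha) (key 1 b hb)

end general

/-! ### Chevalley systems -/

/-- Elements of a Lie superalgebra satisfying the relations of a half-baked Lie superalgebra. -/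
structure PreSystem (ℓ : ℕ) (H : Type u) [AddCommGroup H] [Module ℂ H] (L : Type v)
    [AddCommGroup L] [Module ℂ L] [LieSuperalgebra L] where
  par : Fin ℓ → ZMod 2
  root : Fin ℓ → Module.Dual ℂ H
  coroot : Fin ℓ → H
  c : H →ₗ[ℂ] L
  e : Fin ℓ → L
  f : Fin ℓ → L
  c_mem : ∀ h, c h ∈ part (V := L) 0
  e_mem : ∀ k, e k ∈ part (V := L) (par k)
  f_mem : ∀ k, f k ∈ part (V := L) (par k)
  c_c : ∀ h h', bracket (c h) (c h') = 0
  c_e : ∀ h k, bracket (c h) (e k) = root k h • e k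
  c_f : ∀ h k, bracket (c h) (f k) = -(root k h • f k)
  e_f_same : ∀ k, bracket (e k) (f k) = c (coroot k)
  e_f_ne : ∀ j k, j ≠ k → bracket (e j) (f k) = 0

/-- A Chevalley system: linearly independent roots and coroots, generating elements. -/
structure System (ℓ : ℕ) (H : Type u) [AddCommGroup H] [Module ℂ H] (L : Type v)
    [AddCommGroup L] [Module ℂ L] [LieSuperalgebra L] extends PreSystem ℓ H L where
  root_li : LinearIndependent ℂ root
  coroot_li : LinearIndependent ℂ coroot
  gen : ∀ p : Submodule ℂ L, (∀ h, c h ∈ p) → (∀ k, e k ∈ p) → (∀ k, f k ∈ p) →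
    (∀ i j, ∀ x ∈ p, ∀ y ∈ p, x ∈ part i → y ∈ part j → bracket x y ∈ p) → ∀ x, x ∈ p

section hom

variable {ℓ : ℕ} {H : Type u} [AddCommGroup H] [Module ℂ H] {L : Type v}
    [AddCommGroup L] [Module ℂ L] [LieSuperalgebra L]

/-- The image of a symbol. -/
def PreSystem.onGen (S : PreSystem ℓ H L) : Gen ℓ H → L
  | .cartan h => S.c h
  | .e k => S.e k
  | .f k => S.f k

/-- The bracket is regarded as a nonassociative multiplication on `L`, and the universal property of
the free nonassociative algebra applies. -/
theorem exists_freeSuper_hom (τ : Finset (Fin ℓ)) (g : Gen ℓ H → L) :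
    ∃ F : FreeSuper τ H →ₗ[ℂ] L, (∀ x y, F (bracket x y) = bracket (F x) (F y)) ∧
      ∀ s, F (FreeSuper.gen τ s) = g s := by
  let _ : NonUnitalNonAssocSemiring L :=
    { (inferInstance : AddCommGroup L) with
      mul := fun x y => bracket x y
      left_distrib := fun x y z => map_add (bracket x) y z
      right_distrib := fun x y z => by
        change bracket (x + y) z = bracket x z + bracket y z
        rw [map_add, LinearMap.add_apply]
      zero_mul := fun x => by
        change bracket 0 x = 0
        rw [map_zero, LinearMap.zero_apply]
      mul_zero := fun x => map_zero (bracket x) }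
  have : IsScalarTower ℂ L L := ⟨fun r x y => by
    change bracket (r • x) y = r • bracket x y
    rw [map_smul, LinearMap.smul_apply]⟩
  have : SMulCommClass ℂ L L := ⟨fun r x y => by
    change r • bracket x y = bracket x (r • y)
    rw [map_smul]⟩
  let F := FreeNonUnitalNonAssocAlgebra.lift ℂ g
  refine ⟨⟨⟨F, map_add F⟩, map_smul F⟩, fun x y => map_mul F (show FreeNonUnitalNonAssocAlgebra ℂ (Gen ℓ H) from x) y, fun s => ?_⟩
  exact FreeNonUnitalNonAssocAlgebra.lift_of_apply ℂ g s

/-- A word as an element of the free superalgebra. -/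
def freeSuperWord (τ : Finset (Fin ℓ)) (t : FreeMagma (Gen ℓ H)) : FreeSuper τ H :=
  (MonoidAlgebra.single t 1 : FreeNonUnitalNonAssocAlgebra ℂ (Gen ℓ H))

theorem freeSuper_word_mul (τ : Finset (Fin ℓ)) (s t : FreeMagma (Gen ℓ H)) :
    freeSuperWord τ (.mul s t) = bracket (freeSuperWord τ s) (freeSuperWord τ t) := by
  change MonoidAlgebra.single (s * t) (1 : ℂ) =
    MonoidAlgebra.single s (1 : ℂ) * MonoidAlgebra.single t (1 : ℂ)
  rw [MonoidAlgebra.single_mul_single, one_mul]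

theorem freeSuper_part_eq (τ : Finset (Fin ℓ)) (k : ZMod 2) :
    part (V := FreeSuper τ H) k =
      Submodule.span ℂ (freeSuperWord τ '' {t | wordParity τ t = k}) :=
  MonoidAlgebra.supported_eq_span_single ℂ _

/-- A subspace containing the generators and closed under brackets of homogeneous elements is the
whole free superalgebra. -/
theorem freeSuper_mem_of_gen (τ : Finset (Fin ℓ)) (p : ZMod 2 → FreeSuper τ H → Prop)
    (hg : ∀ s : Gen ℓ H, p (s.parity τ) (FreeSuper.gen τ s))
    (hb : ∀ i j x y, p i x → p j y → p (i + j) (bracket x y)) (t : FreeMagma (Gen ℓ H)) :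
    p (wordParity τ t) (freeSuperWord τ t) := by
  induction t with
  | ih1 s => exact hg s
  | ih2 s t hs ht =>
    have := hb _ _ _ _ hs ht
    rwa [← freeSuper_word_mul] at this

theorem freeSuper_gen_mem (τ : Finset (Fin ℓ)) (s : Gen ℓ H) :
    FreeSuper.gen τ s ∈ part (V := FreeSuper τ H) (s.parity τ) := by
  rw [freeSuper_part_eq]
  exact Submodule.subset_span ⟨.of s, rfl, rfl⟩

theorem freeSuper_generates (τ : Finset (Fin ℓ)) (p : Submodule ℂ (FreeSuper τ H))
    (hg : ∀ s, FreeSuper.gen τ s ∈ p)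
    (hb : ∀ i j, ∀ x ∈ p, ∀ y ∈ p, x ∈ part i → y ∈ part j → bracket x y ∈ p)
    (x : FreeSuper τ H) : x ∈ p := by
  have key : ∀ k, part (V := FreeSuper τ H) k ≤ p := by
    intro k
    rw [freeSuper_part_eq, Submodule.span_le]
    rintro _ ⟨t, -, rfl⟩
    exact (freeSuper_mem_of_gen τ (fun i x => x ∈ p ∧ x ∈ part i)
      (fun s => ⟨hg s, freeSuper_gen_mem τ s⟩)
      (fun i j x y hx hy => ⟨hb i j x hx.1 y hy.1 hx.2 hy.2, bracket_mem hx.2 hy.2⟩) t).1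
  obtain ⟨y, hy, z, hz, rfl⟩ := exists_parts x
  exact add_mem (key 0 hy) (key 1 hz)

/-- The universal property of the half-baked Lie superalgebra. -/
theorem exists_halfBaked_hom {A : Matrix (Fin ℓ) (Fin ℓ) ℂ} (τ : Finset (Fin ℓ))
    (R : Realization A H) (S : PreSystem ℓ H L) (hpar : ∀ k, S.par k = if k ∈ τ then 1 else 0)
    (hroot : S.root = R.root) (hcoroot : S.coroot = R.coroot) :
    ∃ F : HalfBaked τ R →ₗ[ℂ] L, (∀ x y, F (bracket x y) = bracket (F x) (F y)) ∧
      (∀ k, ∀ x ∈ part (V := HalfBaked τ R) k, F x ∈ part (V := L) k) ∧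
      (∀ h, F (HalfBaked.cartan τ R h) = S.c h) ∧
      (∀ k, F (HalfBaked.gen τ R (.e k)) = S.e k) ∧
      (∀ k, F (HalfBaked.gen τ R (.f k)) = S.f k) := by
  obtain ⟨F, hF, hg⟩ := exists_freeSuper_hom τ S.onGen
  have hp : ∀ k, ∀ x ∈ part (V := FreeSuper τ H) k, F x ∈ part (V := L) k := by
    intro k
    have : part (V := FreeSuper τ H) k ≤ (part (V := L) k).comap F := by
      rw [freeSuper_part_eq, Submodule.span_le]
      rintro _ ⟨t, rfl, rfl⟩
      refine freeSuper_mem_of_gen τ (fun i x => F x ∈ part i) (fun s => ?_)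
        (fun i j x y hx hy => ?_) t
      · rw [hg]
        cases s with
        | cartan h => exact S.c_mem h
        | e k => have := S.e_mem k; rwa [hpar] at this
        | f k => have := S.f_mem k; rwa [hpar] at this
      · rw [hF]
        exact bracket_mem hx hy
    exact this
  have hrel : relIdeal τ R ≤ LinearMap.ker F := by
    refine sInf_le ⟨isIdeal_ker F hF hp, fun x hx => ?_⟩
    rw [LinearMap.mem_ker]
    cases hx with
    | skew hx hy =>
      rw [map_add, map_smul, hF, hF, LieSuperalgebra.skew (hp _ _ hx) (hp _ _ hy),
        neg_add_cancel]
    | jacobi hx hy hz =>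
      rw [map_sub, map_add, map_smul]
      simp only [hF]
      rw [LieSuperalgebra.jacobi (hp _ _ hx) (hp _ _ hy) (hp _ _ hz), sub_self]
    | cartan_add h h' => simp [hg, PreSystem.onGen]
    | cartan_smul c h => simp [hg, PreSystem.onGen]
    | cartan_cartan h h' => simp [hF, hg, PreSystem.onGen, S.c_c]
    | cartan_e h i => simp [hF, hg, PreSystem.onGen, S.c_e, hroot]
    | cartan_f h i => simp [hF, hg, PreSystem.onGen, S.c_f, hroot]
    | e_f_same i => simp [hF, hg, PreSystem.onGen, S.e_f_same, hcoroot]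
    | e_f_ne i j hij => simp [hF, hg, PreSystem.onGen, S.e_f_ne i j hij]
  refine ⟨(relIdeal τ R).liftQ F hrel, ?_, ?_, fun h => hg (.cartan h), fun k => hg (.e k),
    fun k => hg (.f k)⟩
  · intro x y
    obtain ⟨x, rfl⟩ := (relIdeal τ R).mkQ_surjective x
    obtain ⟨y, rfl⟩ := (relIdeal τ R).mkQ_surjective y
    exact hF x y
  · rintro k _ ⟨x, hx, rfl⟩
    exact hp k x hx

/-- The tautological relations in the half-baked Lie superalgebra. -/
def HalfBaked.preSystem {A : Matrix (Fin ℓ) (Fin ℓ) ℂ} (τ : Finset (Fin ℓ))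
    (R : Realization A H) : PreSystem ℓ H (HalfBaked τ R) where
  par k := if k ∈ τ then 1 else 0
  root := R.root
  coroot := R.coroot
  c := HalfBaked.cartan τ R
  e k := HalfBaked.gen τ R (.e k)
  f k := HalfBaked.gen τ R (.f k)
  c_mem h := ⟨_, freeSuper_gen_mem τ (.cartan h), rfl⟩
  e_mem k := ⟨_, freeSuper_gen_mem τ (.e k), rfl⟩
  f_mem k := ⟨_, freeSuper_gen_mem τ (.f k), rfl⟩
  c_c h h' := (Submodule.Quotient.mk_eq_zero _).2 (rel_mem τ R (.cartan_cartan h h'))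
  c_e h k := (Submodule.Quotient.eq _).2 (rel_mem τ R (.cartan_e h k))
  c_f h k := by
    rw [eq_neg_iff_add_eq_zero]
    exact (Submodule.Quotient.mk_eq_zero _).2 (rel_mem τ R (.cartan_f h k))
  e_f_same k := (Submodule.Quotient.eq _).2 (rel_mem τ R (.e_f_same k))
  e_f_ne j k hjk := (Submodule.Quotient.mk_eq_zero _).2 (rel_mem τ R (.e_f_ne j k hjk))

/-- The Chevalley system of the half-baked Lie superalgebra. -/
def HalfBaked.system {A : Matrix (Fin ℓ) (Fin ℓ) ℂ} (τ : Finset (Fin ℓ))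
    (R : Realization A H) : System ℓ H (HalfBaked τ R) where
  toPreSystem := HalfBaked.preSystem τ R
  root_li := R.linearIndependent_root
  coroot_li := R.linearIndependent_coroot
  gen p hc he hf hb x := by
    obtain ⟨x, rfl⟩ := (relIdeal τ R).mkQ_surjective x
    refine freeSuper_generates τ (p.comap (relIdeal τ R).mkQ) (fun s => ?_) ?_ x
    · cases s with
      | cartan h => exact hc h
      | e k => exact he k
      | f k => exact hf k
    · intro i j x hx y hy hxi hyj
      exact hb i j _ hx _ hy ⟨x, hxi, rfl⟩ ⟨y, hyj, rfl⟩

/-- The Chevalley system of a contragredient Lie superalgebra. -/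
def Contragredient.system {A : Matrix (Fin ℓ) (Fin ℓ) ℂ} (τ : Finset (Fin ℓ))
    (R : Realization A H) : System ℓ H (Contragredient τ R) where
  par k := if k ∈ τ then 1 else 0
  root := R.root
  coroot := R.coroot
  c := Contragredient.cartan τ R
  e := Contragredient.e τ R
  f := Contragredient.f τ R
  c_mem h := ⟨_, (HalfBaked.preSystem τ R).c_mem h, rfl⟩
  e_mem k := ⟨_, (HalfBaked.preSystem τ R).e_mem k, rfl⟩
  f_mem k := ⟨_, (HalfBaked.preSystem τ R).f_mem k, rfl⟩
  c_c h h' := congrArg (maxIdeal τ R).mkQ ((HalfBaked.preSystem τ R).c_c h h')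
  c_e h k := congrArg (maxIdeal τ R).mkQ ((HalfBaked.preSystem τ R).c_e h k)
  c_f h k := congrArg (maxIdeal τ R).mkQ ((HalfBaked.preSystem τ R).c_f h k)
  e_f_same k := congrArg (maxIdeal τ R).mkQ ((HalfBaked.preSystem τ R).e_f_same k)
  e_f_ne j k h := congrArg (maxIdeal τ R).mkQ ((HalfBaked.preSystem τ R).e_f_ne j k h)
  root_li := R.linearIndependent_root
  coroot_li := R.linearIndependent_coroot
  gen p hc he hf hb x := by
    obtain ⟨x, rfl⟩ := (maxIdeal τ R).mkQ_surjective x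
    refine (HalfBaked.system τ R).gen (p.comap (maxIdeal τ R).mkQ) hc he hf ?_ x
    intro i j x hx y hy hxi hyj
    exact hb i j _ hx _ hy ⟨x, hxi, rfl⟩ ⟨y, hyj, rfl⟩

end hom

/-! ### The Verma module on the tensor algebra -/

section associative

variable {B : Type v} [Ring B] [Algebra ℂ B] (P : B)

/-- The supercommutator of an associative algebra with parity element `P`. -/
def superCommutator : B →ₗ[ℂ] B →ₗ[ℂ] B :=
  LinearMap.mk₂ ℂ (fun x y => x * y -
      ((1 / 2 : ℂ) • ((y + P * y * P) * x) + (1 / 2 : ℂ) • ((y - P * y * P) * (P * x * P))))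
    (fun x x' y => by simp only [add_mul, mul_add, sub_mul, smul_add, smul_sub]; abel)
    (fun c x y => by
      simp only [smul_mul_assoc, mul_smul_comm, smul_add, smul_sub, smul_comm c (1 / 2 : ℂ)])
    (fun x y y' => by simp only [add_mul, mul_add, sub_mul, smul_add, smul_sub]; abel)
    (fun c x y => by
      simp only [add_mul, sub_mul, smul_mul_assoc, mul_smul_comm, smul_add, smul_sub,
        smul_comm c (1 / 2 : ℂ)])

theorem koszul_add_one (i j : ZMod 2) : koszul (i + j) 1 = koszul i 1 * koszul j 1 := by
  obtain rfl | rfl := zmod_two_cases i <;> obtain rfl | rfl := zmod_two_cases j <;>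
    simp [show (1 + 1 : ZMod 2) = 0 from rfl]

theorem koszul_add_left (i j k : ZMod 2) : koszul (i + j) k = koszul i k * koszul j k := by
  obtain rfl | rfl := zmod_two_cases k
  · simp
  · exact koszul_add_one i j

theorem koszul_add_right (i j k : ZMod 2) : koszul k (i + j) = koszul k i * koszul k j := by
  rw [koszul_comm, koszul_add_left, koszul_comm i, koszul_comm j]

/-- Conjugation by P is the parity automorphism: (y ± PyP)/2 are the even and odd components of y,
and PxP supplies the sign of x in front of the odd one. The general formula thus reduces to the
usual supercommutator on homogeneous elements. -/
theorem superCommutator_eq {i j : ZMod 2} {x y : B} (hx : P * x * P = koszul i 1 • x)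
    (hy : P * y * P = koszul j 1 • y) :
    superCommutator P x y = x * y - koszul i j • (y * x) := by
  change x * y -
      ((1 / 2 : ℂ) • ((y + P * y * P) * x) + (1 / 2 : ℂ) • ((y - P * y * P) * (P * x * P))) = _
  rw [hx, hy]
  congr 1
  simp only [add_mul, sub_mul, smul_mul_assoc, mul_smul_comm]
  obtain rfl | rfl := zmod_two_cases i <;> obtain rfl | rfl := zmod_two_cases j <;>
    simp only [koszul_zero_left, koszul_zero_right, koszul_one_one] <;> module

theorem parity_mul (hP : P * P = 1) {i j : ZMod 2} {x y : B} (hx : P * x * P = koszul i 1 • x)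
    (hy : P * y * P = koszul j 1 • y) : P * (x * y) * P = koszul (i + j) 1 • (x * y) := by
  have : P * (x * y) * P = (P * x * P) * (P * y * P) := by
    calc P * (x * y) * P = P * x * 1 * y * P := by noncomm_ring
      _ = _ := by rw [← hP]; noncomm_ring
  rw [this, hx, hy, koszul_add_one, smul_mul_smul_comm]

/-- An associative algebra with a parity element as a Lie superalgebra. -/
@[reducible] def superCommutatorLie (hP : P * P = 1) : LieSuperalgebra B where
  bracket := superCommutator P
  part k :=
    { carrier := {x | P * x * P = koszul k 1 • x}
      add_mem' := fun {x y} (hx : _ = _) (hy : _ = _) => by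
        change _ = _
        rw [mul_add, add_mul, hx, hy, smul_add]
      zero_mem' := by
        change _ = _
        simp
      smul_mem' := fun c x (hx : _ = _) => by
        change _ = _
        rw [mul_smul_comm, smul_mul_assoc, hx, smul_comm] }
  isCompl := by
    constructor
    · rw [Submodule.disjoint_def]
      intro x (h0 : _ = _) (h1 : _ = _)
      rw [h0, koszul_zero_left, koszul_one_one] at h1
      have : (2 : ℂ) • x = 0 := by
        calc (2 : ℂ) • x = (1 : ℂ) • x + (1 : ℂ) • x := by module
          _ = 0 := by nth_rewrite 1 [h1]; module
      exact (smul_eq_zero.1 this).resolve_left two_ne_zero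
    · rw [codisjoint_iff, eq_top_iff]
      intro x _
      have hx : P * (P * x * P) * P = x := by
        calc P * (P * x * P) * P = (P * P) * x * (P * P) := by noncomm_ring
          _ = x := by rw [hP]; simp
      -- The two eigencomponents of the involution x ↦ PxP.
      refine Submodule.mem_sup.2 ⟨(1 / 2 : ℂ) • (x + P * x * P), ?_,
        (1 / 2 : ℂ) • (x - P * x * P), ?_, by module⟩
      · change _ = _
        rw [mul_smul_comm, smul_mul_assoc, mul_add, add_mul, hx, koszul_zero_left]
        module
      · change _ = _
        rw [mul_smul_comm, smul_mul_assoc, mul_sub, sub_mul, hx, koszul_one_one]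
        module
  bracket_mem {i j x y} (hx : _ = _) (hy : _ = _) := by
    change _ = _
    rw [superCommutator_eq P hx hy, mul_sub, sub_mul, mul_smul_comm, smul_mul_assoc,
      parity_mul P hP hx hy, parity_mul P hP hy hx, add_comm j i]
    module
  skew {i j x y} (hx : _ = _) (hy : _ = _) := by
    rw [superCommutator_eq P hx hy, superCommutator_eq P hy hx, smul_sub, smul_smul,
      koszul_comm j i, koszul_mul_self]
    module
  jacobi {i j k x y z} (hx : _ = _) (hy : _ = _) (hz : _ = _) := by
    have hb : ∀ {i j : ZMod 2} {x y : B}, P * x * P = koszul i 1 • x →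
        P * y * P = koszul j 1 • y → P * (x * y - koszul i j • (y * x)) * P =
          koszul (i + j) 1 • (x * y - koszul i j • (y * x)) := by
      intro i j x y hx hy
      rw [mul_sub, sub_mul, mul_smul_comm, smul_mul_assoc,
        parity_mul P hP hx hy, parity_mul P hP hy hx, add_comm j i]
      module
    rw [superCommutator_eq P hy hz, superCommutator_eq P hx hy, superCommutator_eq P hx hz,
      superCommutator_eq P hx (hb hy hz), superCommutator_eq P (hb hx hy) hz,
      superCommutator_eq P hy (hb hx hz)]
    simp only [koszul_add_left, koszul_add_right, mul_sub, sub_mul, mul_smul_comm,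
      smul_mul_assoc, smul_sub, smul_smul, mul_assoc]
    rw [koszul_comm j i]
    obtain h | h : koszul i j = 1 ∨ koszul i j = -1 := by
      unfold koszul; split_ifs <;> simp
    all_goals rw [h]; module

end associative

section verma

variable {ℓ : ℕ} {H : Type u} [AddCommGroup H] [Module ℂ H] (par : Fin ℓ → ZMod 2)
  (root : Fin ℓ → Module.Dual ℂ H) (coroot : Fin ℓ → H) (μ : Module.Dual ℂ H)

/-- The weight of a basis vector of the Verma module of highest weight `μ`. -/
def vermaWeight : List (Fin ℓ) → Module.Dual ℂ H
  | [] => μ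
  | k :: w => vermaWeight w - root k

/-- The sign of a basis vector of the Verma module. -/
def vermaSign : List (Fin ℓ) → ℂ
  | [] => 1
  | k :: w => koszul (par k) 1 * vermaSign w

/-- The action of a lowering operator. -/
def vermaF (k : Fin ℓ) : Module.End ℂ (List (Fin ℓ) →₀ ℂ) :=
  Finsupp.linearCombination ℂ fun w => Finsupp.single (k :: w) 1

/-- The action of a diagonal operator. -/
def vermaDiag (d : List (Fin ℓ) → ℂ) : Module.End ℂ (List (Fin ℓ) →₀ ℂ) :=
  Finsupp.linearCombination ℂ fun w => d w • Finsupp.single w 1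

/-- The action of a raising operator on basis vectors. -/
def vermaRaise (k : Fin ℓ) : List (Fin ℓ) → (List (Fin ℓ) →₀ ℂ)
  | [] => 0
  | l :: w => (if k = l then vermaWeight root μ w (coroot k) • Finsupp.single w 1 else 0) +
      koszul (par k) (par l) • vermaF l (vermaRaise k w)

/-- The action of a raising operator. -/
def vermaE (k : Fin ℓ) : Module.End ℂ (List (Fin ℓ) →₀ ℂ) :=
  Finsupp.linearCombination ℂ (vermaRaise par root coroot μ k)

@[simp] theorem vermaF_single (k : Fin ℓ) (w : List (Fin ℓ)) :
    vermaF k (Finsupp.single w 1) = Finsupp.single (k :: w) 1 := by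
  simp [vermaF]

@[simp] theorem vermaDiag_single (d : List (Fin ℓ) → ℂ) (w : List (Fin ℓ)) :
    vermaDiag d (Finsupp.single w 1) = d w • Finsupp.single w 1 := by
  simp [vermaDiag]

@[simp] theorem vermaE_single (k : Fin ℓ) (w : List (Fin ℓ)) :
    vermaE par root coroot μ k (Finsupp.single w 1) = vermaRaise par root coroot μ k w := by
  simp [vermaE]

theorem verma_ext {f g : Module.End ℂ (List (Fin ℓ) →₀ ℂ)}
    (h : ∀ w, f (Finsupp.single w 1) = g (Finsupp.single w 1)) : f = g :=
  Finsupp.lhom_ext' fun w => LinearMap.ext_ring (h w)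

theorem vermaSign_mul_self (w : List (Fin ℓ)) : vermaSign par w * vermaSign par w = 1 := by
  induction w with
  | nil => simp [vermaSign]
  | cons k w ih =>
    rw [vermaSign, mul_mul_mul_comm, ih, koszul_mul_self, one_mul]

theorem vermaDiag_mul (d d' : List (Fin ℓ) → ℂ) :
    vermaDiag d * vermaDiag d' = vermaDiag (d * d') :=
  verma_ext fun w => by simp [-Finsupp.smul_single, smul_smul, mul_comm]

theorem vermaDiag_vermaF (d : List (Fin ℓ) → ℂ) (k : Fin ℓ) :
    vermaDiag d * vermaF k = vermaF k * vermaDiag fun w => d (k :: w) :=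
  verma_ext fun w => by simp [-Finsupp.smul_single]

theorem vermaParity_mul_self : vermaDiag (vermaSign par) * vermaDiag (vermaSign par) = 1 := by
  refine verma_ext fun w => ?_
  rw [vermaDiag_mul, vermaDiag_single, Pi.mul_apply, vermaSign_mul_self, one_smul,
    Module.End.one_apply]

theorem vermaDiag_smul (a : ℂ) (d : List (Fin ℓ) → ℂ) : vermaDiag (a • d) = a • vermaDiag d :=
  verma_ext fun w => by simp [-Finsupp.smul_single, smul_smul]

/-- This makes `vermaE` homogeneous of parity `par k` for conjugation by the sign operator. Both
terms of the recursion defining `vermaRaise` have the parity of `w` shifted by that of `k`. -/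
theorem vermaParity_raise (k : Fin ℓ) (w : List (Fin ℓ)) :
    vermaDiag (vermaSign par) (vermaRaise par root coroot μ k w) =
      (koszul (par k) 1 * vermaSign par w) • vermaRaise par root coroot μ k w := by
  induction w with
  | nil => simp [-Finsupp.smul_single, vermaRaise]
  | cons l w ih =>
    have h : vermaDiag (vermaSign par) (vermaF l (vermaRaise par root coroot μ k w)) =
        (koszul (par k) 1 * vermaSign par (l :: w)) •
          vermaF l (vermaRaise par root coroot μ k w) := by
      rw [← Module.End.mul_apply, vermaDiag_vermaF, Module.End.mul_apply,
        show (fun w => vermaSign par (l :: w)) = koszul (par l) 1 • vermaSign par from rfl,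
        vermaDiag_smul, LinearMap.smul_apply, ih, map_smul, map_smul, smul_smul, vermaSign]
      congr 1; ring
    rw [vermaRaise, map_add, map_smul, h, smul_add, smul_comm]
    congr 1
    split_ifs with hkl
    · subst hkl
      rw [map_smul, vermaDiag_single, smul_comm, vermaSign, ← mul_assoc, koszul_mul_self, one_mul]
    · simp

theorem vermaCartan_raise (h : H) (k : Fin ℓ) (w : List (Fin ℓ)) :
    vermaDiag (fun w => vermaWeight root μ w h) (vermaRaise par root coroot μ k w) =
      (vermaWeight root μ w h + root k h) • vermaRaise par root coroot μ k w := by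
  induction w with
  | nil => simp [-Finsupp.smul_single, vermaRaise]
  | cons l w ih =>
    have h' : vermaDiag (fun w => vermaWeight root μ w h)
          (vermaF l (vermaRaise par root coroot μ k w)) =
        (vermaWeight root μ (l :: w) h + root k h) •
          vermaF l (vermaRaise par root coroot μ k w) := by
      rw [← Module.End.mul_apply, vermaDiag_vermaF, Module.End.mul_apply,
        show (vermaDiag fun w => vermaWeight root μ (l :: w) h) =
          (vermaDiag fun w => vermaWeight root μ w h) - root l h • 1 from
          verma_ext fun w => by simp [-Finsupp.smul_single, vermaWeight, sub_smul],
        LinearMap.sub_apply, ih, LinearMap.smul_apply, Module.End.one_apply, ← sub_smul, map_smul,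
        vermaWeight, LinearMap.sub_apply]
      congr 1; ring
    rw [vermaRaise, map_add, map_smul, h', smul_add, smul_comm]
    congr 1
    split_ifs with hkl
    · subst hkl
      rw [map_smul, vermaDiag_single, smul_comm, vermaWeight, LinearMap.sub_apply, sub_add_cancel]
    · simp

/-- The relations of the half-baked Lie superalgebra hold in the Verma module. -/
theorem exists_vermaSystem : ∃ (_ : LieSuperalgebra (Module.End ℂ (List (Fin ℓ) →₀ ℂ)))
    (S : PreSystem ℓ H (Module.End ℂ (List (Fin ℓ) →₀ ℂ))), S.par = par ∧ S.root = root ∧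
      S.coroot = coroot ∧ ∀ h, S.c h (Finsupp.single [] 1) = μ h • Finsupp.single [] 1 := by
  have hP := vermaParity_mul_self par
  let inst := superCommutatorLie (vermaDiag (vermaSign par)) hP
  have hC : ∀ h : H, vermaDiag (vermaSign par) * (vermaDiag fun w => vermaWeight root μ w h) *
      vermaDiag (vermaSign par) = koszul 0 1 • vermaDiag fun w => vermaWeight root μ w h := by
    intro h
    refine verma_ext fun w => ?_
    simp only [Module.End.mul_apply, vermaDiag_single, map_smul, smul_smul, koszul_zero_left,
      one_smul]
    rw [mul_left_comm, vermaSign_mul_self, mul_one]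
  have hE : ∀ k, vermaDiag (vermaSign par) * vermaE par root coroot μ k *
      vermaDiag (vermaSign par) = koszul (par k) 1 • vermaE par root coroot μ k := by
    intro k
    refine verma_ext fun w => ?_
    simp only [Module.End.mul_apply, vermaDiag_single, map_smul, vermaE_single,
      vermaParity_raise, smul_smul, LinearMap.smul_apply]
    rw [mul_left_comm, vermaSign_mul_self, mul_one]
  have hF : ∀ k, vermaDiag (vermaSign par) * vermaF k *
      vermaDiag (vermaSign par) = koszul (par k) 1 • vermaF k := by
    intro k
    refine verma_ext fun w => ?_
    simp only [Module.End.mul_apply, vermaDiag_single, map_smul, vermaF_single, smul_smul,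
      LinearMap.smul_apply, vermaSign]
    rw [mul_left_comm, vermaSign_mul_self, mul_one]
  refine ⟨inst, ⟨par, root, coroot,
    ⟨⟨fun h => vermaDiag fun w => vermaWeight root μ w h, fun h h' => ?_⟩, fun a h => ?_⟩,
    vermaE par root coroot μ, vermaF, hC, hE, hF, fun h h' => ?_, fun h k => ?_, fun h k => ?_,
    fun k => ?_, fun j k hjk => ?_⟩, rfl, rfl, rfl, fun h => ?_⟩
  · exact verma_ext fun w => by simp [-Finsupp.smul_single, add_smul]
  · exact verma_ext fun w => by simp [-Finsupp.smul_single, smul_smul]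
  · refine (superCommutator_eq _ (hC h) (hC h')).trans ?_
    change vermaDiag _ * vermaDiag _ - koszul 0 0 • (vermaDiag _ * vermaDiag _) = 0
    rw [koszul_zero_left, one_smul, vermaDiag_mul, vermaDiag_mul, mul_comm, sub_self]
  · refine (superCommutator_eq _ (hC h) (hE k)).trans (verma_ext fun w => ?_)
    simp [-Finsupp.smul_single, vermaCartan_raise, add_smul]
  · refine (superCommutator_eq _ (hC h) (hF k)).trans (verma_ext fun w => ?_)
    simp [-Finsupp.smul_single, vermaWeight, sub_smul]
  · refine (superCommutator_eq _ (hE k) (hF k)).trans (verma_ext fun w => ?_)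
    simp [-Finsupp.smul_single, vermaRaise]
  · refine (superCommutator_eq _ (hE j) (hF k)).trans (verma_ext fun w => ?_)
    simp [-Finsupp.smul_single, vermaRaise, hjk]
  · simp [-Finsupp.smul_single, vermaWeight]

end verma

/-- On the highest weight vector of the Verma module of weight μ, the element h acts by μ(h). If h
becomes zero in the half-baked algebra, then μ(h) = 0 for every μ, and functionals separate points.
-/
theorem HalfBaked.cartan_injective {ℓ : ℕ} {A : Matrix (Fin ℓ) (Fin ℓ) ℂ} (τ : Finset (Fin ℓ))
    {H : Type u} [AddCommGroup H] [Module ℂ H] (R : Realization A H) :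
    Function.Injective (HalfBaked.cartan τ R) := by
  rw [injective_iff_map_eq_zero]
  intro h hh
  refine (Module.forall_dual_apply_eq_zero_iff ℂ h).1 fun μ => ?_
  obtain ⟨_, S, hpar, hroot, hcoroot, hc⟩ := exists_vermaSystem
    (fun k : Fin ℓ => if k ∈ τ then 1 else 0) R.root R.coroot μ
  obtain ⟨F, -, -, hF, -⟩ := exists_halfBaked_hom τ R S (fun k => by rw [hpar]) hroot hcoroot
  have := hc h
  rw [← hF, hh, map_zero, LinearMap.zero_apply] at this
  simpa using this.symm

/-! ### Words, weights and the triangular decomposition -/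

section system

variable {ℓ : ℕ} {H : Type u} [AddCommGroup H] [Module ℂ H] {L : Type v}
    [AddCommGroup L] [Module ℂ L] [LieSuperalgebra L]

namespace PreSystem

variable (S : PreSystem ℓ H L)

theorem e_c (k : Fin ℓ) (h : H) : bracket (S.e k) (S.c h) = -(S.root k h • S.e k) := by
  rw [← S.c_e, skew_even (S.c_mem h) (S.e k), neg_neg]

theorem f_e (j k : Fin ℓ) :
    bracket (S.f j) (S.e k) = -(koszul (S.par j) (S.par k) • bracket (S.e k) (S.f j)) :=
  LieSuperalgebra.skew (S.f_mem j) (S.e_mem k)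

theorem f_e_same (k : Fin ℓ) :
    bracket (S.f k) (S.e k) = -(koszul (S.par k) (S.par k) • S.c (S.coroot k)) := by
  rw [f_e, S.e_f_same]

theorem f_e_ne (j k : Fin ℓ) (h : j ≠ k) : bracket (S.f j) (S.e k) = 0 := by
  rw [f_e, S.e_f_ne k j h.symm, smul_zero, neg_zero]

/-- The system obtained by exchanging the roles of the raising and lowering operators. -/
def swap : PreSystem ℓ H L where
  par := S.par
  root := S.root
  coroot := S.coroot
  -- Negating the Cartan map lets `f k` have weight `root k` for the new system. The factor on `S.e
  -- k` absorbs the Koszul sign in [f_k, e_k], so the coroots are unchanged as well.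
  c := -S.c
  e := S.f
  f k := koszul (S.par k) (S.par k) • S.e k
  c_mem h := neg_mem (S.c_mem h)
  e_mem := S.f_mem
  f_mem k := Submodule.smul_mem _ _ (S.e_mem k)
  c_c h h' := by simp [S.c_c]
  c_e h k := by simp [S.c_f]
  c_f h k := by simp [S.c_e, smul_comm (S.root k h)]
  e_f_same k := by
    rw [map_smul, S.f_e_same, smul_neg, smul_smul, koszul_mul_self, one_smul]
    rfl
  e_f_ne j k h := by rw [map_smul, S.f_e_ne j k h, smul_zero]

/-- The simultaneous eigenspaces of `𝔥`. -/
def wt (β : Module.Dual ℂ H) : Submodule ℂ L :=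
  ⨅ h : H, Module.End.eigenspace (bracket (S.c h)) (β h)

variable {S}

theorem mem_wt {β : Module.Dual ℂ H} {x : L} : x ∈ S.wt β ↔ ∀ h, bracket (S.c h) x = β h • x := by
  simp [wt, Submodule.mem_iInf]

theorem bracket_mem_wt {β γ : Module.Dual ℂ H} {x y : L} (hx : x ∈ S.wt β) (hy : y ∈ S.wt γ) :
    bracket x y ∈ S.wt (β + γ) := by
  rw [mem_wt] at *
  intro h
  rw [jacobi_even (S.c_mem h), hx, hy, map_smul, map_smul, LinearMap.smul_apply, ← add_smul,
    LinearMap.add_apply]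

theorem swap_wt (β : Module.Dual ℂ H) : S.swap.wt β = S.wt (-β) := by
  ext x
  rw [mem_wt, mem_wt]
  refine forall_congr' fun h => ?_
  change bracket (-S.c h) x = _ ↔ bracket (S.c h) x = -(β h) • x
  rw [map_neg, LinearMap.neg_apply, neg_eq_iff_eq_neg, neg_smul]

variable (S) in
theorem e_mem_wt (k : Fin ℓ) : S.e k ∈ S.wt (S.root k) := mem_wt.2 fun h => S.c_e h k

variable (S) in
theorem f_mem_wt (k : Fin ℓ) : S.f k ∈ S.wt (-S.root k) := by
  rw [← swap_wt]
  exact S.swap.e_mem_wt k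

variable (S) in
theorem c_mem_wt (h : H) : S.c h ∈ S.wt 0 := mem_wt.2 fun h' => by simp [S.c_c]

variable (S) in
/-- Right-normed brackets of raising operators, indexed by their content. -/
inductive EWord : Multiset (Fin ℓ) → L → Prop
  | base (k : Fin ℓ) : EWord {k} (S.e k)
  | step (k : Fin ℓ) (m : Multiset (Fin ℓ)) (x : L) :
      EWord m x → EWord (k ::ₘ m) (bracket (S.e k) x)

variable (S) in
/-- The weight of a content. -/
def contentWeight (m : Multiset (Fin ℓ)) : Module.Dual ℂ H := (m.map S.root).sum

@[simp] theorem contentWeight_singleton (k : Fin ℓ) : S.contentWeight {k} = S.root k := by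
  simp [contentWeight]

@[simp] theorem contentWeight_zero : S.contentWeight 0 = 0 := by
  simp [contentWeight]

@[simp] theorem contentWeight_cons (k : Fin ℓ) (m : Multiset (Fin ℓ)) :
    S.contentWeight (k ::ₘ m) = S.root k + S.contentWeight m := by
  simp [contentWeight]

namespace EWord

variable {m : Multiset (Fin ℓ)} {x : L}

theorem ne_zero (h : S.EWord m x) : m ≠ 0 := by
  cases h <;> simp

theorem mem_wt (h : S.EWord m x) : x ∈ S.wt (S.contentWeight m) := by
  induction h with
  | base k => simpa using S.e_mem_wt k
  | step k m x _ ih => simpa using bracket_mem_wt (S.e_mem_wt k) ih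

theorem mem_part (h : S.EWord m x) : x ∈ part (V := L) (m.map S.par).sum := by
  induction h with
  | base k => simpa using S.e_mem k
  | step k m x _ ih => simpa using bracket_mem (S.e_mem k) ih

end EWord

variable (S) in
/-- The span of the right-normed brackets of raising operators. -/
def plus : Submodule ℂ L := Submodule.span ℂ {x | ∃ m, S.EWord m x}

theorem EWord.mem_plus {m : Multiset (Fin ℓ)} {x : L} (h : S.EWord m x) : x ∈ S.plus :=
  Submodule.subset_span ⟨m, h⟩

theorem e_plus (k : Fin ℓ) {x : L} (hx : x ∈ S.plus) : bracket (S.e k) x ∈ S.plus := by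
  have : S.plus ≤ S.plus.comap (bracket (S.e k)) := by
    conv_lhs => rw [plus]
    rw [Submodule.span_le]
    rintro y ⟨m, hy⟩
    exact (hy.step k).mem_plus
  exact this hx

theorem e_range_sup_plus (k : Fin ℓ) {x : L} (hx : x ∈ LinearMap.range S.c ⊔ S.plus) :
    bracket (S.e k) x ∈ S.plus := by
  obtain ⟨_, ⟨h, rfl⟩, y, hy, rfl⟩ := Submodule.mem_sup.1 hx
  rw [map_add, e_c]
  exact add_mem (neg_mem (Submodule.smul_mem _ _ (EWord.base k).mem_plus)) (e_plus k hy)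

theorem exists_f_e (j k : Fin ℓ) : ∃ h, bracket (S.f j) (S.e k) = S.c h := by
  by_cases hjk : j = k
  · subst hjk
    exact ⟨-(koszul (S.par j) (S.par j) • S.coroot j), by rw [f_e_same, map_neg, map_smul]⟩
  · exact ⟨0, by rw [f_e_ne _ _ _ hjk, map_zero]⟩

/-- By the Leibniz rule, f_k meets the outermost e_l in a Cartan element, which only rescales the
weight vector `x`, or passes inside, where induction applies. -/
theorem f_eWord (k : Fin ℓ) {m : Multiset (Fin ℓ)} {x : L} (hx : S.EWord m x) :
    bracket (S.f k) x ∈ LinearMap.range S.c ⊔ S.plus := by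
  induction hx with
  | base l =>
    obtain ⟨h, hh⟩ := S.exists_f_e k l
    exact hh ▸ Submodule.mem_sup_left ⟨h, rfl⟩
  | step l m x hx ih =>
    obtain ⟨h, hh⟩ := S.exists_f_e k l
    rw [jacobi_right (S.f_mem k) (S.e_mem l), hh, PreSystem.mem_wt.1 hx.mem_wt h]
    exact Submodule.mem_sup_right (add_mem (Submodule.smul_mem _ _ hx.mem_plus)
      (Submodule.smul_mem _ _ (e_range_sup_plus l ih)))

theorem f_plus (k : Fin ℓ) {x : L} (hx : x ∈ S.plus) :
    bracket (S.f k) x ∈ LinearMap.range S.c ⊔ S.plus := by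
  have : S.plus ≤ (LinearMap.range S.c ⊔ S.plus).comap (bracket (S.f k)) := by
    conv_lhs => rw [plus]
    rw [Submodule.span_le]
    rintro y ⟨m, hy⟩
    exact f_eWord k hy
  exact this hx

theorem c_plus (h : H) {x : L} (hx : x ∈ S.plus) : bracket (S.c h) x ∈ S.plus := by
  have : S.plus ≤ S.plus.comap (bracket (S.c h)) := by
    conv_lhs => rw [plus]
    rw [Submodule.span_le]
    rintro y ⟨m, hy⟩
    change bracket (S.c h) y ∈ S.plus
    rw [PreSystem.mem_wt.1 hy.mem_wt h]
    exact Submodule.smul_mem _ _ hy.mem_plus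
  exact this hx

theorem range_swap_c : LinearMap.range S.swap.c = LinearMap.range S.c :=
  LinearMap.range_neg S.c

theorem e_minus (k : Fin ℓ) {x : L} (hx : x ∈ S.swap.plus) :
    bracket (S.e k) x ∈ LinearMap.range S.c ⊔ S.swap.plus := by
  have h := S.swap.f_plus k hx
  rw [range_swap_c] at h
  have h' : bracket (S.e k) x = koszul (S.par k) (S.par k) • bracket (S.swap.f k) x := by
    change _ = _ • bracket (koszul (S.par k) (S.par k) • S.e k) x
    rw [map_smul, LinearMap.smul_apply, smul_smul, koszul_mul_self, one_smul]
  rw [h']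
  exact Submodule.smul_mem _ _ h

end PreSystem

namespace System

variable (S : System ℓ H L)

/-- A subspace stable under the generators is stable under all left multiplications. -/
theorem stable_of_gen (M : Submodule ℂ L) (hc : ∀ h, ∀ x ∈ M, bracket (S.c h) x ∈ M)
    (he : ∀ k, ∀ x ∈ M, bracket (S.e k) x ∈ M) (hf : ∀ k, ∀ x ∈ M, bracket (S.f k) x ∈ M)
    (x : L) : ∀ y ∈ M, bracket x y ∈ M := by
  -- The stabiliser of `M` is closed under brackets of homogeneous elements by the Jacobi identity,
  -- so containing the generators it is everything.
  let T : Submodule ℂ L :=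
    { carrier := {x | ∀ y ∈ M, bracket x y ∈ M}
      add_mem' := fun ha hb y hy => by
        rw [map_add]; exact add_mem (ha y hy) (hb y hy)
      zero_mem' := fun y _ => by
        rw [map_zero]; exact zero_mem M
      smul_mem' := fun a x hx y hy => by
        rw [map_smul]; exact Submodule.smul_mem _ _ (hx y hy) }
  refine S.gen T hc he hf (fun i j x hx y hy hxi hyj z hz => ?_) x
  have h : bracket (bracket x y) z =
      bracket x (bracket y z) - koszul i j • bracket y (bracket x z) := by
    rw [jacobi_right hxi hyj, add_sub_cancel_right]
  rw [h]
  exact sub_mem (hx _ (hy z hz)) (Submodule.smul_mem _ _ (hy _ (hx z hz)))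

/-- The sum on the left contains the generators and is stable under bracketing with each of them,
hence under all left multiplications; generation then gives the whole algebra. -/
theorem triangular : LinearMap.range S.c ⊔ S.plus ⊔ S.swap.plus = ⊤ := by
  set M := LinearMap.range S.c ⊔ S.plus ⊔ S.swap.plus with hM
  have h1 : LinearMap.range S.c ⊔ S.plus ≤ M := le_sup_left
  have h2 : S.swap.plus ≤ M := le_sup_right
  have h3 : LinearMap.range S.c ⊔ S.swap.plus ≤ M := sup_le (le_sup_left.trans h1) h2
  have key := S.stable_of_gen M ?_ ?_ ?_
  · rw [eq_top_iff]
    refine fun x _ => S.gen M (fun h => h1 (Submodule.mem_sup_left ⟨h, rfl⟩))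
      (fun k => h1 (Submodule.mem_sup_right (PreSystem.EWord.base k).mem_plus))
      (fun k => h2 (PreSystem.EWord.base (S := S.swap) k).mem_plus)
      (fun i j x _ y hy _ _ => key x y hy) x
  · intro h x hx
    obtain ⟨y', hy', z, hz, rfl⟩ := Submodule.mem_sup.1 hx
    obtain ⟨_, ⟨h', rfl⟩, y, hy, rfl⟩ := Submodule.mem_sup.1 hy'
    rw [map_add, map_add, S.c_c, zero_add]
    refine add_mem (h1 (Submodule.mem_sup_right (PreSystem.c_plus h hy))) (h2 ?_)
    have := PreSystem.c_plus (S := S.swap) (-h) hz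
    rwa [show S.swap.c (-h) = S.c h from (map_neg S.swap.c h).trans (neg_neg _)] at this
  · intro k x hx
    obtain ⟨y, hy, z, hz, rfl⟩ := Submodule.mem_sup.1 hx
    rw [map_add]
    exact add_mem (h1 (Submodule.mem_sup_right (PreSystem.e_range_sup_plus k hy)))
      (h3 (PreSystem.e_minus k hz))
  · intro k x hx
    obtain ⟨y', hy', z, hz, rfl⟩ := Submodule.mem_sup.1 hx
    obtain ⟨_, ⟨h', rfl⟩, y, hy, rfl⟩ := Submodule.mem_sup.1 hy'
    rw [map_add, map_add]
    refine add_mem (add_mem (h2 ?_) (h1 (PreSystem.f_plus k hy)))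
      (h2 (PreSystem.e_plus (S := S.swap) k hz))
    exact PreSystem.e_range_sup_plus (S := S.swap) k
      (Submodule.mem_sup_left (PreSystem.range_swap_c (S := S.toPreSystem) ▸ ⟨h', rfl⟩))

/-- The swapped system. -/
def swap : System ℓ H L where
  toPreSystem := S.toPreSystem.swap
  root_li := S.root_li
  coroot_li := S.coroot_li
  gen p hc he hf hb x := by
    refine S.gen p (fun h => ?_) (fun k => ?_) he hb x
    · have := hc (-h)
      rwa [show S.toPreSystem.swap.c (-h) = S.c h from
        (map_neg S.toPreSystem.swap.c h).trans (neg_neg _)] at this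
    · have := Submodule.smul_mem p (koszul (S.par k) (S.par k)) (hf k)
      rwa [show S.toPreSystem.swap.f k = koszul (S.par k) (S.par k) • S.e k from rfl, smul_smul,
        koszul_mul_self, one_smul] at this

end System

/-- The operators ad h commute, so their simultaneous generalized eigenspaces are independent, and
the weight spaces lie inside these. -/
theorem PreSystem.iSupIndep_wt (S : PreSystem ℓ H L) : iSupIndep S.wt := by
  have hcomm : ∀ h h' : H, Commute (bracket (S.c h) : Module.End ℂ L) (bracket (S.c h')) := by
    intro h h'
    refine LinearMap.ext fun x => ?_
    change bracket (S.c h) (bracket (S.c h') x) = bracket (S.c h') (bracket (S.c h) x)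
    rw [jacobi_even (S.c_mem h), S.c_c, map_zero, LinearMap.zero_apply, zero_add]
  have h := Module.End.independent_iInf_maxGenEigenspace_of_forall_mapsTo
    (fun h : H => (bracket (S.c h) : Module.End ℂ L))
    (fun h h' φ => Module.End.mapsTo_maxGenEigenspace_of_comm (hcomm h' h) φ)
  refine (h.comp (f := fun (β : Module.Dual ℂ H) (h : H) => β h)
    fun β γ hβγ => LinearMap.ext fun h => congrFun hβγ h).mono fun β => ?_
  exact iInf_mono fun h => (Module.End.genEigenspace (bracket (S.c h)) (β h)).monotone le_top

end system

/-- A left inverse of the linear combination map extends the coordinates of `v` to the whole space.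
These functionals are used throughout to read off coefficients of roots. -/
theorem exists_dual_family {K : Type*} [Field K] {V : Type*} [AddCommGroup V] [Module K V]
    {ι : Type*} [DecidableEq ι] {v : ι → V} (hv : LinearIndependent K v) :
    ∃ δ : ι → Module.Dual K V, ∀ i j, δ i (v j) = if j = i then 1 else 0 := by
  obtain ⟨g, hg⟩ := LinearMap.exists_leftInverse_of_injective (Finsupp.linearCombination K v)
    (LinearMap.ker_eq_bot.2 hv)
  refine ⟨fun i => Finsupp.lapply i ∘ₗ g, fun i j => ?_⟩
  have h := LinearMap.congr_fun hg (Finsupp.single j 1)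
  rw [LinearMap.comp_apply, Finsupp.linearCombination_single, one_smul] at h
  simp [h, Finsupp.single_apply]

/-- If a subspace stable under `D` contains the sum of a vector killed by `D` and of eigenvectors
with nonzero eigenvalues, it contains the first one. -/
theorem mem_of_add_mem_of_eigenspaces {K : Type*} [Field K] {V : Type*} [AddCommGroup V]
    [Module K V] (D : Module.End K V) (p : Submodule K V) (hp : ∀ x ∈ p, D x ∈ p) {z y : V}
    (hz : D z = 0) (hy : y ∈ ⨆ μ : {μ : K // μ ≠ 0}, D.eigenspace μ) (h : z + y ∈ p) :
    z ∈ p := by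
  -- A polynomial in `D` that kills `y` and acts on `z` by the nonzero scalar q(0) isolates `z`.
  have hq : ∃ q : Polynomial K, Polynomial.aeval D q y = 0 ∧ q.eval 0 ≠ 0 := by
    clear h
    induction hy using Submodule.iSup_induction' with
    | mem μ x hx =>
      refine ⟨Polynomial.X - Polynomial.C μ.1, ?_, by simpa using μ.2⟩
      rw [Module.End.mem_eigenspace_iff] at hx
      simp [hx, Algebra.algebraMap_eq_smul_one]
    | zero => exact ⟨1, by simp, by simp⟩
    | add x y _ _ ihx ihy =>
      obtain ⟨q, hq, hq0⟩ := ihx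
      obtain ⟨r, hr, hr0⟩ := ihy
      refine ⟨q * r, ?_, by simp [hq0, hr0]⟩
      rw [map_add, map_mul, Module.End.mul_apply, Module.End.mul_apply, hr, map_zero, add_zero,
        ← Module.End.mul_apply, ← map_mul, mul_comm, map_mul, Module.End.mul_apply, hq, map_zero]
  obtain ⟨q, hq, hq0⟩ := hq
  have hpq : ∀ r : Polynomial K, ∀ x ∈ p, Polynomial.aeval D r x ∈ p := by
    intro r x hx
    induction r using Polynomial.induction_on' generalizing x with
    | add a b ha hb => rw [map_add]; exact add_mem (ha x hx) (hb x hx)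
    | monomial n a =>
      rw [Polynomial.aeval_monomial, Module.End.mul_apply, Module.algebraMap_end_apply]
      refine p.smul_mem _ ?_
      induction n generalizing x with
      | zero => simpa using hx
      | succ n ih => rw [pow_succ, Module.End.mul_apply]; exact ih _ (hp x hx)
  have hqz : ∀ r : Polynomial K, Polynomial.aeval D r z = r.eval 0 • z := by
    intro r
    induction r using Polynomial.induction_on' with
    | add a b ha hb =>
      rw [map_add, LinearMap.add_apply, ha, hb, Polynomial.eval_add, add_smul]
    | monomial n a =>
      rw [Polynomial.aeval_monomial, Module.End.mul_apply, Module.algebraMap_end_apply]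
      cases n with
      | zero => simp
      | succ n => rw [pow_succ, Module.End.mul_apply, hz]; simp
  have := hpq q _ h
  rw [map_add, hq, add_zero, hqz] at this
  exact (p.smul_mem_iff hq0).1 this

/-! ### Weight spaces, and ideals meeting the Cartan subalgebra trivially. -/

section system

variable {ℓ : ℕ} {H : Type u} [AddCommGroup H] [Module ℂ H] {L : Type v}
    [AddCommGroup L] [Module ℂ L] [LieSuperalgebra L]

namespace System

variable (S : System ℓ H L)

/-- Fundamental coweights, obtained from a dual family by reflexivity of `H`; evaluating a weight at
one counts the occurrences of a simple root. -/
theorem exists_coweight [FiniteDimensional ℂ H] :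
    ∃ ω : Fin ℓ → H, ∀ j k, S.root j (ω k) = if j = k then 1 else 0 := by
  obtain ⟨δ, hδ⟩ := exists_dual_family S.root_li
  refine ⟨fun k => (Module.evalEquiv ℂ H).symm (δ k), fun j k => ?_⟩
  rw [Module.apply_evalEquiv_symm_apply, hδ]

theorem contentWeight_apply {k : Fin ℓ} {h : H} (hk : ∀ j, S.root j h = if j = k then 1 else 0)
    (m : Multiset (Fin ℓ)) : S.contentWeight m h = m.count k := by
  induction m using Multiset.induction_on with
  | empty => simp
  | cons j m ih =>
    rw [PreSystem.contentWeight_cons, LinearMap.add_apply, hk, ih, Multiset.count_cons]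
    push_cast
    rw [add_comm]
    simp [eq_comm]

theorem contentWeight_coweight {ω : Fin ℓ → H} (hω : ∀ j k, S.root j (ω k) = if j = k then 1 else 0)
    (m : Multiset (Fin ℓ)) (k : Fin ℓ) : S.contentWeight m (ω k) = m.count k :=
  S.contentWeight_apply (fun j => hω j k) m

variable [FiniteDimensional ℂ H]

theorem contentWeight_injective : Function.Injective S.contentWeight := by
  obtain ⟨ω, hω⟩ := S.exists_coweight
  intro m m' h
  ext k
  have := LinearMap.congr_fun h (ω k)
  rw [S.contentWeight_coweight hω, S.contentWeight_coweight hω] at this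
  exact_mod_cast this

theorem contentWeight_ne_neg {m m' : Multiset (Fin ℓ)} (hm : m ≠ 0) :
    S.contentWeight m ≠ -S.contentWeight m' := by
  obtain ⟨ω, hω⟩ := S.exists_coweight
  intro h
  refine hm (Multiset.eq_zero_of_forall_notMem fun k hk => ?_)
  have := LinearMap.congr_fun h (ω k)
  rw [LinearMap.neg_apply, S.contentWeight_coweight hω, S.contentWeight_coweight hω,
    eq_neg_iff_add_eq_zero] at this
  have h0 : m.count k + m'.count k = 0 := by exact_mod_cast this
  have := Multiset.count_pos.2 hk
  omega

theorem contentWeight_ne_zero {m : Multiset (Fin ℓ)} (hm : m ≠ 0) : S.contentWeight m ≠ 0 := by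
  have := S.contentWeight_ne_neg (m' := 0) hm
  simpa using this

/-- The vectors of weight `β` in the triangular decomposition. -/
def basic (β : Module.Dual ℂ H) : Set L :=
  {x | (∃ m, S.EWord m x ∧ S.contentWeight m = β) ∨
    (∃ m, S.toPreSystem.swap.EWord m x ∧ -S.contentWeight m = β) ∨ (β = 0 ∧ ∃ h, S.c h = x)}

omit [FiniteDimensional ℂ H] in
-- The spans of the sets `basic γ` lie in the corresponding weight spaces and together fill the
-- algebra by the triangular decomposition. Independence of the weight spaces leaves no room for
-- anything more in weight β.
theorem wt_eq_span (β : Module.Dual ℂ H) : S.wt β = Submodule.span ℂ (S.basic β) := by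
  have hle : ∀ β, Submodule.span ℂ (S.basic β) ≤ S.wt β := by
    intro β
    rw [Submodule.span_le]
    rintro x (⟨m, hx, rfl⟩ | ⟨m, hx, rfl⟩ | ⟨rfl, h, rfl⟩)
    · exact hx.mem_wt
    · have := hx.mem_wt
      rwa [PreSystem.swap_wt] at this
    · exact S.c_mem_wt h
  have htop : (⨆ γ, Submodule.span ℂ (S.basic γ)) = ⊤ := by
    rw [eq_top_iff, ← S.triangular]
    refine sup_le (sup_le ?_ ?_) ?_
    · rintro _ ⟨h, rfl⟩
      exact Submodule.mem_iSup_of_mem 0 (Submodule.subset_span (.inr (.inr ⟨rfl, h, rfl⟩)))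
    · refine Submodule.span_le.2 ?_
      rintro x ⟨m, hx⟩
      exact Submodule.mem_iSup_of_mem _ (Submodule.subset_span (.inl ⟨m, hx, rfl⟩))
    · refine Submodule.span_le.2 ?_
      rintro x ⟨m, hx⟩
      exact Submodule.mem_iSup_of_mem _ (Submodule.subset_span (.inr (.inl ⟨m, hx, rfl⟩)))
  refine le_antisymm (fun x hx => ?_) (hle β)
  have hx' : x ∈ Submodule.span ℂ (S.basic β) ⊔
      ⨆ γ, ⨆ (_ : γ ≠ β), Submodule.span ℂ (S.basic γ) := by
    refine (show (⊤ : Submodule ℂ L) ≤ _ from ?_) trivial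
    rw [← htop]
    refine iSup_le fun γ => ?_
    by_cases hγ : γ = β
    · exact hγ ▸ le_sup_left
    · exact le_sup_of_le_right (le_iSup₂_of_le γ hγ le_rfl)
  obtain ⟨y, hy, z, hz, rfl⟩ := Submodule.mem_sup.1 hx'
  have hz1 : z ∈ S.wt β := by
    have := sub_mem hx (hle β hy)
    rwa [add_sub_cancel_left] at this
  have hz2 : z ∈ ⨆ γ, ⨆ (_ : γ ≠ β), S.wt γ := iSup₂_mono (fun γ _ => hle γ) hz
  rw [Submodule.disjoint_def.1 (S.iSupIndep_wt β) z hz1 hz2, add_zero]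
  exact hy

theorem wt_zero : S.wt 0 = LinearMap.range S.c := by
  rw [wt_eq_span]
  refine le_antisymm (Submodule.span_le.2 ?_) ?_
  · rintro x (⟨m, hx, h⟩ | ⟨m, hx, h⟩ | ⟨-, h, rfl⟩)
    · exact absurd h (S.contentWeight_ne_zero hx.ne_zero)
    · exact absurd (neg_eq_zero.1 h) (S.contentWeight_ne_zero hx.ne_zero)
    · exact ⟨h, rfl⟩
  · rintro _ ⟨h, rfl⟩
    exact Submodule.subset_span (.inr (.inr ⟨rfl, h, rfl⟩))

theorem wt_contentWeight {m : Multiset (Fin ℓ)} (hm : m ≠ 0) :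
    S.wt (S.contentWeight m) = Submodule.span ℂ {x | S.EWord m x} := by
  rw [wt_eq_span]
  congr 1
  ext x
  constructor
  · rintro (⟨m', hx, h⟩ | ⟨m', hx, h⟩ | ⟨h, -⟩)
    · rwa [S.contentWeight_injective h] at hx
    · exact absurd h.symm (S.contentWeight_ne_neg hm)
    · exact absurd h (S.contentWeight_ne_zero hm)
  · exact fun hx => .inl ⟨m, hx, rfl⟩

omit [FiniteDimensional ℂ H] in
/-- A weight is zero, or a sum of simple roots, or the opposite of such a sum. -/
theorem weight_cases {β : Module.Dual ℂ H} (hβ : S.wt β ≠ ⊥) :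
    β = 0 ∨ (∃ m, m ≠ 0 ∧ β = S.contentWeight m) ∨ ∃ m, m ≠ 0 ∧ β = -S.contentWeight m := by
  by_contra hcon
  push Not at hcon
  apply hβ
  rw [wt_eq_span, show S.basic β = ∅ from ?_, Submodule.span_empty]
  rw [Set.eq_empty_iff_forall_notMem]
  rintro x (⟨m, hx, h⟩ | ⟨m, hx, h⟩ | ⟨h, -⟩)
  · exact hcon.2.1 m hx.ne_zero h.symm
  · exact hcon.2.2 m hx.ne_zero h.symm
  · exact hcon.1 h

theorem wt_root (k : Fin ℓ) : S.wt (S.root k) = Submodule.span ℂ {S.e k} := by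
  have h := S.wt_contentWeight (m := {k}) (by simp)
  rw [PreSystem.contentWeight_singleton] at h
  rw [h]
  congr 1
  ext x
  constructor
  · intro (hx : S.EWord {k} x)
    generalize hm : ({k} : Multiset (Fin ℓ)) = m at hx
    cases hx with
    | base j => rw [Multiset.singleton_inj.1 hm]; rfl
    | step j m x hx =>
      have := congrArg Multiset.card hm
      rw [Multiset.card_singleton, Multiset.card_cons] at this
      exact absurd (Multiset.card_eq_zero.1 (by omega)) hx.ne_zero
  · rintro rfl
    exact .base k

theorem wt_neg_root (k : Fin ℓ) : S.wt (-S.root k) = Submodule.span ℂ {S.f k} := by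
  rw [← PreSystem.swap_wt]
  exact S.swap.wt_root k

/-- An ideal meeting the Cartan subalgebra trivially lies in the sum of the other weight spaces. -/
theorem le_plus_sup_minus_of_isIdeal {I : Submodule ℂ L} (hI : IsIdeal I)
    (h0 : I ⊓ LinearMap.range S.c = ⊥) : I ≤ S.plus ⊔ S.swap.plus := by
  obtain ⟨ω, hω⟩ := S.exists_coweight
  -- The sum of the coweights acts as the height, which is zero on the Cartan part and nonzero on
  -- every word, so an ideal contains the Cartan component of each of its elements.
  have hcard : ∀ m : Multiset (Fin ℓ), S.contentWeight m (∑ k, ω k) = m.card := by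
    intro m
    rw [map_sum]
    simp_rw [S.contentWeight_coweight hω]
    rw [← Nat.cast_sum, Multiset.sum_count_eq_card (by simp)]
  have hplus : S.plus ⊔ S.swap.plus ≤ ⨆ μ : {μ : ℂ // μ ≠ 0},
      Module.End.eigenspace (bracket (S.c (∑ k, ω k))) (μ : ℂ) := by
    refine sup_le (Submodule.span_le.2 ?_) (Submodule.span_le.2 ?_)
    · rintro x ⟨m, hx⟩
      refine Submodule.mem_iSup_of_mem ⟨m.card, by simpa using hx.ne_zero⟩ ?_
      rw [Module.End.mem_eigenspace_iff, PreSystem.mem_wt.1 hx.mem_wt, hcard]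
    · rintro x ⟨m, hx⟩
      refine Submodule.mem_iSup_of_mem ⟨-m.card, by simpa using hx.ne_zero⟩ ?_
      have h := hx.mem_wt
      erw [PreSystem.swap_wt] at h
      rw [Module.End.mem_eigenspace_iff, PreSystem.mem_wt.1 h, LinearMap.neg_apply]
      erw [hcard]
  intro x hx
  have hx' : x ∈ LinearMap.range S.c ⊔ (S.plus ⊔ S.swap.plus) := by
    rw [← sup_assoc]
    exact S.triangular.symm ▸ trivial
  obtain ⟨_, ⟨h, rfl⟩, y, hy, rfl⟩ := Submodule.mem_sup.1 hx'
  have hc : S.c h ∈ I := mem_of_add_mem_of_eigenspaces (bracket (S.c (∑ k, ω k))) I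
    (fun x hx => hI.left _ hx) (S.c_c _ _) (hplus hy) hx
  have : S.c h = 0 := (Submodule.mem_bot ℂ).1 (h0 ▸ ⟨hc, h, rfl⟩)
  rwa [this, zero_add]

theorem plus_minus_disjoint : (S.plus ⊔ S.swap.plus) ⊓ LinearMap.range S.c = ⊥ := by
  rw [eq_bot_iff, ← S.wt_zero]
  rintro x ⟨hx, hx0⟩
  refine Submodule.disjoint_def.1 (S.iSupIndep_wt 0) x hx0 ?_
  refine (show S.plus ⊔ S.swap.plus ≤ _ from ?_) hx
  refine sup_le (Submodule.span_le.2 ?_) (Submodule.span_le.2 ?_)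
  · rintro x ⟨m, hx⟩
    exact Submodule.mem_iSup_of_mem _ (Submodule.mem_iSup_of_mem
      (S.contentWeight_ne_zero hx.ne_zero) hx.mem_wt)
  · rintro x ⟨m, hx⟩
    have h := hx.mem_wt
    erw [PreSystem.swap_wt] at h
    exact Submodule.mem_iSup_of_mem _ (Submodule.mem_iSup_of_mem
      (neg_ne_zero.2 (S.contentWeight_ne_zero hx.ne_zero)) h)

omit [FiniteDimensional ℂ H] in
/-- The Cartan subalgebra embeds, and there are no nonzero ideals meeting it trivially. -/
structure Reduced : Prop where
  injective : Function.Injective S.c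
  ideal_eq_bot : ∀ I : Submodule ℂ L, IsIdeal I → I ⊓ LinearMap.range S.c = ⊥ → I = ⊥

end System

end system

/-! ### Contragredient algebras as reduced Chevalley systems. -/

section contragredient

variable {ℓ : ℕ} {H : Type u} [AddCommGroup H] [Module ℂ H] {A : Matrix (Fin ℓ) (Fin ℓ) ℂ}
  (τ : Finset (Fin ℓ)) (R : Realization A H)

/-- A sum of subspaces avoiding 𝔥 may meet it, but all the ideals in question lie in one common
complement, the sum of the positive and negative parts. -/
theorem maxIdeal_inf_range : maxIdeal τ R ⊓ LinearMap.range (HalfBaked.cartan τ R) = ⊥ := by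
  have := R.finiteDimensional
  rw [eq_bot_iff, ← (HalfBaked.system τ R).plus_minus_disjoint]
  exact inf_le_inf_right _ (sSup_le fun I hI =>
    (HalfBaked.system τ R).le_plus_sup_minus_of_isIdeal hI.1 hI.2)

/-- The preimage of an ideal meeting 𝔥 trivially is again such an ideal, hence contained in the
maximal one. -/
theorem Contragredient.reduced : (Contragredient.system τ R).Reduced where
  injective := by
    rw [injective_iff_map_eq_zero]
    intro h hh
    have hm : HalfBaked.cartan τ R h ∈ maxIdeal τ R := (Submodule.Quotient.mk_eq_zero _).1 hh
    have : HalfBaked.cartan τ R h = 0 :=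
      (Submodule.mem_bot ℂ).1 (maxIdeal_inf_range τ R ▸ ⟨hm, h, rfl⟩)
    exact (map_eq_zero_iff _ (HalfBaked.cartan_injective τ R)).1 this
  ideal_eq_bot I hI h0 := by
    have hle : I.comap (maxIdeal τ R).mkQ ≤ maxIdeal τ R := by
      refine le_sSup ⟨⟨fun x y hy => hI.left ((maxIdeal τ R).mkQ x) hy, fun {x} y hx =>
        hI.right ((maxIdeal τ R).mkQ y) hx, ?_⟩, ?_⟩
      · intro x hx
        obtain ⟨y, hy, z, hz, rfl⟩ := exists_parts x
        obtain ⟨h1, h2⟩ := hI.split (V := Contragredient τ R) (y := (maxIdeal τ R).mkQ y)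
          (z := (maxIdeal τ R).mkQ z) ⟨y, hy, rfl⟩ ⟨z, hz, rfl⟩ hx
        exact Submodule.mem_sup.2 ⟨y, ⟨h1, hy⟩, z, ⟨h2, hz⟩, rfl⟩
      · rw [eq_bot_iff]
        rintro _ ⟨hx, h, rfl⟩
        have h1 : Contragredient.cartan τ R h = 0 :=
          (Submodule.mem_bot ℂ).1 (h0 ▸ ⟨hx, h, rfl⟩)
        have hm : HalfBaked.cartan τ R h ∈ maxIdeal τ R := (Submodule.Quotient.mk_eq_zero _).1 h1
        exact maxIdeal_inf_range τ R ▸ ⟨hm, h, rfl⟩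
    rw [eq_bot_iff]
    intro x hx
    obtain ⟨x, rfl⟩ := (maxIdeal τ R).mkQ_surjective x
    exact (Submodule.Quotient.mk_eq_zero _).2 (hle hx)

/-- A reduced Chevalley system on a Lie superalgebra identifies it with a contragredient one. -/
theorem System.exists_iso {L : Type v} [AddCommGroup L] [Module ℂ L] [LieSuperalgebra L]
    (S : System ℓ H L) (hS : S.Reduced) (hpar : ∀ k, S.par k = if k ∈ τ then 1 else 0)
    (hroot : S.root = R.root) (hcoroot : S.coroot = R.coroot) :
    ∃ φ : L ≃ₗ[ℂ] Contragredient τ R, IsSuperIso φ ∧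
      ∀ h, φ (S.c h) = Contragredient.cartan τ R h := by
  obtain ⟨F, hF, hp, hc, he, hf⟩ := exists_halfBaked_hom τ R S.toPreSystem hpar hroot hcoroot
  have hsurj : Function.Surjective F := by
    intro x
    refine S.gen (LinearMap.range F) (fun h => ⟨_, hc h⟩) (fun k => ⟨_, he k⟩)
      (fun k => ⟨_, hf k⟩) ?_ x
    rintro i j _ ⟨x, rfl⟩ _ ⟨y, rfl⟩ _ _
    exact ⟨_, hF x y⟩
  -- The kernel meets 𝔥 trivially because `S.c` is injective.
  have hker : LinearMap.ker F ≤ maxIdeal τ R := by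
    refine le_sSup ⟨isIdeal_ker F hF hp, ?_⟩
    rw [eq_bot_iff]
    rintro _ ⟨hx, h, rfl⟩
    have : S.c h = 0 := (hc h).symm.trans hx
    rw [(map_eq_zero_iff _ hS.injective).1 this, map_zero]
    exact zero_mem _
  -- By surjectivity the image of the maximal ideal is an ideal of `L`; it meets the Cartan
  -- subalgebra trivially, so it vanishes as `S` is reduced.
  have hmax : maxIdeal τ R ≤ LinearMap.ker F := by
    have h1 : (maxIdeal τ R).map F = ⊥ := by
      refine hS.ideal_eq_bot _ ⟨?_, ?_, ?_⟩ ?_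
      · rintro x _ ⟨y, hy, rfl⟩
        obtain ⟨x, rfl⟩ := hsurj x
        exact ⟨_, (isIdeal_maxIdeal τ R).left x hy, hF x y⟩
      · rintro _ y ⟨x, hx, rfl⟩
        obtain ⟨y, rfl⟩ := hsurj y
        exact ⟨_, (isIdeal_maxIdeal τ R).right y hx, hF x y⟩
      · rintro _ ⟨x, hx, rfl⟩
        obtain ⟨y, hy, z, hz, rfl⟩ := Submodule.mem_sup.1 ((isIdeal_maxIdeal τ R).graded hx)
        rw [map_add]
        exact Submodule.mem_sup.2 ⟨_, ⟨⟨y, hy.1, rfl⟩, hp 0 y hy.2⟩, _,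
          ⟨⟨z, hz.1, rfl⟩, hp 1 z hz.2⟩, rfl⟩
      · rw [eq_bot_iff]
        rintro _ ⟨⟨x, hx, rfl⟩, h, hh⟩
        have h2 : HalfBaked.cartan τ R h - x ∈ maxIdeal τ R := by
          refine hker ?_
          rw [LinearMap.mem_ker, map_sub, hc, hh, sub_self]
        have h3 : HalfBaked.cartan τ R h ∈ maxIdeal τ R := by
          have := add_mem h2 hx
          rwa [sub_add_cancel] at this
        have h4 : HalfBaked.cartan τ R h = 0 :=
          (Submodule.mem_bot ℂ).1 (maxIdeal_inf_range τ R ▸ ⟨h3, h, rfl⟩)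
        rw [Submodule.mem_bot, ← hh, ← hc, h4, map_zero]
    intro x hx
    have : F x ∈ (maxIdeal τ R).map F := ⟨x, hx, rfl⟩
    rwa [h1] at this
  let ψ : Contragredient τ R ≃ₗ[ℂ] L :=
    (Submodule.quotEquivOfEq _ _ (le_antisymm hmax hker)).trans
      (F.quotKerEquivOfSurjective hsurj)
  have hψ : ∀ x, ψ ((maxIdeal τ R).mkQ x) = F x := fun x => rfl
  have hψb : ∀ x y, ψ (bracket x y) = bracket (ψ x) (ψ y) := by
    intro x y
    obtain ⟨x, rfl⟩ := (maxIdeal τ R).mkQ_surjective x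
    obtain ⟨y, rfl⟩ := (maxIdeal τ R).mkQ_surjective y
    exact hF x y
  have hψp : ∀ k, ∀ x ∈ part (V := Contragredient τ R) k, ψ x ∈ part (V := L) k := by
    rintro k _ ⟨x, hx, rfl⟩
    exact hp k x hx
  refine ⟨ψ.symm, ⟨fun x y => ?_, fun k x => ?_⟩, fun h => ?_⟩
  · rw [LinearEquiv.symm_apply_eq, hψb, ψ.apply_symm_apply, ψ.apply_symm_apply]
  · have := part_iff_of_injective ψ.toLinearMap ψ.injective hψp k (ψ.symm x)
    rw [LinearEquiv.coe_coe, ψ.apply_symm_apply] at this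
    exact this.symm
  · rw [LinearEquiv.symm_apply_eq, ← hc h]
    rfl

end contragredient

/-! ### Local nilpotency and the coefficients of strings. -/

section nilpotency

variable {L : Type v} [AddCommGroup L] [Module ℂ L] [LieSuperalgebra L]

/-- Each application of the Leibniz rule lowers one of the two nilpotency orders in every term, so
their sum bounds the number of applications needed. -/
theorem derivation_pow_bracket {D : Module.End ℂ L}
    (hD : ∀ y z, D (bracket y z) = bracket (D y) z + bracket y (D z)) (N : ℕ) :
    ∀ (n m : ℕ) (y z : L), n + m ≤ N → (D ^ n) y = 0 → (D ^ m) z = 0 →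
      (D ^ N) (bracket y z) = 0 := by
  induction N with
  | zero =>
    intro n m y z h hy hz
    obtain rfl : n = 0 := by omega
    rw [pow_zero, Module.End.one_apply] at hy
    rw [hy, map_zero, LinearMap.zero_apply, map_zero]
  | succ N ih =>
    intro n m y z h hy hz
    rcases n with _ | n
    · rw [pow_zero, Module.End.one_apply] at hy
      rw [hy, map_zero, LinearMap.zero_apply, map_zero]
    rcases m with _ | m
    · rw [pow_zero, Module.End.one_apply] at hz
      rw [hz, map_zero, map_zero]
    rw [pow_succ, Module.End.mul_apply, hD, map_add,
      ih n (m + 1) _ _ (by omega) (by rwa [pow_succ] at hy) hz,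
      ih (n + 1) m _ _ (by omega) hy (by rwa [pow_succ] at hz), add_zero]

/-- Some power of the left multiplication by a homogeneous element is an even derivation. -/
theorem exists_pow_derivation {p : ZMod 2} {x : L} (hx : x ∈ part (V := L) p) :
    ∃ q : ℕ, 0 < q ∧ ∀ y z, ((bracket x : Module.End ℂ L) ^ q) (bracket y z) =
      bracket (((bracket x : Module.End ℂ L) ^ q) y) z +
        bracket y (((bracket x : Module.End ℂ L) ^ q) z) := by
  obtain rfl | rfl := zmod_two_cases p
  · exact ⟨1, one_pos, fun y z => by simpa using jacobi_even hx y z⟩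
  -- For odd x the cross terms cancel in (ad x)², which is therefore an even derivation.
  · refine ⟨2, two_pos, fun y z => ?_⟩
    simp only [pow_two, Module.End.mul_apply]
    induction y using parts_induction with
    | hom k y hy =>
      rw [jacobi_right hx hy, map_add, map_smul, jacobi_right hx (bracket_mem hx hy),
        jacobi_right hx hy]
      obtain rfl | rfl := zmod_two_cases k
      · simp
      · simp [show (1 + 1 : ZMod 2) = 0 from rfl]
    | add a b ha hb => simp only [map_add, LinearMap.add_apply, ha, hb]; abel

/-- The subspace on which the left multiplication by `x` is nilpotent. -/
def nilSubmodule (x : L) : Submodule ℂ L :=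
  Module.End.maxGenEigenspace (bracket x) 0

theorem mem_nilSubmodule {x y : L} :
    y ∈ nilSubmodule x ↔ ∃ n : ℕ, (bracket x ^ n : Module.End ℂ L) y = 0 := by
  simp [nilSubmodule, Module.End.mem_maxGenEigenspace]

/-- As the nil subspace is closed under brackets, local nilpotency need only be checked on
generators. -/
theorem bracket_mem_nilSubmodule {p : ZMod 2} {x : L} (hx : x ∈ part (V := L) p) {y z : L}
    (hy : y ∈ nilSubmodule x) (hz : z ∈ nilSubmodule x) : bracket y z ∈ nilSubmodule x := by
  rw [mem_nilSubmodule] at *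
  obtain ⟨q, hq, hD⟩ := exists_pow_derivation hx
  obtain ⟨n, hn⟩ := hy
  obtain ⟨m, hm⟩ := hz
  have hle : ∀ (n : ℕ) (y : L), (bracket x ^ n : Module.End ℂ L) y = 0 →
      ((bracket x ^ q : Module.End ℂ L) ^ n) y = 0 := by
    intro n y h
    rw [← pow_mul, ← Nat.sub_add_cancel (Nat.le_mul_of_pos_left n hq), pow_add,
      Module.End.mul_apply, h, map_zero]
  refine ⟨q * (n + m), ?_⟩
  rw [pow_mul]
  exact derivation_pow_bracket hD (n + m) n m y z le_rfl (hle n y hn) (hle m z hm)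

end nilpotency

/-- The coefficients of the rank one representation theory: `[fᵢ, (ad eᵢ)ⁿ⁺¹ v] = cₙ₊₁ (ad eᵢ)ⁿ v`
if `v` is killed by `fᵢ` and is of weight `lam` under the coroot. -/
def stringCoeff (κ lam a : ℂ) : ℕ → ℂ
  | 0 => 0
  | n + 1 => κ * (stringCoeff κ lam a n - (lam + n * a))

theorem stringCoeff_even (lam a : ℂ) (n : ℕ) :
    2 * stringCoeff 1 lam a n = -(n * (2 * lam + (n - 1) * a)) := by
  induction n with
  | zero => simp [stringCoeff]
  | succ n ih =>
    rw [stringCoeff, one_mul, mul_sub, ih]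
    push_cast
    ring

/-- The even-indexed coefficients do not involve `lam`. If `a ≠ 0` they vanish only at index 0, so a
string under an odd root can end only after an even number of steps. -/
theorem stringCoeff_odd (lam a : ℂ) (n : ℕ) :
    stringCoeff (-1) lam a (2 * n) = n * a ∧ stringCoeff (-1) lam a (2 * n + 1) = lam + n * a := by
  induction n with
  | zero => simp [stringCoeff]
  | succ n ih =>
    have h : stringCoeff (-1) lam a (2 * (n + 1)) = (n + 1 : ℕ) * a := by
      rw [show 2 * (n + 1) = (2 * n + 1) + 1 from rfl, stringCoeff, ih.2]
      push_cast
      ring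
    refine ⟨h, ?_⟩
    rw [stringCoeff, h]
    push_cast
    ring

/-! ### Strings (ad e_i)^n e_j and singular vectors in reduced systems. -/

section system

variable {ℓ : ℕ} {H : Type u} [AddCommGroup H] [Module ℂ H] {L : Type v}
    [AddCommGroup L] [Module ℂ L] [LieSuperalgebra L]

namespace PreSystem

variable (S : PreSystem ℓ H L)

/-- The vectors `(ad eᵢ)ⁿ eⱼ`. -/
def ev (i j : Fin ℓ) (n : ℕ) : L := (bracket (S.e i) ^ n : Module.End ℂ L) (S.e j)

/-- The coefficients of the `αᵢ`-string of `eⱼ`. -/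
def coeff (i j : Fin ℓ) (n : ℕ) : ℂ :=
  stringCoeff (koszul (S.par i) (S.par i)) (S.root j (S.coroot i)) (S.root i (S.coroot i)) n

variable {S}

@[simp] theorem ev_zero (i j : Fin ℓ) : S.ev i j 0 = S.e j := by simp [ev]

theorem ev_succ (i j : Fin ℓ) (n : ℕ) : S.ev i j (n + 1) = bracket (S.e i) (S.ev i j n) := by
  rw [ev, pow_succ', Module.End.mul_apply, ev]

theorem eWord_ev (i j : Fin ℓ) (n : ℕ) :
    S.EWord (Multiset.replicate n i + {j}) (S.ev i j n) := by
  induction n with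
  | zero => simpa using EWord.base j
  | succ n ih =>
    rw [Multiset.replicate_succ, Multiset.cons_add, ev_succ]
    exact ih.step i

theorem contentWeight_replicate_add (i j : Fin ℓ) (n : ℕ) :
    S.contentWeight (Multiset.replicate n i + {j}) = S.root j + n • S.root i := by
  simp [contentWeight, add_comm]

theorem ev_mem_wt (i j : Fin ℓ) (n : ℕ) : S.ev i j n ∈ S.wt (S.root j + n • S.root i) := by
  rw [← contentWeight_replicate_add]
  exact (eWord_ev i j n).mem_wt

theorem ev_mem_part (i j : Fin ℓ) (n : ℕ) :
    S.ev i j n ∈ part (V := L) (S.par j + n • S.par i) := by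
  have := (eWord_ev (S := S) i j n).mem_part
  simpa [add_comm] using this

theorem f_ev {i j : Fin ℓ} (hij : i ≠ j) (n : ℕ) :
    bracket (S.f i) (S.ev i j (n + 1)) = S.coeff i j (n + 1) • S.ev i j n := by
  have hc : ∀ n, bracket (S.c (S.coroot i)) (S.ev i j n) =
      (S.root j (S.coroot i) + n * S.root i (S.coroot i)) • S.ev i j n := by
    intro n
    rw [mem_wt.1 (ev_mem_wt i j n)]
    simp
  induction n with
  | zero =>
    rw [ev_succ, jacobi_right (S.f_mem i) (S.e_mem i), f_e_same, map_neg, map_smul,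
      LinearMap.neg_apply, LinearMap.smul_apply, hc, ev_zero, S.f_e_ne i j hij, coeff, stringCoeff,
      stringCoeff, map_zero]
    module
  | succ n ih =>
    rw [ev_succ, jacobi_right (S.f_mem i) (S.e_mem i), ih, f_e_same, map_neg, map_smul,
      LinearMap.neg_apply, LinearMap.smul_apply, hc, map_smul, ← ev_succ, coeff, coeff,
      stringCoeff.eq_def _ _ _ (n + 1 + 1)]
    module

/-- Since f_k and e_i have zero bracket, ad f_k passes through the string up to sign; what remains
is zero for k ≠ j and a Cartan element for k = j. -/
theorem f_ev_ne {i k : Fin ℓ} (hik : k ≠ i) (j : Fin ℓ) (n : ℕ) :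
    bracket (S.f k) (S.ev i j n) = koszul (S.par k) (S.par i) ^ n •
      (bracket (S.e i) ^ n : Module.End ℂ L) (bracket (S.f k) (S.e j)) := by
  induction n with
  | zero => simp
  | succ n ih =>
    rw [ev_succ, jacobi_right (S.f_mem k) (S.e_mem i), S.f_e_ne k i hik, map_zero,
      LinearMap.zero_apply, zero_add, ih, map_smul, smul_smul, pow_succ', pow_succ',
      Module.End.mul_apply]

variable (S) in
theorem e_pow_c (i : Fin ℓ) (h : H) (n : ℕ) :
    (bracket (S.e i) ^ (n + 1) : Module.End ℂ L) (S.c h) = -(S.root i h • S.ev i i n) := by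
  rw [pow_succ, Module.End.mul_apply, e_c, map_neg, map_smul, ev]

theorem ev_self_even {i : Fin ℓ} (hi : S.par i = 0) (n : ℕ) : S.ev i i (n + 1) = 0 := by
  have h : S.e i ∈ part (V := L) 0 := hi ▸ S.e_mem i
  induction n with
  | zero => rw [ev_succ, ev_zero, bracket_self_even h]
  | succ n ih => rw [ev_succ, ih, map_zero]

variable (S) in
theorem ev_self (i : Fin ℓ) (n : ℕ) : S.ev i i (n + 2) = 0 := by
  obtain hi | hi := zmod_two_cases (S.par i)
  · exact ev_self_even hi (n + 1)
  · have h : S.e i ∈ part (V := L) 1 := hi ▸ S.e_mem i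
    induction n with
    | zero => rw [ev_succ, ev_succ, ev_zero, bracket_cube_odd h]
    | succ n ih => rw [ev_succ, ih, map_zero]

end PreSystem

namespace System

variable {S : System ℓ H L}

/-- The nil subspace of e_i is a subalgebra containing 𝔥, every f_k and e_i automatically, so only
the other e_j need an assumption. -/
theorem e_adLocallyNilpotent {i : Fin ℓ} (h : ∀ j, j ≠ i → ∃ n, S.ev i j n = 0) :
    IsAdLocallyNilpotent (S.e i) := by
  -- Three steps suffice: h goes to a multiple of e_i, then of [e_i, e_i], then to zero.
  have hc : ∀ h, S.c h ∈ nilSubmodule (S.e i) := fun h =>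
    mem_nilSubmodule.2 ⟨3, by rw [S.e_pow_c, S.ev_self, smul_zero, neg_zero]⟩
  refine fun y => mem_nilSubmodule.1 (S.gen _ hc (fun k => mem_nilSubmodule.2 ?_)
    (fun k => mem_nilSubmodule.2 ?_) (fun _ _ x hx y hy _ _ =>
      bracket_mem_nilSubmodule (S.e_mem i) hx hy) y)
  · by_cases hk : k = i
    · subst hk
      exact ⟨2, S.ev_self k 0⟩
    · exact h k hk
  · by_cases hk : k = i
    · subst hk
      obtain ⟨n, hn⟩ := mem_nilSubmodule.1 (hc (S.coroot k))
      exact ⟨n + 1, by rw [pow_succ, Module.End.mul_apply, S.e_f_same, hn]⟩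
    · exact ⟨1, by rw [pow_one, S.e_f_ne i k (Ne.symm hk)]⟩

theorem Reduced.swap (hS : S.Reduced) : S.swap.Reduced where
  injective := neg_injective.comp hS.injective
  ideal_eq_bot I hI h := hS.ideal_eq_bot I hI (by
    rw [← h]
    exact congrArg _ (PreSystem.range_swap_c (S := S.toPreSystem)).symm)

theorem Reduced.e_ne_zero (hS : S.Reduced) (k : Fin ℓ) : S.e k ≠ 0 := by
  intro h
  have := S.e_f_same k
  rw [h, map_zero, LinearMap.zero_apply, eq_comm, map_eq_zero_iff _ hS.injective] at this
  exact S.coroot_li.ne_zero k this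

/-- A bracket of raising operators killed by all the lowering operators is zero. -/
theorem Reduced.eq_zero_of_singular [FiniteDimensional ℂ H] (hS : S.Reduced)
    {m : Multiset (Fin ℓ)} {x : L} (hx : S.EWord m x) (hf : ∀ k, bracket (S.f k) x = 0) :
    x = 0 := by
  -- The vectors obtained from `x` by raising operators span an ideal, because `x` is killed by the
  -- lowering ones. This ideal lies in the positive part, so reducedness makes it zero.
  let W : List (Fin ℓ) → L := fun w => w.foldr (fun k y => bracket (S.e k) y) x
  have hW : ∀ w : List (Fin ℓ), S.EWord ((w : Multiset (Fin ℓ)) + m) (W w) := by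
    intro w
    induction w with
    | nil =>
      rw [Multiset.coe_nil, zero_add]
      exact hx
    | cons k w ih =>
      have := ih.step k
      rwa [← Multiset.cons_add, Multiset.cons_coe] at this
  let M : Submodule ℂ L := Submodule.span ℂ (Set.range W)
  have hWM : ∀ w, W w ∈ M := fun w => Submodule.subset_span ⟨w, rfl⟩
  have hM : ∀ (D : Module.End ℂ L), (∀ w, D (W w) ∈ M) → ∀ y ∈ M, D y ∈ M := by
    intro D hD
    have : M ≤ M.comap D := by
      refine Submodule.span_le.2 ?_
      rintro _ ⟨w, rfl⟩
      exact hD w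
    exact this
  have hideal : IsIdeal M := by
    refine isIdeal_of_left (S.stable_of_gen M (fun h => hM _ fun w => ?_) (fun k => hM _ fun w => ?_)
      (fun k => hM _ fun w => ?_)) (Submodule.span_le.2 ?_)
    · rw [PreSystem.mem_wt.1 (hW w).mem_wt]
      exact M.smul_mem _ (hWM w)
    · exact hWM (k :: w)
    · induction w with
      | nil => exact (hf k).symm ▸ zero_mem M
      | cons l w ih =>
        obtain ⟨h, hh⟩ := PreSystem.exists_f_e (S := S.toPreSystem) k l
        change bracket (S.f k) (bracket (S.e l) (W w)) ∈ M
        rw [jacobi_right (S.f_mem k) (S.e_mem l), hh, PreSystem.mem_wt.1 (hW w).mem_wt]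
        refine add_mem (M.smul_mem _ (hWM w)) (M.smul_mem _ ?_)
        exact hM _ (fun w => hWM (l :: w)) _ ih
    · rintro _ ⟨w, rfl⟩
      have := (hW w).mem_part
      obtain h | h := zmod_two_cases ((Multiset.map S.par (w + m)).sum)
      · rw [h] at this
        exact Submodule.mem_sup_left ⟨hWM w, this⟩
      · rw [h] at this
        exact Submodule.mem_sup_right ⟨hWM w, this⟩
  have hbot : M = ⊥ := by
    refine hS.ideal_eq_bot M hideal (eq_bot_iff.2 ?_)
    rw [← S.plus_minus_disjoint]
    refine inf_le_inf_right _ (le_sup_of_le_left (Submodule.span_le.2 ?_))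
    rintro _ ⟨w, rfl⟩
    exact (hW w).mem_plus
  have := hWM []
  rwa [hbot, Submodule.mem_bot] at this

/-- The vector is singular: f_i kills it by `hn`, f_j by `hc`, and every other f_k because it has
zero bracket with e_i and e_j. -/
theorem Reduced.ev_eq_zero [FiniteDimensional ℂ H] (hS : S.Reduced) {i j : Fin ℓ} (hij : i ≠ j)
    {n : ℕ} (hn : S.coeff i j (n + 1) = 0)
    (hc : (bracket (S.e i) ^ (n + 1) : Module.End ℂ L) (S.c (S.coroot j)) = 0) :
    S.ev i j (n + 1) = 0 := by
  refine hS.eq_zero_of_singular (PreSystem.eWord_ev i j (n + 1)) fun k => ?_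
  by_cases hk : k = i
  · rw [hk, PreSystem.f_ev hij, hn, zero_smul]
  · rw [PreSystem.f_ev_ne hk]
    by_cases hkj : k = j
    · rw [hkj, PreSystem.f_e_same, map_neg, map_smul, hc, smul_zero, neg_zero, smul_zero]
    · rw [PreSystem.f_e_ne _ _ _ hkj, map_zero, smul_zero]

/-- The square of an isotropic raising operator vanishes. -/
theorem Reduced.ev_self_isotropic [FiniteDimensional ℂ H] (hS : S.Reduced) {i : Fin ℓ}
    (ha : S.root i (S.coroot i) = 0) (n : ℕ) : S.ev i i (n + 1) = 0 := by
  have h : S.ev i i 1 = 0 := by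
    refine hS.eq_zero_of_singular (PreSystem.eWord_ev i i 1) fun k => ?_
    by_cases hk : k = i
    · subst hk
      rw [PreSystem.ev_succ, PreSystem.ev_zero, jacobi_right (S.f_mem k) (S.e_mem k),
        PreSystem.f_e_same, map_neg, map_smul, map_neg, map_smul, LinearMap.neg_apply,
        LinearMap.smul_apply, PreSystem.e_c, S.c_e, ha]
      simp
    · rw [PreSystem.f_ev_ne hk, PreSystem.f_e_ne _ _ _ hk, map_zero, smul_zero]
  induction n with
  | zero => exact h
  | succ n ih => rw [PreSystem.ev_succ, ih, map_zero]

/-- If a power of `ad eᵢ` kills `eⱼ`, the first one that does has vanishing coefficient. -/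
theorem Reduced.exists_coeff_eq_zero (hS : S.Reduced) {i j : Fin ℓ} (hij : i ≠ j) {n : ℕ}
    (hn : S.ev i j n = 0) :
    ∃ m, S.ev i j m ≠ 0 ∧ S.ev i j (m + 1) = 0 ∧ S.coeff i j (m + 1) = 0 := by
  classical
  have hex : ∃ n, S.ev i j n = 0 := ⟨n, hn⟩
  obtain ⟨m, hm⟩ : ∃ m, Nat.find hex = m + 1 := by
    refine Nat.exists_eq_succ_of_ne_zero fun h => ?_
    have := Nat.find_spec hex
    rw [h, PreSystem.ev_zero] at this
    exact hS.e_ne_zero j this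
  have h1 : S.ev i j m ≠ 0 := Nat.find_min hex (by omega)
  have h2 : S.ev i j (m + 1) = 0 := hm ▸ Nat.find_spec hex
  refine ⟨m, h1, h2, ?_⟩
  have := PreSystem.f_ev (S := S.toPreSystem) hij m
  rw [h2, map_zero, eq_comm, smul_eq_zero] at this
  exact this.resolve_right h1

/-- Bracketing f_j with [e_i, e_j] gives, up to sign, the multiple α_i(α_j^∨) of e_i, which is
nonzero in a reduced system. -/
theorem Reduced.root_coroot_eq_zero (hS : S.Reduced) {i j : Fin ℓ} (hij : i ≠ j)
    (h : S.ev i j 1 = 0) : S.root i (S.coroot j) = 0 := by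
  have h1 := PreSystem.f_ev_ne (S := S.toPreSystem) hij.symm j 1
  rw [h, map_zero, pow_one, pow_one, PreSystem.f_e_same, map_neg, map_smul, PreSystem.e_c] at h1
  have h2 := h1.symm
  rw [smul_eq_zero, neg_eq_zero, smul_eq_zero, neg_eq_zero, smul_eq_zero] at h2
  exact ((h2.resolve_left (koszul_ne_zero _ _)).resolve_left (koszul_ne_zero _ _)).resolve_right
    (hS.e_ne_zero i)

end System

end system

/-! ### Changes of basis and the rank of a pairing matrix. -/

section linear

variable {K V : Type*} [Field K] [AddCommGroup V] [Module K V] {ι : Type*} [Fintype ι]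
  [DecidableEq ι]

/-- The new family spans the same subspace, and independence of a finite family is determined by the
dimension of its span. -/
theorem linearIndependent_elementary {v : ι → V} (hv : LinearIndependent K v) (i : ι) {s : K}
    (hs : s ≠ 0) {x y : ι → K} (hx : ∀ j, j ≠ i → x j ≠ 0) :
    LinearIndependent K fun j => if j = i then s • v i else x j • v j + y j • v i := by
  rw [linearIndependent_iff_card_eq_finrank_span] at hv ⊢
  rw [hv, Set.finrank, Set.finrank]
  suffices h : Submodule.span K (Set.range v) = Submodule.span K (Set.range fun j =>
      if j = i then s • v i else x j • v j + y j • v i) by rw [h]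
  set u : ι → V := fun j => if j = i then s • v i else x j • v j + y j • v i with hu
  have hvs : ∀ j, v j ∈ Submodule.span K (Set.range v) := fun j => Submodule.subset_span ⟨j, rfl⟩
  have hus : ∀ j, u j ∈ Submodule.span K (Set.range u) := fun j => Submodule.subset_span ⟨j, rfl⟩
  have hi : v i ∈ Submodule.span K (Set.range u) := by
    have := hus i
    rw [hu] at this
    simp only [if_true] at this
    exact (Submodule.smul_mem_iff _ hs).1 this
  refine le_antisymm (Submodule.span_le.2 ?_) (Submodule.span_le.2 ?_)
  · rintro _ ⟨j, rfl⟩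
    by_cases hj : j = i
    · exact hj ▸ hi
    · have h := hus j
      have hj' : u j = x j • v j + y j • v i := if_neg hj
      rw [hj'] at h
      exact (Submodule.smul_mem_iff _ (hx j hj)).1
        ((Submodule.add_mem_iff_left _ (Submodule.smul_mem _ _ hi)).1 h)
  · rintro _ ⟨j, rfl⟩
    by_cases hj : j = i
    · have hj' : u j = s • v i := if_pos hj
      rw [hj']
      exact Submodule.smul_mem _ _ (hvs i)
    · have hj' : u j = x j • v j + y j • v i := if_neg hj
      rw [hj']
      exact add_mem (Submodule.smul_mem _ _ (hvs j)) (Submodule.smul_mem _ _ (hvs i))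

theorem exists_transition {v u : ι → V} (hu : LinearIndependent K u)
    (huv : ∀ j, u j ∈ Submodule.span K (Set.range v)) :
    ∃ X : Matrix ι ι K, IsUnit X.det ∧ ∀ j, u j = ∑ k, X j k • v k := by
  choose X hX using fun j => Submodule.mem_span_range_iff_exists_fun (R := K) |>.1 (huv j)
  refine ⟨Matrix.of X, ?_, fun j => (hX j).symm⟩
  rw [← Matrix.isUnit_iff_isUnit_det, ← Matrix.linearIndependent_rows_iff_isUnit]
  refine LinearIndependent.of_comp (Fintype.linearCombination K v) ?_
  convert hu using 1
  funext j
  exact hX j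

/-- The rank of the matrix of pairings is invariant under changes of bases. -/
theorem rank_pairing_eq {r r' : ι → Module.Dual K V} {v v' : ι → V}
    (hr : LinearIndependent K r') (hv : LinearIndependent K v')
    (hr' : ∀ j, r' j ∈ Submodule.span K (Set.range r))
    (hv' : ∀ j, v' j ∈ Submodule.span K (Set.range v)) :
    (Matrix.of fun j k => r' k (v' j)).rank = (Matrix.of fun j k => r k (v j)).rank := by
  obtain ⟨X, hX, hX'⟩ := exists_transition hv hv'
  obtain ⟨Y, hY, hY'⟩ := exists_transition hr hr'
  have h : (Matrix.of fun j k => r' k (v' j)) =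
      X * (Matrix.of fun j k => r k (v j)) * Y.transpose := by
    ext j k
    simp only [Matrix.mul_apply, Matrix.of_apply, Matrix.transpose_apply, hX', hY', map_sum,
      map_smul, LinearMap.sum_apply, LinearMap.smul_apply, smul_eq_mul, Finset.sum_mul,
      Finset.mul_sum]
    rw [Finset.sum_comm]
    refine Finset.sum_congr rfl fun a _ => Finset.sum_congr rfl fun b _ => ?_
    ring
  rw [h, Matrix.rank_mul_eq_left_of_isUnit_det _ _ (by rwa [Matrix.det_transpose]),
    Matrix.rank_mul_eq_right_of_isUnit_det _ _ hX]

end linear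

/-! ### Construction of the reflected Chevalley system. -/

section system

variable {ℓ : ℕ} {H : Type u} [AddCommGroup H] [Module ℂ H] {L : Type v}
    [AddCommGroup L] [Module ℂ L] [LieSuperalgebra L]

namespace System

variable {S : System ℓ H L}

/-- The `αᵢ`-strings starting at the raising operators `eⱼ`, `j ≠ i`, have lengths `m j`, and so
do those starting at the lowering operators. -/
structure IsStringLength (S : System ℓ H L) (i : Fin ℓ) (m : Fin ℓ → ℕ) : Prop where
  coeff_ne : ∀ j, j ≠ i → ∀ n, n < m j → S.coeff i j (n + 1) ≠ 0
  ev_eq : ∀ j, j ≠ i → S.ev i j (m j + 1) = 0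
  swap_ev_eq : ∀ j, j ≠ i → S.swap.ev i j (m j + 1) = 0

/-- Descending the string with f_i recovers e_j from its end, as no coefficient on the way vanishes.
This shows that the reflected elements still generate. -/
theorem ev_mem_of_ev_mem {i j : Fin ℓ} (hj : j ≠ i) {N : ℕ}
    (h : ∀ n, n < N → S.coeff i j (n + 1) ≠ 0) {p : Submodule ℂ L} (hp : S.ev i j N ∈ p)
    (hb : ∀ n, S.ev i j n ∈ p → bracket (S.f i) (S.ev i j n) ∈ p) : S.e j ∈ p := by
  induction N with
  | zero => simpa using hp
  | succ N ih =>
    refine ih (fun n hn => h n (by omega)) ?_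
    have := hb _ hp
    rw [PreSystem.f_ev hj.symm] at this
    exact (p.smul_mem_iff (h N (by omega))).1 this

theorem swap_ev_mem_wt (i j : Fin ℓ) (n : ℕ) :
    S.swap.ev i j n ∈ S.wt (-(S.root j + n • S.root i)) := by
  rw [← PreSystem.swap_wt]
  exact PreSystem.ev_mem_wt (S := S.swap.toPreSystem) i j n

theorem e_swap_ev {i j : Fin ℓ} (hj : j ≠ i) (n : ℕ) :
    bracket (S.e i) (S.swap.ev i j (n + 1)) =
      (koszul (S.par i) (S.par i) * S.coeff i j (n + 1)) • S.swap.ev i j n := by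
  have h : bracket (koszul (S.par i) (S.par i) • S.e i) (S.swap.ev i j (n + 1)) =
    S.coeff i j (n + 1) • S.swap.ev i j n := PreSystem.f_ev (S := S.swap.toPreSystem) hj.symm n
  rw [mul_smul, ← h, map_smul, LinearMap.smul_apply, smul_smul, koszul_mul_self, one_smul]

variable [FiniteDimensional ℂ H]

/-- Such a weight has coefficient 1 at α_j and -1 at α_k, whereas the coefficients of a weight never
have opposite signs. -/
theorem wt_sub_eq_bot (S : System ℓ H L) {i j k : Fin ℓ} (hj : j ≠ i) (hk : k ≠ i) (hjk : j ≠ k)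
    (a b : ℕ) : S.wt ((S.root j + a • S.root i) + -(S.root k + b • S.root i)) = ⊥ := by
  obtain ⟨ω, hω⟩ := S.exists_coweight
  by_contra hne
  have h1 : ((S.root j + a • S.root i) + -(S.root k + b • S.root i)) (ω j) = 1 := by
    simp [hω, hj.symm, hjk.symm]
  have h2 : ((S.root j + a • S.root i) + -(S.root k + b • S.root i)) (ω k) = -1 := by
    simp [hω, hk.symm, hjk]
  rcases S.weight_cases hne with h | ⟨m, -, h⟩ | ⟨m, -, h⟩
  · rw [h] at h1
    simp at h1
  · rw [h, S.contentWeight_coweight hω] at h2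
    have : (m.count k : ℂ) + 1 = 0 := by rw [h2]; ring
    exact absurd this (Nat.cast_add_one_ne_zero _)
  · rw [h, LinearMap.neg_apply, S.contentWeight_coweight hω] at h1
    have : (m.count j : ℂ) + 1 = 0 := by rw [← h1]; ring
    exact absurd this (Nat.cast_add_one_ne_zero _)

/-- This provides the coroot of the reflected system. Only `x ≠ 0` matters, since it keeps the new
coroots independent. -/
theorem exists_bracket_ev_ev {i j : Fin ℓ} (hj : j ≠ i) {N : ℕ}
    (h : ∀ n, n < N → S.coeff i j (n + 1) ≠ 0) :
    ∃ x y : ℂ, x ≠ 0 ∧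
      bracket (S.ev i j N) (S.swap.ev i j N) = S.c (x • S.coroot j + y • S.coroot i) := by
  induction N with
  | zero =>
    refine ⟨1, 0, one_ne_zero, ?_⟩
    rw [PreSystem.ev_zero, PreSystem.ev_zero, one_smul, zero_smul, add_zero]
    exact S.e_f_same j
  | succ N ih =>
    obtain ⟨x, y, hx, hxy⟩ := ih fun n hn => h n (by omega)
    -- This bracket is a multiple of f_i, so after bracketing with e_i it affects only the
    -- coefficient of the i-th coroot.
    have hwt : bracket (S.ev i j N) (S.swap.ev i j (N + 1)) ∈ S.wt (-S.root i) := by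
      have := PreSystem.bracket_mem_wt (PreSystem.ev_mem_wt (S := S.toPreSystem) i j N)
        (S.swap_ev_mem_wt i j (N + 1))
      rwa [show S.root j + N • S.root i + -(S.root j + (N + 1) • S.root i) = -S.root i by
        rw [succ_nsmul]; abel] at this
    rw [S.wt_neg_root, Submodule.mem_span_singleton] at hwt
    obtain ⟨t, ht⟩ := hwt
    have hjac := jacobi_right (S.e_mem i) (PreSystem.ev_mem_part (S := S.toPreSystem) i j N)
      (S.swap.ev i j (N + 1))
    rw [← PreSystem.ev_succ, ← ht, e_swap_ev hj, map_smul, map_smul, S.e_f_same, hxy] at hjac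
    set s := koszul (S.par i) (S.par j + N • S.par i) with hs
    refine ⟨-(s * (koszul (S.par i) (S.par i) * S.coeff i j (N + 1)) * x),
      t - s * (koszul (S.par i) (S.par i) * S.coeff i j (N + 1)) * y,
      neg_ne_zero.2 (mul_ne_zero (mul_ne_zero (koszul_ne_zero _ _)
        (mul_ne_zero (koszul_ne_zero _ _) (h N (by omega)))) hx), ?_⟩
    rw [← sub_eq_iff_eq_add] at hjac
    rw [← hjac, smul_smul, ← map_smul, ← map_smul, ← map_sub]
    congr 1
    module

/-- The reflected Chevalley system. -/
theorem exists_reflected {i : Fin ℓ} {m : Fin ℓ → ℕ}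
    (hm : S.IsStringLength i m) :
    ∃ S' : System ℓ H L, S'.c = S.c ∧
      (S'.root = fun j => if j = i then -S.root i else S.root j + m j • S.root i) ∧
      (Matrix.of fun j k => S'.root k (S'.coroot j)).rank =
        (Matrix.of fun j k => S.root k (S.coroot j)).rank := by
  choose! x y hx hxy using fun j (hj : j ≠ i) => exists_bracket_ev_ev hj (hm.coeff_ne j hj)
  let root' : Fin ℓ → Module.Dual ℂ H :=
    fun j => if j = i then -S.root i else S.root j + m j • S.root i
  let coroot' : Fin ℓ → H := fun j => if j = i then
    (-koszul (S.par i) (S.par i)) • S.coroot i else x j • S.coroot j + y j • S.coroot i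
  let e' : Fin ℓ → L := fun j => if j = i then S.f i else S.ev i j (m j)
  let f' : Fin ℓ → L := fun j => if j = i then S.e i else S.swap.ev i j (m j)
  let par' : Fin ℓ → ZMod 2 := fun j => if j = i then S.par i else S.par j + m j • S.par i
  have hroot_li : LinearIndependent ℂ root' := by
    have h : root' = fun j => if j = i then (-1 : ℂ) • S.root i else
        (1 : ℂ) • S.root j + (m j : ℂ) • S.root i := by
      funext j
      rw [neg_one_smul, one_smul, Nat.cast_smul_eq_nsmul]
    rw [h]
    exact linearIndependent_elementary S.root_li i (neg_ne_zero.2 one_ne_zero)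
      (fun _ _ => one_ne_zero)
  have hcoroot_li : LinearIndependent ℂ coroot' :=
    linearIndependent_elementary S.coroot_li i (neg_ne_zero.2 (koszul_ne_zero _ _)) hx
  have hri : root' i = -S.root i := if_pos rfl
  have hci : coroot' i = (-koszul (S.par i) (S.par i)) • S.coroot i := if_pos rfl
  have hei : e' i = S.f i := if_pos rfl
  have hfi : f' i = S.e i := if_pos rfl
  have hpi : par' i = S.par i := if_pos rfl
  have hrj : ∀ j, j ≠ i → root' j = S.root j + m j • S.root i := fun j hj => if_neg hj
  have hcj : ∀ j, j ≠ i → coroot' j = x j • S.coroot j + y j • S.coroot i := fun j hj => if_neg hj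
  have hej : ∀ j, j ≠ i → e' j = S.ev i j (m j) := fun j hj => if_neg hj
  have hfj : ∀ j, j ≠ i → f' j = S.swap.ev i j (m j) := fun j hj => if_neg hj
  have hpj : ∀ j, j ≠ i → par' j = S.par j + m j • S.par i := fun j hj => if_neg hj
  have he_wt : ∀ j, e' j ∈ S.wt (root' j) := by
    intro j
    by_cases hj : j = i
    · rw [hj, hei, hri]
      exact S.f_mem_wt i
    · rw [hej j hj, hrj j hj]
      exact PreSystem.ev_mem_wt i j _
  have hf_wt : ∀ j, f' j ∈ S.wt (-root' j) := by
    intro j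
    by_cases hj : j = i
    · rw [hj, hfi, hri, neg_neg]
      exact S.e_mem_wt i
    · rw [hfj j hj, hrj j hj]
      exact S.swap_ev_mem_wt i j _
  have he_mem : ∀ j, e' j ∈ part (V := L) (par' j) := by
    intro j
    by_cases hj : j = i
    · rw [hj, hei, hpi]
      exact S.f_mem i
    · rw [hej j hj, hpj j hj]
      exact PreSystem.ev_mem_part i j _
  have hf_mem : ∀ j, f' j ∈ part (V := L) (par' j) := by
    intro j
    by_cases hj : j = i
    · rw [hj, hfi, hpi]
      exact S.e_mem i
    · rw [hfj j hj, hpj j hj]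
      exact PreSystem.ev_mem_part (S := S.swap.toPreSystem) i j _
  refine ⟨⟨⟨par', root', coroot', S.c, e', f', S.c_mem, he_mem, hf_mem, S.c_c,
    fun h k => PreSystem.mem_wt.1 (he_wt k) h, fun h k => ?_, fun k => ?_, fun j k hjk => ?_⟩,
    hroot_li, hcoroot_li, fun p hc he hf hb z => ?_⟩, rfl, rfl, ?_⟩
  · rw [PreSystem.mem_wt.1 (hf_wt k) h, LinearMap.neg_apply, neg_smul]
  · by_cases hk : k = i
    · rw [hk, hei, hfi, hci, S.f_e_same, map_smul, neg_smul]
    · rw [hej k hk, hfj k hk, hcj k hk, hxy k hk]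
  · by_cases hj : j = i
    · have hk : k ≠ i := fun hk => hjk (hj.trans hk.symm)
      rw [hj, hei, hfj k hk]
      exact (PreSystem.ev_succ (S := S.swap.toPreSystem) i k (m k)).symm.trans (hm.swap_ev_eq k hk)
    · by_cases hk : k = i
      · rw [hk, hfi, hej j hj, LieSuperalgebra.skew (PreSystem.ev_mem_part i j _) (S.e_mem i),
          ← PreSystem.ev_succ, hm.ev_eq j hj, smul_zero, neg_zero]
      · have := PreSystem.bracket_mem_wt (he_wt j) (hf_wt k)
        rw [hrj j hj, hrj k hk, S.wt_sub_eq_bot hj hk hjk] at this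
        exact (Submodule.mem_bot ℂ).1 this
  -- Since e_i and f_i are merely exchanged, both strings can be descended inside `p` to recover the
  -- old generators.
  · have hpe : S.e i ∈ p := hfi ▸ hf i
    have hpf : S.f i ∈ p := hei ▸ he i
    refine S.gen p hc (fun j => ?_) (fun j => ?_) hb z
    · by_cases hj : j = i
      · exact hj ▸ hpe
      · refine ev_mem_of_ev_mem hj (hm.coeff_ne j hj) (hej j hj ▸ he j) fun n hn => ?_
        exact hb _ _ _ hpf _ hn (S.f_mem i) (PreSystem.ev_mem_part i j n)
    · by_cases hj : j = i
      · exact hj ▸ hpf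
      · refine ev_mem_of_ev_mem (S := S.swap) hj (hm.coeff_ne j hj) (hfj j hj ▸ hf j)
          fun n hn => ?_
        exact hb _ _ _ (p.smul_mem _ hpe) _ hn (S.swap.f_mem i)
          (PreSystem.ev_mem_part (S := S.swap.toPreSystem) i j n)
  · have hs : ∀ j, S.root j ∈ Submodule.span ℂ (Set.range S.root) :=
      fun j => Submodule.subset_span ⟨j, rfl⟩
    have hs' : ∀ j, S.coroot j ∈ Submodule.span ℂ (Set.range S.coroot) :=
      fun j => Submodule.subset_span ⟨j, rfl⟩
    refine rank_pairing_eq hroot_li hcoroot_li (fun j => ?_) fun j => ?_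
    · change root' j ∈ _
      by_cases hj : j = i
      · rw [hj, hri]
        exact neg_mem (hs i)
      · rw [hrj j hj]
        exact add_mem (hs j) (Submodule.smul_of_tower_mem _ _ (hs i))
    · change coroot' j ∈ _
      by_cases hj : j = i
      · rw [hj, hci]
        exact Submodule.smul_mem _ _ (hs' i)
      · rw [hcj j hj]
        exact add_mem (Submodule.smul_mem _ _ (hs' j)) (Submodule.smul_mem _ _ (hs' i))

end System

end system

/-! ### Reflexions of root bases -/

section bases

variable {V : Type v} [AddCommGroup V] [Module ℂ V]

theorem exists_add_of_mem_closure {T : Set V} {x : V} (hx : x ∈ AddSubmonoid.closure T)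
    (h0 : x ≠ 0) : ∃ s ∈ T, ∃ y ∈ AddSubmonoid.closure T, x = s + y := by
  suffices h : x = 0 ∨ ∃ s ∈ T, ∃ y ∈ AddSubmonoid.closure T, x = s + y from h.resolve_left h0
  clear h0
  induction hx using AddSubmonoid.closure_induction with
  | mem s hs => exact .inr ⟨s, hs, 0, zero_mem _, (add_zero s).symm⟩
  | zero => exact .inl rfl
  | add x y hx hy ihx ihy =>
    rcases ihx with rfl | ⟨s, hs, z, hz, rfl⟩
    · simpa using ihy
    · exact .inr ⟨s, hs, z + y, add_mem hz hy, add_assoc _ _ _⟩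

theorem exists_nat_of_mem_closure {T : Set V} (δ : Module.Dual ℂ V)
    (hδ : ∀ t ∈ T, ∃ n : ℕ, δ t = n) {x : V} (hx : x ∈ AddSubmonoid.closure T) :
    ∃ n : ℕ, δ x = n := by
  induction hx using AddSubmonoid.closure_induction with
  | mem s hs => exact hδ s hs
  | zero => exact ⟨0, by simp⟩
  | add x y _ _ ihx ihy =>
    obtain ⟨a, ha⟩ := ihx
    obtain ⟨b, hb⟩ := ihy
    exact ⟨a + b, by rw [map_add, ha, hb, Nat.cast_add]⟩

theorem natCast_add_one_ne_neg (n m : ℕ) : (n : ℂ) ≠ -((m : ℂ) + 1) := by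
  intro h
  have : ((n + m : ℕ) : ℂ) + 1 = 0 := by push_cast; rw [h]; ring
  exact Nat.cast_add_one_ne_zero _ this

/-- A reflected base consists of the opposite of the simple root and of the ends of the strings
of the other ones. -/
theorem IsReflexion.exists_strings {ι : Type*} [Fintype ι] [DecidableEq ι] {α : ι → V}
    (hα : LinearIndependent ℂ α) {i : ι} {Δ S' : Set V}
    (h : IsReflexion Δ (Set.range α) (α i) S') :
    ∃ N : ι → ℕ, (∀ j, j ≠ i → IsGreatest {n : ℤ | α j + n • α i ∈ Δ} (N j)) ∧
      S' = Set.range fun j => if j = i then -α i else α j + N j • α i := by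
  -- The proof compares two coordinate systems: δ for the original base and ε for `S'`. Each takes
  -- natural values on sums of elements of its own base.
  obtain ⟨δ, hδ⟩ := exists_dual_family hα
  classical
  obtain ⟨ε, hε⟩ := exists_dual_family h.target.linearIndependent
  have hε1 : ∀ s : S', ε s s = 1 := fun s => by simpa using hε s s
  have hε0 : ∀ s t : S', t ≠ s → ε s t = 0 := fun s t hts => by simpa [hts] using hε s t
  have hεnat : ∀ (s : S') {x : V}, x ∈ AddSubmonoid.closure S' → ∃ n : ℕ, ε s x = n := by
    intro s x hx
    refine exists_nat_of_mem_closure (ε s) (fun t ht => ?_) hx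
    by_cases hts : (⟨t, ht⟩ : S') = s
    · exact ⟨1, by rw [← hts, Nat.cast_one]; exact hε1 ⟨t, ht⟩⟩
    · exact ⟨0, by rw [Nat.cast_zero]; exact hε0 s ⟨t, ht⟩ hts⟩
  have hδnat : ∀ k {x : V}, x ∈ AddSubmonoid.closure (Set.range α) → ∃ n : ℕ, δ k x = n := by
    intro k x hx
    refine exists_nat_of_mem_closure (δ k) ?_ hx
    rintro _ ⟨j, rfl⟩
    exact ⟨if j = k then 1 else 0, by rw [hδ]; split_ifs <;> simp⟩
  have hmult : ∀ {x : V}, x ∈ AddSubmonoid.closure (Set.range α) → (∀ k, k ≠ i → δ k x = 0) →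
      ∃ n : ℕ, x = n • α i := by
    intro x hx hk
    obtain ⟨a, rfl⟩ := AddSubmonoid.mem_closure_range_iff_of_fintype.1 hx
    refine ⟨a i, Finset.sum_eq_single i (fun k _ hki => ?_) (by simp)⟩
    have := hk k hki
    rw [map_sum, Finset.sum_eq_single k (fun j _ hj => by simp [hδ, hj]) (by simp), map_nsmul, hδ,
      if_pos rfl, nsmul_eq_mul, mul_one, Nat.cast_eq_zero] at this
    rw [this, zero_smul]
  have hαi : α i ≠ 0 := hα.ne_zero i
  -- the elements of `S'` other than negative multiples of `α i`
  have hS'pos : ∀ s ∈ S', s ∈ positiveRoots Δ S' :=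
    fun s hs => ⟨h.target.subset hs, AddSubmonoid.subset_closure hs⟩
  have hS'ne : ∀ s ∈ S', s ≠ 0 := fun s hs h0 => by
    have := hε1 ⟨s, hs⟩
    simp [h0] at this
  have hdich : ∀ s ∈ S', (∃ n : ℕ, 0 < n ∧ s = n • -α i) ∨
      s ∈ positiveRoots Δ (Set.range α) \ positiveMultiples (α i) := by
    intro s hs
    by_cases hm : s ∈ positiveMultiples (-α i)
    · exact .inl hm
    · exact .inr (h.diff_eq ▸ ⟨hS'pos s hs, hm⟩)
  have hδS' : ∀ k, k ≠ i → ∀ s ∈ S', ∃ n : ℕ, δ k s = n := by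
    intro k hk s hs
    rcases hdich s hs with ⟨n, -, rfl⟩ | hs'
    · exact ⟨0, by simp [hδ, hk.symm]⟩
    · exact hδnat k hs'.1.2
  -- elements of `S'` without coordinates outside `i`
  have hneg : ∀ s ∈ S', (∀ k, k ≠ i → δ k s = 0) → ∃ n : ℕ, 0 < n ∧ s = n • -α i := by
    intro s hs hk
    refine (hdich s hs).resolve_right fun hs' => hs'.2 ?_
    obtain ⟨n, hn⟩ := hmult hs'.1.2 hk
    refine ⟨n, Nat.pos_of_ne_zero fun h0 => hS'ne s hs ?_, hn⟩
    rw [hn, h0, zero_smul]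
  -- The root -α_i is positive for `S'`. A summand s of it has no coordinate outside i, so s =
  -- n(-α_i); its own ε-coordinate then gives n·a = 1 with natural a, hence n = 1.
  have hmem : -α i ∈ S' := by
    have hΔ : α i ∈ positiveRoots Δ S' ∪ {α | -α ∈ positiveRoots Δ S'} :=
      h.target.eq_union ▸ h.mem.1
    have hcl : -α i ∈ AddSubmonoid.closure S' := by
      refine (hΔ.resolve_left fun hpos => ?_).2
      by_cases hm : α i ∈ positiveMultiples (-α i)
      · obtain ⟨n, -, hn⟩ := hm
        have := congrArg (δ i) hn
        rw [map_nsmul, map_neg, hδ, if_pos rfl, nsmul_eq_mul, mul_neg_one] at this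
        have h2 : ((n : ℕ) : ℂ) + 1 = 0 := by rw [this]; ring
        exact Nat.cast_add_one_ne_zero n h2
      · have : α i ∈ positiveRoots Δ (Set.range α) \ positiveMultiples (α i) :=
          h.diff_eq ▸ ⟨hpos, hm⟩
        exact this.2 ⟨1, one_pos, (one_smul ℕ _).symm⟩
    obtain ⟨s, hs, y, hy, hsy⟩ := exists_add_of_mem_closure hcl (neg_ne_zero.2 hαi)
    obtain ⟨n, hn, hsn⟩ := hneg s hs fun k hk => by
      obtain ⟨a, ha⟩ := hδS' k hk s hs
      obtain ⟨b, hb⟩ := exists_nat_of_mem_closure (δ k) (hδS' k hk) hy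
      have := congrArg (δ k) hsy
      rw [map_neg, hδ, if_neg hk.symm, neg_zero, map_add, ha, hb] at this
      have h0 : a + b = 0 := by exact_mod_cast this.symm
      rw [ha, show a = 0 by omega, Nat.cast_zero]
    have h1 := hε1 ⟨s, hs⟩
    obtain ⟨b, hb⟩ := hεnat ⟨s, hs⟩ hy
    obtain ⟨a, ha⟩ := hεnat ⟨s, hs⟩ hcl
    have h2 : (n : ℂ) * a = 1 := by
      rw [← h1]
      refine Eq.trans ?_ (congrArg (ε ⟨s, hs⟩) hsn).symm
      rw [map_nsmul, ha, nsmul_eq_mul]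
    have h3 : n * a = 1 := by exact_mod_cast h2
    rw [Nat.eq_one_of_mul_eq_one_right h3, one_smul] at hsn
    exact hsn ▸ hs
  let σ : S' := ⟨-α i, hmem⟩
  have hσ : ε σ (α i) = -1 := by
    have := hε1 σ
    change ε σ (-α i) = 1 at this
    rw [map_neg] at this
    rw [← this, neg_neg]
  have hht : ∀ s ∈ S', s ≠ -α i → ∃ k, k ≠ i ∧ δ k s ≠ 0 := by
    intro s hs hne
    by_contra hcon
    push Not at hcon
    obtain ⟨n, hn, hsn⟩ := hneg s hs hcon
    have h1 := hε1 ⟨s, hs⟩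
    have h0 := hε0 ⟨s, hs⟩ σ fun he => hne (congrArg Subtype.val he).symm
    change ε ⟨s, hs⟩ (-α i) = 0 at h0
    have h2 := congrArg (ε ⟨s, hs⟩) hsn
    rw [map_nsmul, h0, smul_zero] at h2
    exact zero_ne_one (h2.symm.trans h1)
  -- The root α_j is positive for `S'`. Its δ-coordinates outside i add up to 1, and each element of
  -- `S'` other than -α_i contributes at least 1 to them, so exactly one such element occurs,
  -- together with copies of -α_i.
  have hclos : ∀ j, j ≠ i → ∃ s ∈ S', s ≠ -α i ∧ ∃ n : ℕ, s = α j + n • α i := by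
    intro j hj
    have hαj : α j ∈ AddSubmonoid.closure S' := by
      have : α j ∈ positiveRoots Δ S' \ positiveMultiples (-α i) := by
        rw [← h.diff_eq]
        refine ⟨⟨h.source.subset ⟨j, rfl⟩, AddSubmonoid.subset_closure ⟨j, rfl⟩⟩, ?_⟩
        rintro ⟨n, -, hn⟩
        have := congrArg (δ j) hn
        simp [hδ, hj.symm] at this
      exact this.1.2
    rw [show S' = insert (-α i) (S' \ {-α i}) by
      rw [Set.insert_sdiff_singleton, Set.insert_eq_of_mem hmem], Set.insert_eq,
      AddSubmonoid.closure_union, AddSubmonoid.mem_sup] at hαj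
    obtain ⟨a, ha, y, hy, hay⟩ := hαj
    obtain ⟨n, rfl⟩ := AddSubmonoid.mem_closure_singleton.1 ha
    have hcoord : ∀ k, k ≠ i → δ k y = δ k (α j) := by
      intro k hk
      rw [← hay, map_add, map_nsmul, map_neg, hδ k i, if_neg hk.symm]
      simp
    have hy0 : y ≠ 0 := by
      rintro rfl
      have := hcoord j hj
      simp [hδ] at this
    obtain ⟨s, hs, z, hz, rfl⟩ := exists_add_of_mem_closure hy hy0
    have hTnat : ∀ k, k ≠ i → ∀ t ∈ S' \ {-α i}, ∃ n : ℕ, δ k t = n :=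
      fun k hk t ht => hδS' k hk t ht.1
    have hone : ∀ s z, s ∈ S' \ {-α i} → z ∈ AddSubmonoid.closure (S' \ {-α i}) →
        (∀ k, k ≠ i → δ k (s + z) = δ k (α j)) → δ j s = 1 := by
      intro s z hs hz hc
      obtain ⟨k, hk, hk0⟩ := hht s hs.1 hs.2
      obtain ⟨a, ha⟩ := hTnat k hk s hs
      obtain ⟨b, hb⟩ := exists_nat_of_mem_closure (δ k) (hTnat k hk) hz
      have := hc k hk
      rw [map_add, ha, hb, hδ] at this
      have ha0 : a ≠ 0 := fun h0 => hk0 (by rw [ha, h0, Nat.cast_zero])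
      split_ifs at this with hjk
      · have h1 : a + b = 1 := by exact_mod_cast this
        rw [hjk, ha, show a = 1 by omega, Nat.cast_one]
      · have h1 : a + b = 0 := by exact_mod_cast this
        omega
    have hz0 : z = 0 := by
      by_contra hz0
      obtain ⟨t, ht, w, hw, rfl⟩ := exists_add_of_mem_closure hz hz0
      have h1 := hone s (t + w) hs hz hcoord
      have h2 := hone t (s + w) ht (add_mem (AddSubmonoid.subset_closure hs) hw) fun k hk => by
        rw [← hcoord k hk]; congr 1; abel
      obtain ⟨b, hb⟩ := exists_nat_of_mem_closure (δ j) (hTnat j hj) hw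
      have := hcoord j hj
      rw [map_add, map_add, h1, h2, hb, hδ, if_pos rfl] at this
      have h3 : 1 + (1 + b) = 1 := by exact_mod_cast this
      omega
    refine ⟨s, hs.1, hs.2, n, ?_⟩
    rw [← hay, hz0, add_zero, smul_neg]
    abel
  choose! γ hγS hγne N hγ using hclos
  have hsub : ∀ j, (if j = i then -α i else α j + N j • α i) ∈ S' := by
    intro j
    split_ifs with hj
    · exact hmem
    · exact hγ j hj ▸ hγS j hj
  refine ⟨N, fun j hj => ⟨?_, ?_⟩, ?_⟩
  · have := h.target.subset (hγS j hj)
    rw [hγ j hj] at this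
    simpa using this
  -- Beyond N_j the ε-coordinate at -α_i would be N_j - n < 0, although the root is positive for
  -- both bases.
  · intro n (hn : α j + n • α i ∈ Δ)
    by_contra hlt
    push Not at hlt
    obtain ⟨d, hd⟩ : ∃ d : ℕ, n = N j + (d + 1) :=
      ⟨(n - N j - 1).toNat, by omega⟩
    have hnot : ∀ c : ℕ, α j + n • α i ≠ c • α i := by
      intro c hc
      have := congrArg (δ j) hc
      simp [hδ, hj.symm] at this
    have hpos : α j + n • α i ∈ positiveRoots Δ (Set.range α) := by
      have : α j + n • α i ∈ positiveRoots Δ (Set.range α) ∪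
        {α' | -α' ∈ positiveRoots Δ (Set.range α)} := h.source.eq_union ▸ hn
      refine this.resolve_right fun hneg' => ?_
      obtain ⟨a, ha⟩ := hδnat j hneg'.2
      rw [map_neg, map_add, map_zsmul, hδ, hδ, if_pos rfl, if_neg hj.symm, smul_zero,
        add_zero] at ha
      exact natCast_add_one_ne_neg a 0 (by rw [← ha]; simp)
    have hcl : α j + n • α i ∈ AddSubmonoid.closure S' := by
      have : α j + n • α i ∈ positiveRoots Δ S' \ positiveMultiples (-α i) :=
        h.diff_eq ▸ ⟨hpos, fun ⟨c, _, hc⟩ => hnot c hc⟩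
      exact this.1.2
    obtain ⟨a, ha⟩ := hεnat σ hcl
    have hγ0 := hε0 σ ⟨γ j, hγS j hj⟩ fun he => hγne j hj (congrArg Subtype.val he)
    change ε σ (γ j) = 0 at hγ0
    rw [hγ j hj, map_add, map_nsmul, hσ] at hγ0
    rw [map_add, map_zsmul, hσ, hd] at ha
    refine natCast_add_one_ne_neg a d ?_
    rw [← ha, eq_neg_of_add_eq_zero_left hγ0]
    simp
  -- For a further element t of `S'`, the coordinate ε_t vanishes on the listed elements, hence on
  -- every α_j and on all their combinations, including t itself.
  · refine Set.Subset.antisymm (fun t ht => ?_) (Set.range_subset_iff.2 hsub)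
    by_contra hcon
    have hzero : ∀ j, ε ⟨t, ht⟩ (if j = i then -α i else α j + N j • α i) = 0 := fun j =>
      hε0 ⟨t, ht⟩ ⟨_, hsub j⟩ fun he => hcon ⟨j, congrArg Subtype.val he⟩
    have hi0 : ε ⟨t, ht⟩ (α i) = 0 := by simpa using hzero i
    have hall : ∀ j, ε ⟨t, ht⟩ (α j) = 0 := by
      intro j
      by_cases hj : j = i
      · rw [hj, hi0]
      · simpa [hj, hi0] using hzero j
    have hcl : ∀ x ∈ AddSubmonoid.closure (Set.range α), ε ⟨t, ht⟩ x = 0 := by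
      intro x hx
      have : AddSubmonoid.closure (Set.range α) ≤
          (LinearMap.ker (ε ⟨t, ht⟩)).toAddSubmonoid := by
        rw [AddSubmonoid.closure_le]
        rintro _ ⟨j, rfl⟩
        exact hall j
      exact this hx
    have h1 : ε ⟨t, ht⟩ t = 1 := hε1 ⟨t, ht⟩
    rcases hdich t ht with ⟨n, -, hn⟩ | ht'
    · have h2 := congrArg (ε ⟨t, ht⟩) hn
      rw [map_nsmul, map_neg, hi0, neg_zero, smul_zero] at h2
      exact zero_ne_one (h2.symm.trans h1)
    · rw [hcl t ht'.1.2] at h1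
      exact zero_ne_one h1

end bases

section bases

variable {V : Type v} [AddCommGroup V] [Module ℂ V] {ι : Type*} [DecidableEq ι] {α : ι → V}

theorem string_eq_of_range_eq (hα : LinearIndependent ℂ α) {i : ι} {m N : ι → ℕ}
    (h : (Set.range fun j => if j = i then -α i else α j + m j • α i) =
      Set.range fun j => if j = i then -α i else α j + N j • α i) (j : ι) (hj : j ≠ i) :
    m j = N j := by
  obtain ⟨δ, hδ⟩ := exists_dual_family hα
  have hmem : α j + m j • α i ∈ Set.range fun j => if j = i then -α i else α j + N j • α i :=
    h ▸ ⟨j, if_neg hj⟩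
  obtain ⟨k, hk⟩ := hmem
  have hkj := congrArg (δ j) hk
  have hki := congrArg (δ i) hk
  by_cases hki' : k = i
  · simp [hki', hδ, hj.symm] at hkj
  · by_cases hkj' : k = j
    · subst hkj'
      simp only [if_neg hki', map_add, map_nsmul, hδ, if_true, zero_add, nsmul_eq_mul,
        mul_one, Nat.cast_inj] at hki
      exact hki.symm
    · simp [hki', hδ, hj.symm, hkj'] at hkj

end bases

/-! ### Weight spaces along strings, and root bases coming from Chevalley systems. -/

section system

variable {ℓ : ℕ} {H : Type u} [AddCommGroup H] [Module ℂ H] {L : Type v}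
    [AddCommGroup L] [Module ℂ L] [LieSuperalgebra L]

theorem PreSystem.EWord.eq_ev_self {S : PreSystem ℓ H L} {i : Fin ℓ} {n : ℕ} {x : L}
    (hx : S.EWord (Multiset.replicate (n + 1) i) x) : x = S.ev i i n := by
  generalize hm : Multiset.replicate (n + 1) i = m at hx
  induction hx generalizing n with
  | base k =>
    have h1 : k ∈ Multiset.replicate (n + 1) i := hm ▸ Multiset.mem_singleton_self k
    have h2 := congrArg Multiset.card hm
    rw [Multiset.card_replicate, Multiset.card_singleton] at h2
    obtain rfl : n = 0 := by omega
    rw [Multiset.eq_of_mem_replicate h1, ev_zero]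
  | step k m x hx ih =>
    have h1 : k ∈ Multiset.replicate (n + 1) i := hm ▸ Multiset.mem_cons_self k m
    rw [Multiset.eq_of_mem_replicate h1] at hm ⊢
    rw [Multiset.replicate_succ, Multiset.cons_inj_right] at hm
    rcases n with _ | n
    · exact absurd hm.symm hx.ne_zero
    · rw [ih hm, ev_succ]

/-- If the outermost letter is i, induction applies. If it is j, the rest is a word in e_i alone,
which vanishes unless it has length one, when skew symmetry exchanges the two letters. -/
theorem PreSystem.EWord.mem_span_ev {S : PreSystem ℓ H L} {i j : Fin ℓ} {n : ℕ} {x : L}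
    (h : 2 ≤ n → S.ev i i 1 = 0) (hx : S.EWord (Multiset.replicate n i + {j}) x) :
    x ∈ Submodule.span ℂ {S.ev i j n} := by
  induction n generalizing x with
  | zero =>
    rw [Multiset.replicate_zero, zero_add] at hx
    rw [hx.eq_ev_self (i := j) (n := 0), ev_zero, ev_zero]
    exact Submodule.mem_span_singleton_self _
  | succ n ih =>
    generalize hm : Multiset.replicate (n + 1) i + {j} = m at hx
    cases hx with
    | base k =>
      have h2 := congrArg Multiset.card hm
      rw [Multiset.card_add, Multiset.card_replicate, Multiset.card_singleton,
        Multiset.card_singleton] at h2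
      omega
    | step k m x hx =>
      have h1 : k ∈ Multiset.replicate (n + 1) i + {j} := hm ▸ Multiset.mem_cons_self k m
      rcases Multiset.mem_add.1 h1 with h1 | h1
      · rw [Multiset.eq_of_mem_replicate h1] at hm ⊢
        rw [Multiset.replicate_succ, Multiset.cons_add, Multiset.cons_inj_right] at hm
        obtain ⟨t, rfl⟩ := Submodule.mem_span_singleton.1 (ih (fun h2 => h (by omega)) (hm ▸ hx))
        rw [map_smul, ← ev_succ]
        exact Submodule.smul_mem _ _ (Submodule.mem_span_singleton_self _)
      · rw [Multiset.mem_singleton.1 h1] at hm ⊢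
        rw [add_comm, Multiset.singleton_add, Multiset.cons_inj_right] at hm
        subst hm
        rw [hx.eq_ev_self]
        rcases n with _ | n
        · rw [ev_zero, ev_succ, ev_zero, LieSuperalgebra.skew (S.e_mem j) (S.e_mem i)]
          exact neg_mem (Submodule.smul_mem _ _ (Submodule.mem_span_singleton_self _))
        · have h0 : ∀ n, S.ev i i (n + 1) = 0 := by
            intro r
            induction r with
            | zero => exact h (by omega)
            | succ r ihr => rw [ev_succ, ihr, map_zero]
          rw [h0, map_zero]
          exact zero_mem _

namespace System

variable (S : System ℓ H L)

/-- The nonzero weights. -/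
def roots : Set (Module.Dual ℂ H) := {α | α ≠ 0 ∧ S.wt α ≠ ⊥}

theorem mem_closure_root {β : Module.Dual ℂ H} :
    β ∈ AddSubmonoid.closure (Set.range S.root) ↔ ∃ m, β = S.contentWeight m := by
  constructor
  · intro h
    induction h using AddSubmonoid.closure_induction with
    | mem x hx =>
      obtain ⟨k, rfl⟩ := hx
      exact ⟨{k}, by simp⟩
    | zero => exact ⟨0, by simp⟩
    | add x y _ _ hx hy =>
      obtain ⟨m, rfl⟩ := hx
      obtain ⟨m', rfl⟩ := hy
      exact ⟨m + m', by simp [PreSystem.contentWeight]⟩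
  · rintro ⟨m, rfl⟩
    refine AddSubmonoid.multiset_sum_mem _ _ fun x hx => ?_
    obtain ⟨k, -, rfl⟩ := Multiset.mem_map.1 hx
    exact AddSubmonoid.subset_closure ⟨k, rfl⟩

theorem roots_eq_of_c_eq {S S' : System ℓ H L} (hc : S'.c = S.c) : S'.roots = S.roots := by
  unfold roots PreSystem.wt
  rw [hc]

variable [FiniteDimensional ℂ H]

theorem wt_string {i j : Fin ℓ} {n : ℕ} (h : 2 ≤ n → S.ev i i 1 = 0) :
    S.wt (S.root j + n • S.root i) ≤ Submodule.span ℂ {S.ev i j n} := by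
  rw [← PreSystem.contentWeight_replicate_add, S.wt_contentWeight (by simp)]
  exact Submodule.span_le.2 fun x hx => PreSystem.EWord.mem_span_ev h hx

variable {S}

theorem Reduced.isRootBase (hS : S.Reduced) (hneg : ∀ α ∈ S.roots, -α ∈ S.roots) :
    IsRootBase S.roots (Set.range S.root) where
  subset := by
    rintro _ ⟨k, rfl⟩
    refine ⟨S.root_li.ne_zero k, fun h => hS.e_ne_zero k ?_⟩
    exact (Submodule.mem_bot ℂ).1 (h ▸ S.e_mem_wt k)
  linearIndependent := S.root_li.linearIndepOn_id
  eq_union := by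
    ext β
    constructor
    · intro hβ
      rcases S.weight_cases hβ.2 with h | ⟨m, -, h⟩ | ⟨m, -, h⟩
      · exact absurd h hβ.1
      · exact .inl ⟨hβ, S.mem_closure_root.2 ⟨m, h⟩⟩
      · exact .inr ⟨hneg β hβ, S.mem_closure_root.2 ⟨m, by rw [h, neg_neg]⟩⟩
    · rintro (hβ | hβ)
      · exact hβ.1
      · have := hneg _ hβ.1
        rwa [neg_neg] at this
  disjoint := by
    rw [Set.disjoint_left]
    intro β hβ hβ'
    obtain ⟨m, hm⟩ := S.mem_closure_root.1 hβ.2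
    obtain ⟨m', hm'⟩ := S.mem_closure_root.1 hβ'.2
    have hm0 : m ≠ 0 := by
      rintro rfl
      exact hβ.1.1 (by rw [hm, PreSystem.contentWeight_zero])
    exact S.contentWeight_ne_neg hm0 (m' := m') (by rw [← hm', neg_neg, hm])

/-- A positive root that is not a multiple of α_i has a positive coefficient at some k ≠ i. A
coweight common to both systems reads the same coefficient in either base, so the root is positive
in both. -/
theorem positiveRoots_diff_subset {S S' : System ℓ H L} (hc : S'.c = S.c) {i : Fin ℓ}
    (hi : S'.root i = -S.root i)
    (hω : ∀ k, k ≠ i → ∃ h : H, (∀ j, S.root j h = if j = k then 1 else 0) ∧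
      ∀ j, S'.root j h = if j = k then 1 else 0) :
    positiveRoots S.roots (Set.range S.root) \ positiveMultiples (S.root i) ⊆
      positiveRoots S.roots (Set.range S'.root) \ positiveMultiples (S'.root i) := by
  rintro β ⟨⟨hβ, hβc⟩, hβm⟩
  obtain ⟨m, rfl⟩ := S.mem_closure_root.1 hβc
  obtain ⟨k, hkm, hk⟩ : ∃ k ∈ m, k ≠ i := by
    by_contra hcon
    push Not at hcon
    have hrep := Multiset.eq_replicate_of_mem hcon
    refine hβm ⟨m.card, Nat.pos_of_ne_zero fun h0 => hβ.1 ?_, ?_⟩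
    · rw [Multiset.card_eq_zero.1 h0, PreSystem.contentWeight_zero]
    · conv_lhs => rw [hrep]
      simp [PreSystem.contentWeight]
  obtain ⟨h, hh, hh'⟩ := hω k hk
  have hcount := S.contentWeight_apply hh m
  have hpos : m.count k ≠ 0 := (Multiset.count_pos.2 hkm).ne'
  have hβ' : S'.wt (S.contentWeight m) ≠ ⊥ := (roots_eq_of_c_eq hc ▸ hβ : _ ∈ S'.roots).2
  refine ⟨⟨hβ, ?_⟩, ?_⟩
  · rcases S'.weight_cases hβ' with h0 | ⟨m', -, h0⟩ | ⟨m', -, h0⟩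
    · exact absurd h0 hβ.1
    · exact S'.mem_closure_root.2 ⟨m', h0⟩
    · have := LinearMap.congr_fun h0 h
      rw [hcount, LinearMap.neg_apply, S'.contentWeight_apply hh', eq_neg_iff_add_eq_zero] at this
      have h1 : m.count k + m'.count k = 0 := by exact_mod_cast this
      omega
  · rintro ⟨n, -, hn⟩
    have := LinearMap.congr_fun hn h
    rw [hcount, hi, LinearMap.smul_apply, LinearMap.neg_apply, hh, if_neg hk.symm, neg_zero,
      smul_zero] at this
    exact hpos (by exact_mod_cast this)

theorem Reduced.isReflexion {S S' : System ℓ H L} (hS : S.Reduced)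
    (hneg : ∀ α ∈ S.roots, -α ∈ S.roots) (hc : S'.c = S.c) {i : Fin ℓ} {m : Fin ℓ → ℕ}
    (hroot : S'.root = fun j => if j = i then -S.root i else S.root j + m j • S.root i) :
    IsReflexion S.roots (Set.range S.root) (S.root i) (Set.range S'.root) := by
  have hS' : S'.Reduced := ⟨hc ▸ hS.injective, hc ▸ hS.ideal_eq_bot⟩
  have hr := roots_eq_of_c_eq hc
  have hi : S'.root i = -S.root i := by rw [hroot]; simp
  have hω : ∀ k, k ≠ i → ∃ h : H, (∀ j, S.root j h = if j = k then 1 else 0) ∧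
      ∀ j, S'.root j h = if j = k then 1 else 0 := by
    intro k hk
    obtain ⟨ω, hω⟩ := S.exists_coweight
    refine ⟨ω k, fun j => hω j k, fun j => ?_⟩
    rw [hroot]
    by_cases hj : j = i
    · simp [hj, hω, hk.symm]
    · simp [hj, hω, hk.symm]
  refine ⟨hS.isRootBase hneg, ⟨(hS.isRootBase hneg).subset ⟨i, rfl⟩,
    AddSubmonoid.subset_closure ⟨i, rfl⟩⟩, ?_, ?_⟩
  · rw [← hr] at hneg ⊢
    exact hS'.isRootBase hneg
  · refine Set.Subset.antisymm ?_ ?_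
    · have := positiveRoots_diff_subset hc hi hω
      rwa [hi] at this
    · have := positiveRoots_diff_subset hc.symm (S := S') (S' := S) (i := i)
        (by rw [hi, neg_neg]) fun k hk => (hω k hk).imp fun _ h => h.symm
      rwa [hi, hr] at this

/-- Besides the vanishing coefficient, singularity requires (ad e_i)^(m_j+1) to kill the j-th
coroot, that is, a_ji (ad e_i)^(m_j) e_i = 0. For length at least two this is automatic; lengths
zero and one are covered by `h3` and `h4`. -/
theorem Reduced.isStringLength (hS : S.Reduced) {i : Fin ℓ} {m : Fin ℓ → ℕ}
    (h1 : ∀ j, j ≠ i → ∀ n, n < m j → S.coeff i j (n + 1) ≠ 0)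
    (h2 : ∀ j, j ≠ i → S.coeff i j (m j + 1) = 0)
    (h3 : ∀ j, j ≠ i → m j = 0 → S.root i (S.coroot j) = 0)
    (h4 : ∀ j, j ≠ i → m j = 1 → S.par i = 0 ∨ S.root i (S.coroot i) = 0) :
    S.IsStringLength i m := by
  have key : ∀ T : System ℓ H L, T.Reduced → T.root = S.root → T.coroot = S.coroot →
      T.par = S.par → ∀ j, j ≠ i → T.ev i j (m j + 1) = 0 := by
    intro T hT hr hc hp j hj
    refine hT.ev_eq_zero hj.symm ?_ ?_
    · rw [PreSystem.coeff, hr, hc, hp]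
      exact h2 j hj
    · rw [T.e_pow_c, hr, hc]
      by_cases hm0 : m j = 0
      · rw [h3 j hj hm0, zero_smul, neg_zero]
      · obtain ⟨n, hn⟩ := Nat.exists_eq_succ_of_ne_zero hm0
        have h0 : T.ev i i (m j) = 0 := by
          rw [hn]
          rcases n with _ | n
          · rcases h4 j hj hn with h | h
            · exact PreSystem.ev_self_even (hp ▸ h) 0
            · exact hT.ev_self_isotropic (by rw [hr, hc]; exact h) 0
          · exact T.ev_self i n
        rw [h0, smul_zero, neg_zero]
  exact ⟨h1, key S hS rfl rfl rfl, key S.swap hS.swap rfl rfl rfl⟩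

end System

end system

/-! ### The implications between the conditions (a) to (d). -/

section contragredient

variable {ℓ : ℕ} {H : Type u} [AddCommGroup H] [Module ℂ H] {A : Matrix (Fin ℓ) (Fin ℓ) ℂ}
  (τ : Finset (Fin ℓ)) (R : Realization A H)

namespace Contragredient

/-- The swapped system is reduced with the same data, so it yields an automorphism acting by -1 on
𝔥, the Chevalley involution. -/
theorem neg_mem_roots {α : Module.Dual ℂ H} (hα : α ∈ roots τ R) : -α ∈ roots τ R := by
  obtain ⟨φ, hφ, hc⟩ := System.exists_iso τ R (system τ R).swap (reduced τ R).swap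
    (fun _ => rfl) rfl rfl
  refine ⟨neg_ne_zero.2 hα.1, fun h => hα.2 (eq_bot_iff.2 fun x hx => ?_)⟩
  have hx' : φ x ∈ rootSpace τ R (-α) := by
    refine (PreSystem.mem_wt (S := (system τ R).toPreSystem)).2 fun h => ?_
    change bracket (cartan τ R h) (φ x) = _
    rw [← hc, ← hφ.map_bracket]
    change φ (bracket (-cartan τ R h) x) = _
    have hx1 : bracket (cartan τ R h) x = α h • x :=
      (PreSystem.mem_wt (S := (system τ R).toPreSystem)).1 hx h
    rw [map_neg, LinearMap.neg_apply, hx1, ← neg_smul, map_smul, LinearMap.neg_apply]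
  rw [h, Submodule.mem_bot] at hx'
  exact (Submodule.mem_bot ℂ).2 ((map_eq_zero_iff φ φ.injective).1 hx')

/-- The equality of ranks is what makes the same 𝔥 a realization of the new Cartan matrix. -/
theorem isContragredientBase_of_system (S : System ℓ H (Contragredient τ R))
    (hc : S.c = cartan τ R)
    (hrank : (Matrix.of fun j k => S.root k (S.coroot j)).rank = A.rank)
    (hbase : IsRootBase (roots τ R) (Set.range S.root)) :
    IsContragredientBase τ R (Set.range S.root) := by
  classical
  let τ' : Finset (Fin ℓ) := Finset.univ.filter fun k => S.par k = 1
  let R' : Realization (Matrix.of fun j k => S.root k (S.coroot j)) H :=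
    { finiteDimensional := R.finiteDimensional
      finrank_add_rank := by rw [hrank, R.finrank_add_rank]
      root := S.root
      coroot := S.coroot
      linearIndependent_root := S.root_li
      linearIndependent_coroot := S.coroot_li
      root_coroot := fun _ _ => rfl }
  have hS : S.Reduced := ⟨hc ▸ (reduced τ R).injective, hc ▸ (reduced τ R).ideal_eq_bot⟩
  have hpar : ∀ k, S.par k = if k ∈ τ' then 1 else 0 := by
    intro k
    rcases zmod_two_cases (S.par k) with h | h <;> simp [τ', h]
  obtain ⟨φ, hφ, hφc⟩ := System.exists_iso τ' R' S hS hpar rfl rfl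
  refine ⟨hbase, ℓ, _, τ', H, inferInstance, inferInstance, R', φ, LinearEquiv.refl ℂ H, hφ,
    fun h => ?_, rfl⟩
  rw [← hc]
  exact hφc h

end Contragredient

open Contragredient

theorem CondA.condB {i : Fin ℓ} (h : CondA τ R i) : CondB τ R i :=
  h.imp fun _ h => h.1

/-- The strings α_j + nα_i are bounded by N_j, so the next vectors of the strings of e_j and f_j lie
in zero weight spaces. -/
theorem CondB.condC {i : Fin ℓ} (h : CondB τ R i) : CondC τ R i := by
  obtain ⟨S', hS'⟩ := h
  obtain ⟨N, hN, -⟩ := hS'.exists_strings R.linearIndependent_root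
  have := R.finiteDimensional
  set S := system τ R
  have hbot : ∀ j, j ≠ i → ∀ β, (β = S.root j + (N j + 1) • S.root i ∨
      β = -(S.root j + (N j + 1) • S.root i)) → S.wt β = ⊥ := by
    intro j hj β hβ
    by_contra hne
    have h0 : S.root j + (N j + 1) • S.root i ≠ 0 := by
      rw [← PreSystem.contentWeight_replicate_add]
      exact S.contentWeight_ne_zero (by simp)
    have hmem : S.root j + (N j + 1) • S.root i ∈ roots τ R := by
      rcases hβ with rfl | rfl
      · exact ⟨h0, hne⟩
      · have hneg : -(S.root j + (N j + 1) • S.root i) ∈ roots τ R := ⟨neg_ne_zero.2 h0, hne⟩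
        have := neg_mem_roots τ R hneg
        rwa [neg_neg] at this
    have h1 : ((N j + 1 : ℕ) : ℤ) ∈ {n : ℤ | R.root j + n • R.root i ∈ roots τ R} := by
      rw [Set.mem_ofPred_eq, natCast_zsmul]
      exact hmem
    have := (hN j hj).2 h1
    omega
  refine ⟨System.e_adLocallyNilpotent (S := S) fun j hj => ⟨N j + 1, ?_⟩,
    System.e_adLocallyNilpotent (S := S.swap) fun j hj => ⟨N j + 1, ?_⟩⟩
  · have := PreSystem.ev_mem_wt (S := S.toPreSystem) i j (N j + 1)
    rwa [hbot j hj _ (.inl rfl), Submodule.mem_bot] at this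
  · have := S.swap_ev_mem_wt i j (N j + 1)
    rwa [hbot j hj _ (.inr rfl), Submodule.mem_bot] at this

theorem coeff_system_even {i : Fin ℓ} (hi : i ∉ τ) (j : Fin ℓ) (n : ℕ) :
    2 * (system τ R).coeff i j n = -(n * (2 * A i j + (n - 1) * A i i)) := by
  have hp : (system τ R).par i = 0 := if_neg hi
  rw [PreSystem.coeff, hp, koszul_zero_left, stringCoeff_even]
  change -(_ * (2 * R.root j (R.coroot i) + _ * R.root i (R.coroot i))) = _
  rw [R.root_coroot, R.root_coroot]

theorem coeff_system_odd {i : Fin ℓ} (hi : i ∈ τ) (j : Fin ℓ) (n : ℕ) :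
    (system τ R).coeff i j (2 * n) = n * A i i ∧
      (system τ R).coeff i j (2 * n + 1) = A i j + n * A i i := by
  have hp : (system τ R).par i = 1 := if_pos hi
  rw [← R.root_coroot i i, ← R.root_coroot i j, PreSystem.coeff, PreSystem.coeff, hp,
    koszul_one_one]
  exact stringCoeff_odd _ _ _

theorem coeff_system_two {i : Fin ℓ} (ha : A i i = 0) (hi : i ∉ τ → ∀ j, A i j = 0) (j : Fin ℓ) :
    (system τ R).coeff i j 2 = 0 := by
  by_cases h : i ∈ τ
  · have := (coeff_system_odd τ R h j 1).1
    rwa [ha, mul_zero] at this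
  · have := coeff_system_even τ R h j 2
    rw [ha, hi h j] at this
    simpa using this

/-- Local nilpotency of isotropic raising and lowering operators. -/
theorem condC_of_isotropic {i : Fin ℓ} (ha : A i i = 0) (hi : i ∉ τ → ∀ j, A i j = 0) :
    CondC τ R i := by
  have := R.finiteDimensional
  have ha' : (system τ R).root i ((system τ R).coroot i) = 0 := (R.root_coroot i i).trans ha
  have key : ∀ T : System ℓ H (Contragredient τ R), T.Reduced → T.root = (system τ R).root →
      T.coroot = (system τ R).coroot → T.par = (system τ R).par → ∀ j, j ≠ i →
      ∃ n, T.ev i j n = 0 := by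
    intro T hT hr hc hp j hj
    refine ⟨2, hT.ev_eq_zero hj.symm ?_ ?_⟩
    · rw [PreSystem.coeff, hr, hc, hp]
      exact coeff_system_two τ R ha hi j
    · rw [T.e_pow_c, hT.ev_self_isotropic (by rw [hr, hc]; exact ha') 0, smul_zero, neg_zero]
  exact ⟨System.e_adLocallyNilpotent (key (system τ R) (reduced τ R) rfl rfl rfl),
    System.e_adLocallyNilpotent (key (system τ R).swap (reduced τ R).swap rfl rfl rfl)⟩

theorem CondC.exists_coeff {i : Fin ℓ} (h : CondC τ R i) {j : Fin ℓ} (hj : j ≠ i) :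
    ∃ m : ℕ, (system τ R).coeff i j (m + 1) = 0 ∧ (m = 0 → A j i = 0) := by
  obtain ⟨n, hn⟩ := h.1 ((system τ R).e j)
  obtain ⟨m, -, h2, h3⟩ := (reduced τ R).exists_coeff_eq_zero hj.symm (n := n) hn
  refine ⟨m, h3, fun hm => ?_⟩
  subst hm
  rw [← R.root_coroot j i]
  exact (reduced τ R).root_coroot_eq_zero hj.symm h2

theorem CondC.even {i : Fin ℓ} (hi : i ∉ τ) (h : CondC τ R i) {j : Fin ℓ} (hj : j ≠ i) :
    ∃ m : ℕ, 2 * A i j = -(m * A i i) ∧ (m = 0 → A j i = 0) := by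
  obtain ⟨m, hm, hm0⟩ := h.exists_coeff τ R hj
  refine ⟨m, ?_, hm0⟩
  have h1 := coeff_system_even τ R hi j (m + 1)
  rw [hm, mul_zero, eq_comm, neg_eq_zero, mul_eq_zero] at h1
  have h2 := h1.resolve_left (by exact_mod_cast Nat.succ_ne_zero m)
  push_cast at h2
  linear_combination h2

theorem CondC.odd {i : Fin ℓ} (ha : A i i ≠ 0) (hi : i ∈ τ) (h : CondC τ R i) {j : Fin ℓ}
    (hj : j ≠ i) : ∃ m : ℕ, A i j = -(m * A i i) ∧ (m = 0 → A j i = 0) := by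
  obtain ⟨m, hm, hm0⟩ := h.exists_coeff τ R hj
  obtain ⟨q, rfl | rfl⟩ := Nat.even_or_odd' m
  · refine ⟨q, ?_, fun hq => hm0 (by rw [hq])⟩
    rw [(coeff_system_odd τ R hi j q).2] at hm
    linear_combination hm
  -- An odd length is excluded: the coefficient would be (q+1)a_ii ≠ 0.
  · have := (coeff_system_odd τ R hi j (q + 1)).1
    rw [show 2 * (q + 1) = 2 * q + 1 + 1 from rfl, hm, eq_comm, mul_eq_zero] at this
    exact absurd (this.resolve_right ha) (by exact_mod_cast Nat.succ_ne_zero q)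

theorem CondC.condD {i : Fin ℓ} (ha : A i i ≠ 0) (h : CondC τ R i) : CondD τ A i where
  a1 h0 := absurd h0 ha
  a2 j hj := by
    have hji : j ≠ i := by
      rintro rfl
      exact ha hj
    by_cases hi : i ∈ τ
    · obtain ⟨m, hm, hm0⟩ := h.odd τ R ha hi hji
      rw [hj, eq_comm, neg_eq_zero, mul_eq_zero] at hm
      exact hm0 (by exact_mod_cast hm.resolve_right ha)
    · obtain ⟨m, hm, hm0⟩ := h.even τ R hi hji
      rw [hj, mul_zero, eq_comm, neg_eq_zero, mul_eq_zero] at hm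
      exact hm0 (by exact_mod_cast hm.resolve_right ha)
  a3_even _ hi j hj := by
    obtain ⟨m, hm, -⟩ := h.even τ R hi hj
    refine ⟨-m, by omega, ?_⟩
    rw [hm]
    push_cast
    field_simp
  a3_odd _ hi j hj := by
    obtain ⟨m, hm, -⟩ := h.odd τ R ha hi hj
    refine ⟨-m, by omega, ?_⟩
    rw [hm]
    push_cast
    field_simp

/-- Under the matrix conditions, the lengths of the strings of the simple roots. -/
theorem CondD.exists_stringLength {i : Fin ℓ} (h : CondD τ A i) :
    ∃ m : Fin ℓ → ℕ, (system τ R).IsStringLength i m ∧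
      (A i i ≠ 0 → ∀ j, j ≠ i → (m j : ℂ) = -(2 * A i j / A i i)) ∧
      (A i i = 0 → ∀ j, j ≠ i → m j = if A i j = 0 then 0 else 1) := by
  have := R.finiteDimensional
  have hr : ∀ j k, (system τ R).root k ((system τ R).coroot j) = A j k := R.root_coroot
  by_cases ha : A i i = 0
  -- In the isotropic case the first coefficient is a_ij up to sign and the second vanishes, so the
  -- length is at most one.
  · refine ⟨fun j => if A i j = 0 then 0 else 1, ?_, fun h0 => absurd ha h0, fun _ _ _ => rfl⟩
    have h1 : ∀ j, (system τ R).coeff i j 1 = -(koszul ((system τ R).par i) ((system τ R).par i) *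
        A i j) := by
      intro j
      rw [PreSystem.coeff, stringCoeff, stringCoeff, hr]
      simp
    refine (reduced τ R).isStringLength (fun j _ n hn => ?_) (fun j _ => ?_) (fun j _ hm => ?_)
      (fun j _ _ => .inr ((hr i i).trans ha))
    · split_ifs at hn with hij
      · omega
      · obtain rfl : n = 0 := by omega
        rw [h1]
        exact neg_ne_zero.2 (mul_ne_zero (koszul_ne_zero _ _) hij)
    · split_ifs with hij
      · rw [h1, hij, mul_zero, neg_zero]
      · exact coeff_system_two τ R ha (h.a1 ha) j
    · rw [hr]
      refine h.a2 j ?_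
      by_contra hij
      rw [if_neg hij] at hm
      exact one_ne_zero hm
  · have hrecover : ∀ j, j ≠ i → ∃ m : ℕ, (m : ℂ) = -(2 * A i j / A i i) ∧
        (∀ n, n < m → (system τ R).coeff i j (n + 1) ≠ 0) ∧
        (system τ R).coeff i j (m + 1) = 0 ∧ (m = 1 → (system τ R).par i = 0) := by
      intro j hj
      by_cases hi : i ∈ τ
      · obtain ⟨z, hz, hzA⟩ := h.a3_odd ha hi j hj
        obtain ⟨k, rfl⟩ : ∃ k : ℕ, z = -k := ⟨(-z).toNat, by omega⟩
        have hA : A i j = -(k * A i i) := by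
          rw [div_eq_iff ha] at hzA
          rw [hzA]
          push_cast
          ring
        -- For odd i the length is twice the integer -a_ij/a_ii; being even, it is never 1, where
        -- [e_i, e_i] ≠ 0 could interfere.
        refine ⟨2 * k, ?_, fun n hn => ?_, ?_, fun h1 => by omega⟩
        · rw [hA]
          field_simp
          push_cast
          ring
        · obtain ⟨q, rfl | rfl⟩ := Nat.even_or_odd' n
          · rw [(coeff_system_odd τ R hi j q).2, hA]
            have hqk : (q : ℂ) - k ≠ 0 := by
              rw [sub_ne_zero]
              exact_mod_cast (show q ≠ k by omega)
            intro h0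
            exact (mul_ne_zero hqk ha) (by linear_combination h0)
          · rw [show 2 * q + 1 + 1 = 2 * (q + 1) from rfl, (coeff_system_odd τ R hi j (q + 1)).1]
            exact mul_ne_zero (by exact_mod_cast Nat.succ_ne_zero q) ha
        · rw [(coeff_system_odd τ R hi j k).2, hA]
          ring
      · obtain ⟨z, hz, hzA⟩ := h.a3_even ha hi j hj
        obtain ⟨k, rfl⟩ : ∃ k : ℕ, z = -k := ⟨(-z).toNat, by omega⟩
        have hA : 2 * A i j = -(k * A i i) := by
          rw [div_eq_iff ha] at hzA
          rw [hzA]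
          push_cast
          ring
        have hc : ∀ n : ℕ, 2 * (system τ R).coeff i j (n + 1) =
            -(((n : ℂ) + 1) * (((n : ℂ) - k) * A i i)) := by
          intro n
          rw [coeff_system_even τ R hi, hA]
          push_cast
          ring
        refine ⟨k, ?_, fun n hn h0 => ?_, ?_, fun _ => if_neg hi⟩
        · rw [hzA]
          push_cast
          ring
        · have h1 := hc n
          rw [h0, mul_zero, eq_comm, neg_eq_zero] at h1
          have hnk : (n : ℂ) - k ≠ 0 := by
            rw [sub_ne_zero]
            exact_mod_cast hn.ne
          exact mul_ne_zero (Nat.cast_add_one_ne_zero n) (mul_ne_zero hnk ha) h1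
        · have h1 := hc k
          rw [sub_self, zero_mul, mul_zero, neg_zero, mul_eq_zero] at h1
          exact h1.resolve_left two_ne_zero
    choose! m hm h1 h2 h3 using hrecover
    refine ⟨m, ?_, fun _ => hm, fun h0 => absurd h0 ha⟩
    refine (reduced τ R).isStringLength h1 h2 (fun j hj hm0 => ?_)
      (fun j hj hm1 => .inl (h3 j hj hm1))
    rw [hr]
    refine h.a2 j ?_
    have := hm j hj
    rw [hm0, Nat.cast_zero, eq_comm, neg_eq_zero, div_eq_zero_iff, mul_eq_zero] at this
    exact (this.resolve_right ha).resolve_left two_ne_zero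

theorem exists_contragredient_reflexion {i : Fin ℓ} {m : Fin ℓ → ℕ}
    (hm : (system τ R).IsStringLength i m) :
    IsReflexion (roots τ R) (Set.range R.root) (R.root i)
        (Set.range fun j => if j = i then -R.root i else R.root j + m j • R.root i) ∧
      IsContragredientBase τ R
        (Set.range fun j => if j = i then -R.root i else R.root j + m j • R.root i) := by
  have := R.finiteDimensional
  obtain ⟨S', hc, hroot, hrank⟩ := System.exists_reflected hm
  have hrefl := (reduced τ R).isReflexion (fun α hα => neg_mem_roots τ R hα) hc hroot
  have hA : (Matrix.of fun j k => (system τ R).root k ((system τ R).coroot j)) = A := by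
    ext j k
    exact R.root_coroot j k
  rw [hA] at hrank
  have hcb := isContragredientBase_of_system τ R S' hc hrank hrefl.target
  rw [hroot] at hrefl hcb
  exact ⟨hrefl, hcb⟩

theorem CondD.condA {i : Fin ℓ} (h : CondD τ A i) : CondA τ R i := by
  obtain ⟨m, hm, -⟩ := h.exists_stringLength τ R
  exact ⟨_, exists_contragredient_reflexion τ R hm⟩

/-- Any reflexion at a simple root with given string lengths. -/
theorem reflexion_unique {i : Fin ℓ} {m : Fin ℓ → ℕ} (hm : (system τ R).IsStringLength i m)
    {g : Fin ℓ → Module.Dual ℂ H} (hgi : g i = -R.root i)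
    (hg : ∀ j, j ≠ i → g j = R.root j + m j • R.root i) {S : Set (Module.Dual ℂ H)}
    (hS : IsReflexion (roots τ R) (Set.range R.root) (R.root i) S) :
    S = Set.range g ∧ ∀ j, IsReflexionValue (roots τ R) (R.root i) (R.root j) (g j) := by
  have hli := R.linearIndependent_root
  -- Both the given reflexion and the constructed one are described by the greatest elements of the
  -- same root strings, hence coincide.
  obtain ⟨N, hN, rfl⟩ := hS.exists_strings hli
  obtain ⟨N', hN', hr⟩ := (exists_contragredient_reflexion τ R hm).1.exists_strings hli
  have hmN : ∀ j, j ≠ i → m j = N j := fun j hj => by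
    rw [string_eq_of_range_eq hli hr j hj]
    exact_mod_cast (hN' j hj).unique (hN j hj)
  refine ⟨congrArg _ (funext fun j => ?_), fun j => ?_⟩
  · split_ifs with hj
    · rw [hj, hgi]
    · rw [hg j hj, hmN j hj]
  · by_cases hj : j = i
    · exact .inl ⟨by rw [hj], by rw [hj, hgi]⟩
    · refine .inr ⟨fun he => hj (hli.injective he), N j, hN j hj, ?_⟩
      rw [hg j hj, hmN j hj, natCast_zsmul]

/-- A contragredient isotropic reflexion forces the symmetry of the vanishing of entries. -/
theorem CondA.symm_of_isotropic {i : Fin ℓ} (ha : A i i = 0) (h : CondA τ R i) {j : Fin ℓ}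
    (hij : A i j = 0) : A j i = 0 := by
  have := R.finiteDimensional
  obtain ⟨S', hS', -, ℓ', A', τ', H', _, _, R', φ, ψ, hφ, hψ, hbase⟩ := h
  have := R'.finiteDimensional
  by_contra hji
  have hj : j ≠ i := by
    rintro rfl
    exact hji hij
  set S := system τ R
  have hred : S.Reduced := reduced τ R
  have hr : ∀ j k, S.root k (S.coroot j) = A j k := R.root_coroot
  have hc : ∀ n, S.coeff i j n = 0 := by
    intro n
    rw [PreSystem.coeff, hr, hr, ha, hij]
    induction n with
    | zero => rfl
    | succ n ih => rw [stringCoeff, ih]; simp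
  have hii : S.ev i i 1 = 0 := hred.ev_self_isotropic ((hr i i).trans ha) 0
  -- Since a_ji ≠ 0 the string has length exactly one, although f_i kills [e_i, e_j] because a_ij =
  -- 0.
  have h1 : S.ev i j 1 ≠ 0 := fun h0 =>
    hji ((hr j i).symm.trans (hred.root_coroot_eq_zero hj.symm h0))
  have h2 : S.ev i j 2 = 0 := hred.ev_eq_zero hj.symm (hc 2) (by
    rw [S.e_pow_c, hii, smul_zero, neg_zero])
  have hev : ∀ n, 2 ≤ n → S.ev i j n = 0 := by
    intro n hn
    induction n, hn using Nat.le_induction with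
    | base => exact h2
    | succ n _ ih => rw [PreSystem.ev_succ, ih, map_zero]
  obtain ⟨N, hN, hrange⟩ := hS'.exists_strings R.linearIndependent_root
  have hN1 : N j = 1 := by
    have hmem : S.root j + N j • S.root i ∈ roots τ R := by
      have := (hN j hj).1
      rw [Set.mem_ofPred_eq, natCast_zsmul] at this
      exact this
    have hle : N j ≤ 1 := by
      by_contra hlt
      refine hmem.2 (eq_bot_iff.2 ?_)
      refine (S.wt_string (n := N j) fun _ => hii).trans ?_
      rw [hev _ (by omega), Submodule.span_zero_singleton]
    have hge : (1 : ℤ) ≤ N j := by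
      refine (hN j hj).2 (show _ ∈ roots τ R from ?_)
      rw [one_zsmul]
      have hmem := PreSystem.ev_mem_wt (S := S.toPreSystem) i j 1
      refine ⟨fun h0 => ?_, fun h0 => h1 ?_⟩
      · refine S.contentWeight_ne_zero (m := Multiset.replicate 1 i + {j}) (by simp) ?_
        rw [PreSystem.contentWeight_replicate_add, one_nsmul]
        exact h0
      · rw [one_nsmul] at hmem
        exact (Submodule.mem_bot ℂ).1 (h0 ▸ hmem)
    omega
  rw [hbase] at hrange
  obtain ⟨p, hp⟩ : -R.root i ∈ Set.range fun j => (R'.root j) ∘ₗ ψ.toLinearMap := by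
    rw [hrange]
    exact ⟨i, if_pos rfl⟩
  obtain ⟨q, hq⟩ : R.root j + R.root i ∈ Set.range fun j => (R'.root j) ∘ₗ ψ.toLinearMap := by
    rw [hrange]
    exact ⟨j, (if_neg hj).trans (by rw [hN1, one_nsmul])⟩
  set T := system τ' R'
  have hbr : ∀ (h : H) (x : Contragredient τ R),
      bracket (T.c (ψ h)) (φ x) = φ (bracket (S.c h) x) := by
    intro h x
    rw [hφ.map_bracket]
    exact congrArg (fun z => bracket z (φ x)) (hψ h).symm
  have hback : ∀ (r : Fin ℓ') (β : Module.Dual ℂ H), (R'.root r) ∘ₗ ψ.toLinearMap = β →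
      φ.symm (T.e r) ∈ S.wt β := by
    rintro r _ rfl
    refine PreSystem.mem_wt.2 fun h => φ.injective ?_
    rw [← hbr, φ.apply_symm_apply, map_smul, φ.apply_symm_apply]
    exact T.c_e (ψ h) r
  -- As α_j = (α_j + α_i) + (-α_i) is a sum of two simple roots of the target, the image of e_j is a
  -- multiple of [e'_p, e'_q].
  have hfwd : φ (S.e j) ∈ T.wt (T.root q + 1 • T.root p) := by
    refine PreSystem.mem_wt.2 fun h => ?_
    obtain ⟨h, rfl⟩ := ψ.surjective h
    rw [hbr, S.c_e, map_smul]
    congr 1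
    have h3 := LinearMap.congr_fun hp h
    have h4 := LinearMap.congr_fun hq h
    change R'.root p (ψ h) = -(R.root i h) at h3
    change R'.root q (ψ h) = R.root j h + R.root i h at h4
    change R.root j h = R'.root q (ψ h) + (1 • R'.root p) (ψ h)
    rw [one_smul, h3, h4]
    ring
  obtain ⟨t, ht⟩ := Submodule.mem_span_singleton.1 (T.wt_string (fun h2 => by omega) hfwd)
  have hx := hback p _ hp
  have hy := hback q _ hq
  obtain ⟨a, ha'⟩ := Submodule.mem_span_singleton.1 ((S.wt_neg_root i).le hx)
  have hy' : φ.symm (T.e q) ∈ S.wt (S.root j + 1 • S.root i) := by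
    rw [one_smul]
    exact hy
  obtain ⟨b, hb⟩ := Submodule.mem_span_singleton.1 (S.wt_string (fun h2 => by omega) hy')
  -- Pulled back, e'_p and e'_q are multiples of f_i and [e_i, e_j], whose bracket vanishes; this
  -- forces e_j = 0.
  have hzero : bracket (φ.symm (T.e p)) (φ.symm (T.e q)) = 0 := by
    rw [← ha', ← hb, map_smul, map_smul, LinearMap.smul_apply, PreSystem.f_ev hj.symm, hc,
      zero_smul, smul_zero, smul_zero]
  refine hred.e_ne_zero j (φ.injective ?_)
  rw [map_zero, ← ht, PreSystem.ev_succ, PreSystem.ev_zero, ← φ.apply_symm_apply (T.e p),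
    ← φ.apply_symm_apply (T.e q), ← hφ.map_bracket, hzero, map_zero, smul_zero]

end contragredient

end SuperLie

end

theorem mainTheorem8 {ℓ : ℕ} (A : Matrix (Fin ℓ) (Fin ℓ) ℂ) (τ : Finset (Fin ℓ))
    {H : Type*} [AddCommGroup H] [Module ℂ H] (R : Realization A H) (i : Fin ℓ) :
    ((CondA τ R i → CondB τ R i) ∧ (CondB τ R i → CondC τ R i)) ∧
    (A i i ≠ 0 →
      (CondA τ R i ↔ CondB τ R i) ∧ (CondB τ R i ↔ CondC τ R i) ∧
      (CondC τ R i ↔ CondD τ A i) ∧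
      (∀ S, IsReflexion (Contragredient.roots τ R) (Set.range R.root) (R.root i) S →
        S = Set.range (fun j => reflection R i (R.root j)) ∧
        ∀ j, IsReflexionValue (Contragredient.roots τ R) (R.root i) (R.root j)
          (reflection R i (R.root j)))) ∧
    (A i i = 0 →
      (i ∉ τ → (CondC τ R i ↔ ∀ j, A i j = 0)) ∧
      (i ∈ τ → CondC τ R i) ∧
      (CondA τ R i ↔ CondD τ A i) ∧
      (CondD τ A i →
        ∀ S, IsReflexion (Contragredient.roots τ R) (Set.range R.root) (R.root i) S →
          S = Set.range (isotropicReflexion R i) ∧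
          ∀ j, IsReflexionValue (Contragredient.roots τ R) (R.root i) (R.root j)
            (isotropicReflexion R i j))) := by
  have hAB : CondA τ R i → CondB τ R i := CondA.condB τ R
  have hBC : CondB τ R i → CondC τ R i := CondB.condC τ R
  have hDA : CondD τ A i → CondA τ R i := CondD.condA τ R
  have hP1 : A i i = 0 → i ∉ τ → CondC τ R i → ∀ j, A i j = 0 := by
    intro ha hi hC j
    by_cases hj : j = i
    · rw [hj, ha]
    · obtain ⟨m, hm, -⟩ := hC.even τ R hi hj
      rw [ha, mul_zero, neg_zero, mul_eq_zero] at hm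
      exact hm.resolve_left two_ne_zero
  refine ⟨⟨hAB, hBC⟩, fun ha => ?_, fun ha => ?_⟩
  · have hCD : CondC τ R i → CondD τ A i := CondC.condD τ R ha
    refine ⟨⟨hAB, fun h => hDA (hCD (hBC h))⟩, ⟨hBC, fun h => hAB (hDA (hCD h))⟩,
      ⟨hCD, fun h => hBC (hAB (hDA h))⟩, fun S hS => ?_⟩
    -- The reflexion at hand is itself condition (b), so (d) holds and determines the string
    -- lengths.
    obtain ⟨m, hm, hmA, -⟩ := (hCD (hBC ⟨S, hS⟩)).exists_stringLength τ R
    refine reflexion_unique τ R hm (g := fun j => reflection R i (R.root j)) ?_ (fun j hj => ?_) hS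
    · rw [reflection, R.root_coroot, mul_div_assoc, div_self ha]
      module
    · rw [reflection, R.root_coroot, ← Nat.cast_smul_eq_nsmul ℂ, hmA ha j hj, neg_smul,
        sub_eq_add_neg]
  · refine ⟨fun hi => ⟨hP1 ha hi, fun h => condC_of_isotropic τ R ha fun _ => h⟩,
      fun hi => condC_of_isotropic τ R ha fun h => absurd hi h,
      ⟨fun h => ⟨fun _ hi => hP1 ha hi (hBC (hAB h)), fun j hj => h.symm_of_isotropic τ R ha hj,
        fun h0 => absurd ha h0, fun h0 => absurd ha h0⟩, hDA⟩, fun hD S hS => ?_⟩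
    obtain ⟨m, hm, -, hmA⟩ := hD.exists_stringLength τ R
    refine reflexion_unique τ R hm ?_ (fun j hj => ?_) hS
    · rw [isotropicReflexion, if_pos rfl]
    · rw [isotropicReflexion, if_neg hj, hmA ha j hj]
      split_ifs
      · rw [zero_smul, add_zero]
      · rw [one_smul]
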